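/- All point sets are finite sets in the plane. Point $c$ is to the left of the directed line from $a$ to $b$ if $(b_1-a_1)(c_2-a_2)-(b_2-a_2)(c_1-a_1)>0$; the sign of this number is the orientation of $(a,b,c)$. Two sets have the same order type if some bijection between them preserves the orientation of all triplets. A drawing of $\mathcal X$ is a set of points with integer coordinates that has the same order type as $\mathcal X$. Let $R_k$ be the set of vertices of the convex hull of $\mathcal X$, let $R_{k-1}$ be the set of vertices of the convex hull of $\mathcal X\setminus R_k$, and so on, where $k$ is the number of convex layers obtained in this way, so that $R_1$ is the most internal layer; put $\mathcal X_j=R_1\cup\dots\cup R_j$. The set $\mathcal X$ is nested almost convex if for $1\le j\le k$ no three points of $\mathcal X_j$ are collinear, the vertices of the convex hull of $\mathcal X_j$ are the points of $R_j$, and the interior of every triangle with vertices in $R_j$ contains exactly one point of $\mathcal X_{j-1}$. It is of type 1 if $|R_j|=2^j$ for $1\le j\le k$, and of type 2 if $k\ge1$, $|R_1|=1$ and $|R_j|=3\cdot2^{j-2}$ for $2\le j\le k$. Trees. Let $T_1(k)$ be the complete binary tree with $2^{k+1}-1$ nodes; its $j$-level consists of the nodes at distance $j$ from the root. For $k\ge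 1$ let $T_2(k)$ be the tree whose root has three children, each the root of a complete binary tree with $2^{k-1}-1$ nodes (just the root if $k=1$); its $j$-level consists of the nodes at distance $j-1$ from the root. A type 1 labeling of a type 1 set with $k$ layers labels the nodes of $T_1(k)$ other than the root bijectively with its points; a type 2 labeling of a type 2 set with $k$ layers labels all nodes of $T_2(k)$ bijectively with its points. Write $x_u$ for the label of $u$, $\mathcal X_u$ for the set of labels of the proper descendants of $u$, and $\overline{\mathcal X_u}$ for the set of labels of $u$ and its descendants; $u(l),u(r)$ are the left and right children of $u$. A labeling is nested if, for $1\le j\le k$, the labels of the $j$-level are the points of $R_j$ and their left to right order is the counterclockwise order of $R_j$. It is an internal separation if for every node $u$ with two children every point of $\mathcal X\setminus\mathcal X_u$ is to the left of every directed line from a point of $\overline{\mathcal X_{u(l)}}$ to a point of $\overline{\mathcal X_{u(r)}}$, and, if the root has three children, for every two cyclically consecutive children $c,c'$ of the root every point of $\mathcal X$ outside $\overline{\mathcal X_c}\cup\overline{\mathcal X_{c'}}$ is to the left of every directed line from a point of $\overline{\mathcal X_c}$ to a point of $\overline{\mathcal X_{c'}}$. It is an external separation if for every node $u$ with two children, every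 point of $\mathcal X\setminus\overline{\mathcal X_u}$ is to the left of every directed line from a point of $\overline{\mathcal X_{u(l)}}$ to $x_u$ and of every directed line from $x_u$ to a point of $\overline{\mathcal X_{u(r)}}$. Construction. For a triple $\alpha=(q,o,p)$ of points put $L(\alpha,c)=o+c(q-o)$ and $R(\alpha,c)=o+c(p-o)$. Let the root of $T_1(k)$ have the corner $((0,2\cdot5^{k+1}),(0,0),(2\cdot5^{k+1},0))$, and if $u$ has the corner $\alpha_u$, let $$\alpha_{u(l)}=(L(\alpha_u,\tfrac25),L(\alpha_u,\tfrac15),R(\alpha_u,\tfrac15)),\qquad \alpha_{u(r)}=(L(\alpha_u,\tfrac15),R(\alpha_u,\tfrac15),R(\alpha_u,\tfrac25)).$$ For a leaf $v$ of $T_1(k+1)$ that is a child of the leaf $u$ of $T_1(k)$, let $y_v=L(\alpha_u,\frac15)$ if $v$ is a left child and $y_v=R(\alpha_u,\frac15)$ if it is a right child. For a node $u$ of $T_1(k)$ let $x_u$ be the midpoint of $y_v$ and $y_{v'}$, where $v$ and $v'$ are the leftmost and rightmost leaves of $T_1(k+1)$ below $u$. Let $D_1(k)$ be the set of the points $x_u$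 for the nodes $u\ne$ root of $T_1(k)$. For $k\ge1$ let $D_2(k)\subseteq D_1(k)$ be the set of the points $x_u$ for which $u$ is equal to or below the left child $w_1$ of the root, or equal to or below the left child of the right child of the root; in these nodes, let the left child of the right child of the root become the third child of $w_1$, which identifies the tree on them, with root $w_1$, with $T_2(k)$. Theorem. (1) For every $k\ge0$, the points $y_v$ are in convex position, in counterclockwise order from left to right. The set $D_1(k)$ has $2^{k+1}-2$ points, with integer coordinates of absolute value at most $2\cdot5^{k+1}$; it is a nested almost convex set, of type 1 with $k$ layers, and its labeling by $u\mapsto x_u$ is a type 1 labeling that is nested, an internal separation and an external separation. (2) For every $k\ge1$, the set $D_2(k)$ has $3\cdot2^{k-1}-2$ points; it is a nested almost convex set, of type 2 with $k$ layers, and its induced labeling by $T_2(k)$ is a type 2 labeling that is nested, an internal separation and an external separation. (3) Let $\mathcal X$ be any nested almost convex set, with $n$ points and $k$ convex layers. Then either $\mathcal X$ is of type 1, $n=2^{k+1}-2$ and $D:=D_1(k)$ is a drawing of $\mathcal X$, or $\mathcal X$ is of type 2, $n=3\cdot2^{k-1}-2$ and $D:=D_2(k)$ is a drawing of $\mathcal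 X$. The coordinates of the points of $D$ have absolute value at most $C\,n^{\log_25}$, where $C$ is an absolute constant. Moreover, one fixed random access machine program (unit-cost addition, subtraction, multiplication, integer division, comparison and indirect memory access, on words of $O(\log n)$ bits) computes from $n$, for every such $n$, the list of the points of $D$ in $O(n)$ steps. -/

import Mathlib

namespace NestedDrawing

noncomputable section

/-! ## Points, order type, drawings -/

/-- The Euclidean plane, in coordinates. -/
abbrev Plane := ℝ × ℝ

/-- The orientation determinant: positive iff `c` is to the left of the directed line from `a`
to `b`, negative iff it is to the right, zero iff the three points are collinear. -/
def orient (a b c : Plane) : ℝ :=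
  (b.1 - a.1) * (c.2 - a.2) - (b.2 - a.2) * (c.1 - a.1)

/-- No three points are collinear. -/
def GeneralPosition (X : Set Plane) : Prop :=
  ∀ a ∈ X, ∀ b ∈ X, ∀ c ∈ X, a ≠ b → a ≠ c → b ≠ c → ¬ Collinear ℝ {a, b, c}

/-- There is a bijection that preserves the orientation of all triplets. -/
def SameOrderType (X Y : Set Plane) : Prop :=
  ∃ f : X ≃ Y, ∀ a b c : X,
    SignType.sign (orient (f a) (f b) (f c)) = SignType.sign (orient a b c)

/-- The point has integer coordinates. -/
def IsIntegerPoint (p : Plane) : Prop := ∃ a b : ℤ, p = ((a : ℝ), (b : ℝ))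

/-- `D` is a drawing of `X`: integer coordinates and the order type of `X`. -/
def IsDrawing (D X : Set Plane) : Prop :=
  (∀ p ∈ D, IsIntegerPoint p) ∧ SameOrderType X D

/-! ## Convex layers and nested almost convex sets -/

/-- The vertices of the convex hull. -/
def hullVertices (X : Set Plane) : Set Plane := (convexHull ℝ X).extremePoints ℝ

/-- Remove the vertices of the convex hull. -/
def peel (X : Set Plane) : Set Plane := X \ hullVertices X

/-- The number of convex layers of a finite set. -/
def numLayers (X : Set Plane) : ℕ := sInf {i | peel^[i] X = ∅}

/-- `layer X j` is the `j`-th convex layer `R_j`, for `1 ≤ j ≤ numLayers X`, where `R_1` is the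
most internal one. -/
def layer (X : Set Plane) (j : ℕ) : Set Plane := hullVertices (peel^[numLayers X - j] X)

/-- `X_j = R_1 ∪ ⋯ ∪ R_j`. -/
def innerLayers (X : Set Plane) (j : ℕ) : Set Plane :=
  {p | ∃ i, 1 ≤ i ∧ i ≤ j ∧ p ∈ layer X i}

/-- Nested almost convex (finite) point sets. -/
structure IsNestedAlmostConvex (X : Set Plane) : Prop where
  finite : X.Finite
  generalPosition : ∀ j, 1 ≤ j → j ≤ numLayers X → GeneralPosition (innerLayers X j)
  vertices : ∀ j, 1 ≤ j → j ≤ numLayers X → hullVertices (innerLayers X j) = layer X j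
  triangle : ∀ j, 1 ≤ j → j ≤ numLayers X →
    ∀ a ∈ layer X j, ∀ b ∈ layer X j, ∀ c ∈ layer X j, a ≠ b → a ≠ c → b ≠ c →
      ∃! p, p ∈ innerLayers X (j - 1) ∧ p ∈ interior (convexHull ℝ {a, b, c})

/-- `|R_j| = 2 ^ j` for all layers. -/
def IsTypeOne (X : Set Plane) : Prop :=
  ∀ j, 1 ≤ j → j ≤ numLayers X → (layer X j).ncard = 2 ^ j

/-- `|R_1| = 1` and `|R_j| = 3 * 2 ^ (j - 2)` for the other layers. -/
def IsTypeTwo (X : Set Plane) : Prop :=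
  1 ≤ numLayers X ∧ (layer X 1).ncard = 1 ∧
    ∀ j, 2 ≤ j → j ≤ numLayers X → (layer X j).ncard = 3 * 2 ^ (j - 2)

/-! ## Trees and labelings

A node of an ordered rooted tree is the list of the indices of the edges on the path from the
root to the node: `[]` is the root and `u ++ [i]` is the `i`-th child of `u`. For a node with two
children, `u ++ [0]` is the left one and `u ++ [1]` the right one. The node `v` is `u` or a
descendant of `u` iff `u` is a prefix of `v`. Among the nodes of one level, the left to right
order is the lexicographic order. -/

/-- The complete binary tree with `2 ^ (k + 1) - 1` nodes. -/
def tree1 (k : ℕ) : Set (List ℕ) := {w | w.length ≤ k ∧ ∀ i ∈ w, i < 2}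

/-- The `j`-level of `tree1 k`. -/
def level1 (k j : ℕ) : Set (List ℕ) := {w ∈ tree1 k | w.length = j}

/-- The tree whose root has three children, each of which is the root of a complete binary tree
with `2 ^ (k - 1) - 1` nodes. -/
def tree2 (k : ℕ) : Set (List ℕ) :=
  {w | w.length < k ∧ (w = [] ∨ ∃ a v, w = a :: v ∧ a < 3 ∧ ∀ i ∈ v, i < 2)}

/-- The `j`-level of `tree2 k`. -/
def level2 (k j : ℕ) : Set (List ℕ) := {w ∈ tree2 k | w.length + 1 = j}

/-- `x` gives the labels of a type 1 labeling of `X`: the nodes of `tree1 k`, other than the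
root, are labeled bijectively by the points of `X`. -/
def IsTypeOneLabeling (k : ℕ) (x : List ℕ → Plane) (X : Set Plane) : Prop :=
  numLayers X = k ∧ IsTypeOne X ∧ Set.BijOn x (tree1 k \ {[]}) X

/-- `x` gives the labels of a type 2 labeling of `X`: all the nodes of `tree2 k` are labeled
bijectively by the points of `X`. -/
def IsTypeTwoLabeling (k : ℕ) (x : List ℕ → Plane) (X : Set Plane) : Prop :=
  numLayers X = k ∧ IsTypeTwo X ∧ Set.BijOn x (tree2 k) X

/-- The labels of the `j`-level are the points of `R_j`, and the left to right order of the level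
is the counterclockwise order of these points. -/
def IsNestedLabeling (level : ℕ → Set (List ℕ)) (x : List ℕ → Plane) (X : Set Plane) : Prop :=
  ∀ j, 1 ≤ j → j ≤ numLayers X →
    x '' level j = layer X j ∧
    ∀ u ∈ level j, ∀ v ∈ level j, ∀ w ∈ level j, u < v → v < w → 0 < orient (x u) (x v) (x w)

/-- The labels of `u` and of its descendants; `N` is the set of the labeled nodes. -/
def closedSubtree (N : Set (List ℕ)) (x : List ℕ → Plane) (u : List ℕ) : Set Plane :=
  x '' {v ∈ N | u <+: v}

/-- `(c, c')` is a pair of cyclically consecutive children of `u`: the left and the right child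
if `u` has two children; the first and second, the second and third, or the third and first child
if `u` has three children. -/
def ConsecutiveChildren (N : Set (List ℕ)) (u c c' : List ℕ) : Prop :=
  (c = u ++ [0] ∧ c' = u ++ [1]) ∨
  (u ++ [2] ∈ N ∧
    ((c = u ++ [1] ∧ c' = u ++ [2]) ∨ (c = u ++ [2] ∧ c' = u ++ [0])))

/-- Internal separation. For a node `u` with two children, the points that lie in neither of the
two closed subtrees of its children are exactly the points that do not label a descendant
of `u`. -/
def InternalSeparation (N : Set (List ℕ)) (x : List ℕ → Plane) (X : Set Plane) : Prop :=
  ∀ u c c', ConsecutiveChildren N u c c' →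
    ∀ a ∈ closedSubtree N x c, ∀ b ∈ closedSubtree N x c',
      ∀ z ∈ X \ (closedSubtree N x c ∪ closedSubtree N x c'), 0 < orient a b z

/-- External separation. (For the root, no point `z` is left and the condition is void.) -/
def ExternalSeparation (N : Set (List ℕ)) (x : List ℕ → Plane) (X : Set Plane) : Prop :=
  ∀ u, ∀ z ∈ X \ closedSubtree N x u,
    (∀ a ∈ closedSubtree N x (u ++ [0]), 0 < orient a (x u) z) ∧
    (∀ b ∈ closedSubtree N x (u ++ [1]), 0 < orient (x u) b z)

/-! ## The recursive corner construction -/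

/-- A corner `(q, o, p)` with apex `o`. -/
structure Corner where
  q : Plane
  o : Plane
  p : Plane

/-- The point of the segment `oq` at distance `c * |oq|` from `o`. -/
def leftPoint (α : Corner) (c : ℝ) : Plane := AffineMap.lineMap α.o α.q c

/-- The point of the segment `op` at distance `c * |op|` from `o`. -/
def rightPoint (α : Corner) (c : ℝ) : Plane := AffineMap.lineMap α.o α.p c

/-- The corner of the left (`i = 0`) or right child of a node with corner `α`. -/
def childCorner (α : Corner) (i : ℕ) : Corner :=
  if i = 0 then ⟨leftPoint α (2 / 5), leftPoint α (1 / 5), rightPoint α (1 / 5)⟩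
  else ⟨leftPoint α (1 / 5), rightPoint α (1 / 5), rightPoint α (2 / 5)⟩

/-- The corner of the root of `tree1 k`. -/
def rootCorner (k : ℕ) : Corner := ⟨(0, 2 * 5 ^ (k + 1)), (0, 0), (2 * 5 ^ (k + 1), 0)⟩

/-- The corner of a node `u` of `tree1 k`. -/
def corner (k : ℕ) (u : List ℕ) : Corner := u.foldl childCorner (rootCorner k)

/-- The point `y_v` of a leaf `v = u ++ [i]` of `tree1 (k + 1)`, where `u` is a leaf of
`tree1 k`. -/
def leafPoint (k : ℕ) (v : List ℕ) : Plane :=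
  if v.getLast? = some 0 then leftPoint (corner k v.dropLast) (1 / 5)
  else rightPoint (corner k v.dropLast) (1 / 5)

/-- The point `y_v` for the leftmost leaf `v` of `tree1 (k + 1)` below `u`. -/
def firstPoint (k : ℕ) (u : List ℕ) : Plane :=
  leafPoint k (u ++ List.replicate (k + 1 - u.length) 0)

/-- The point `y_v` for the rightmost leaf `v` of `tree1 (k + 1)` below `u`. -/
def lastPoint (k : ℕ) (u : List ℕ) : Plane :=
  leafPoint k (u ++ List.replicate (k + 1 - u.length) 1)

/-- The point `x_u`. -/
def nodePoint (k : ℕ) (u : List ℕ) : Plane := midpoint ℝ (firstPoint k u) (lastPoint k u)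

/-- The constructed point set: the points `x_u` for the nodes `u` of `tree1 k` other than the
root. -/
def drawing1 (k : ℕ) : Set Plane := nodePoint k '' (tree1 k \ {[]})

/-- The subset for type 2: the points `x_u` where `u` is the left child `[0]` of the root, or
below it, or `u` is the left child `[1, 0]` of the right child of the root, or below it. -/
def drawing2 (k : ℕ) : Set Plane :=
  nodePoint k '' {u ∈ tree1 k | [0] <+: u ∨ [1, 0] <+: u}

/-- The isomorphism from `tree2 k` to the tree on the nodes used in `drawing2 k`, in which
`[1, 0]` becomes the third child of `[0]`. -/
def embed2 : List ℕ → List ℕ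
  | [] => [0]
  | a :: v => if a = 2 then 1 :: 0 :: v else 0 :: a :: v

/-! ## Random access machines

A program is a structured program over integer registers and an integer memory with indirect
addressing. Each arithmetic operation, memory access and comparison takes one step. All the
integers that are written or used as addresses must have absolute value at most the bound `W`, so
that a machine with words of `O(log W)` bits can execute the program. -/

/-- The contents of the registers and of the memory. -/
structure MachineState where
  reg : ℕ → ℤ
  mem : ℕ → ℤ

/-- An operand is a constant or a register. -/
inductive Operand
  | const (z : ℤ)
  | reg (r : ℕ)

def Operand.val (s : MachineState) : Operand → ℤ
  | const z => z
  | reg r => s.reg r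

inductive Arith
  | add
  | sub
  | mul
  | div

/-- Here `div` is integer division. -/
def Arith.eval : Arith → ℤ → ℤ → ℤ
  | add, a, b => a + b
  | sub, a, b => a - b
  | mul, a, b => a * b
  | div, a, b => a / b

inductive Program
  /-- do nothing -/
  | skip
  /-- `r := a op b` -/
  | assign (r : ℕ) (op : Arith) (a b : Operand)
  /-- `r := mem[a]` -/
  | load (r : ℕ) (a : Operand)
  /-- `mem[a] := b` -/
  | store (a b : Operand)
  /-- first `P`, then `Q` -/
  | seq (P Q : Program)
  /-- if `a < b` then `P` else `Q` -/
  | ite (a b : Operand) (P Q : Program)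
  /-- while `a < b` do `P` -/
  | loop (a b : Operand) (P : Program)

/-- `Exec W P s s' t`: the program `P`, started in the state `s`, halts in the state `s'` after
`t` steps, and all words that occur have absolute value at most `W`. -/
inductive Exec (W : ℕ) : Program → MachineState → MachineState → ℕ → Prop
  | skip (s : MachineState) : Exec W .skip s s 0
  | assign (s : MachineState) (r : ℕ) (op : Arith) (a b : Operand)
      (h : |op.eval (a.val s) (b.val s)| ≤ (W : ℤ)) :
      Exec W (.assign r op a b) s
        { s with reg := Function.update s.reg r (op.eval (a.val s) (b.val s)) } 1
  | load (s : MachineState) (r : ℕ) (a : Operand) (h0 : 0 ≤ a.val s) (hW : a.val s ≤ (W : ℤ)) :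
      Exec W (.load r a) s
        { s with reg := Function.update s.reg r (s.mem (a.val s).toNat) } 1
  | store (s : MachineState) (a b : Operand) (h0 : 0 ≤ a.val s) (hW : a.val s ≤ (W : ℤ))
      (h : |b.val s| ≤ (W : ℤ)) :
      Exec W (.store a b) s
        { s with mem := Function.update s.mem (a.val s).toNat (b.val s) } 1
  | seq (P Q : Program) (s s' s'' : MachineState) (t t' : ℕ)
      (hP : Exec W P s s' t) (hQ : Exec W Q s' s'' t') : Exec W (.seq P Q) s s'' (t + t')
  | ite_true (a b : Operand) (P Q : Program) (s s' : MachineState) (t : ℕ)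
      (h : a.val s < b.val s) (hP : Exec W P s s' t) : Exec W (.ite a b P Q) s s' (t + 1)
  | ite_false (a b : Operand) (P Q : Program) (s s' : MachineState) (t : ℕ)
      (h : ¬ a.val s < b.val s) (hQ : Exec W Q s s' t) : Exec W (.ite a b P Q) s s' (t + 1)
  | loop_true (a b : Operand) (P : Program) (s s' s'' : MachineState) (t t' : ℕ)
      (h : a.val s < b.val s) (hP : Exec W P s s' t) (hL : Exec W (.loop a b P) s' s'' t') :
      Exec W (.loop a b P) s s'' (t + t' + 1)
  | loop_false (a b : Operand) (P : Program) (s : MachineState)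
      (h : ¬ a.val s < b.val s) : Exec W (.loop a b P) s s 1

/-- The initial state on input `n`: register `0` holds `n`, everything else is `0`. -/
def inputState (n : ℕ) : MachineState where
  reg := fun r => if r = 0 then (n : ℤ) else 0
  mem := fun _ => 0

/-- The output list of `n` integer points: the coordinates of the `i`-th point, `i < n`, are in
the memory cells `2 * i` and `2 * i + 1`. -/
def outputPoints (n : ℕ) (s : MachineState) : Set Plane :=
  {p | ∃ i < n, p = ((s.mem (2 * i) : ℝ), (s.mem (2 * i + 1) : ℝ))}

end

end NestedDrawing

open NestedDrawing

namespace NestedDrawing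

/-! ## Orientation of triples -/

/-! The order type is encoded combinatorially. Nodes are binary words; for type 2 they are the words
equal to or below `[0]` or `[1, 0]`. `PosTriple` collects the triples of words whose orientation is
forced by internal and external separation. By `posTriple_trichotomy`, any three distinct words form
such a triple in one of their two cyclic orders. Hence two separated labelings with the same nodes
give the same order type (`Separated.sameOrderType`), and it remains to find a separated labeling of
every nested almost convex set and of the construction.

For an arbitrary set, let `R` be a layer and `Y` the points inside it. A fan triangulation gives
`|R| = |Y| + 2` if `|R| ≥ 3` (`LayerPair.ncard_eq`). So the innermost layer has one or two points,
and from the layer of two points, or from the triangle around one point, the layers double in size.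
The triangle cut off at a vertex of `R` contains one point of `Y`, its ear point, which is a hull
vertex of `Y`. At most two vertices share an ear point, and these are adjacent, so by counting the
vertices of `R` are paired up by twin edges (`LayerPair.exists_twins`). A twin edge together with
its ear point behaves like a single point: no line through two other points separates the three
(`IsTwinEdge.sameSide`), since otherwise one triangle would contain two points of `Y`. The ends of
the twin edge can therefore label the children of the node of the ear point, and new orientations
are inherited from the parents (`LayerPair.exists_extension`).

For the construction, affine coordinates are taken with respect to the corner of a node `u`. The
labels of `u` and its descendants have nonnegative coordinates with sum below `1/4`; all other
labels have nonnegative coordinates with sum at least `3/4`. Separation then reduces to estimates of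
linear forms (`separated_nodePoint`). A separated labeling by a suitable forest in turn makes a set
nested almost convex, the point inside a triangle being the label of the meet of two of its vertices
(`Forest.isNestedAlmostConvex_image`). The type 2 set is the restriction to a subforest, so it needs
no further geometry.

All corners have the form `(o + 2we, o, o + 2wf)` with integer data and `w` a power of `5`. The
program keeps a queue of these data, writes the point of the next node and appends its two children.
The grid bound is `5 ^ j = (2 ^ j) ^ logb 2 5`, and all words are polynomial in `n`. -/

theorem orient_rotate (a b c : Plane) : orient a b c = orient b c a := by
  unfold orient; ring

theorem orient_swap (a b c : Plane) : orient b a c = -orient a b c := by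
  unfold orient; ring

theorem orient_swap_right (a b c : Plane) : orient a c b = -orient a b c := by
  unfold orient; ring

@[simp] theorem orient_self_left (a c : Plane) : orient a a c = 0 := by unfold orient; ring

@[simp] theorem orient_self_right (a c : Plane) : orient a c c = 0 := by unfold orient; ring

@[simp] theorem orient_self_outer (a c : Plane) : orient a c a = 0 := by unfold orient; ring

theorem orient_combo (a b x y : Plane) {s t : ℝ} (h : s + t = 1) :
    orient a b (s • x + t • y) = s * orient a b x + t * orient a b y := by
  obtain rfl : s = 1 - t := by linarith
  simp only [orient, Prod.fst_add, Prod.snd_add, Prod.smul_fst, Prod.smul_snd, smul_eq_mul]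
  ring

theorem convex_orient_nonneg (a b : Plane) : Convex ℝ {z | 0 ≤ orient a b z} := by
  intro x hx y hy s t hs ht h
  simp only [Set.mem_ofPred_eq] at *
  rw [orient_combo _ _ _ _ h]
  positivity

theorem convex_orient_pos (a b : Plane) : Convex ℝ {z | 0 < orient a b z} := by
  intro x hx y hy s t hs ht h
  simp only [Set.mem_ofPred_eq] at *
  rw [orient_combo _ _ _ _ h]
  rcases hs.eq_or_lt with rfl | hs
  · obtain rfl : t = 1 := by linarith
    simpa using hy
  · nlinarith [mul_pos hs hx, mul_nonneg ht hy.le]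

theorem orient_nonneg_of_mem_convexHull {a b z : Plane} {S : Set Plane}
    (h : ∀ p ∈ S, 0 ≤ orient a b p) (hz : z ∈ convexHull ℝ S) : 0 ≤ orient a b z :=
  convexHull_min (t := {z | 0 ≤ orient a b z}) h (convex_orient_nonneg a b) hz

/-- The Grassmann–Plücker relation `key` makes the angular order around `o` transitive in the
half-plane to the left of `ox`. -/
theorem orient_trans {o x a b c : Plane} (hxa : 0 < orient o x a) (hxb : 0 < orient o x b)
    (hxc : 0 < orient o x c) (hab : 0 < orient o a b) (hbc : 0 < orient o b c) :
    0 < orient o a c := by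
  have key : orient o x b * orient o a c
      = orient o x a * orient o b c + orient o x c * orient o a b := by
    unfold orient; ring
  have : 0 < orient o x b * orient o a c := by rw [key]; positivity
  exact (pos_iff_pos_of_mul_pos this).1 hxb

theorem collinear_iff_orient (a b c : Plane) : Collinear ℝ {a, b, c} ↔ orient a b c = 0 := by
  rw [collinear_iff_of_mem (p₀ := a) (by simp)]
  constructor
  · rintro ⟨v, hv⟩
    obtain ⟨r, hr⟩ := hv b (by simp)
    obtain ⟨s, hs⟩ := hv c (by simp)
    simp only [vadd_eq_add] at hr hs
    rw [hr, hs]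
    simp only [orient, Prod.fst_add, Prod.snd_add, Prod.smul_fst, Prod.smul_snd, smul_eq_mul]
    ring
  · intro h
    by_cases hab : a = b
    · subst hab
      refine ⟨c - a, ?_⟩
      intro p hp
      simp only [Set.mem_insert_iff, Set.mem_singleton_iff, or_self_left] at hp
      rcases hp with rfl | rfl
      · exact ⟨0, by simp⟩
      · exact ⟨1, by simp⟩
    · refine ⟨b - a, ?_⟩
      have hc : ∃ r : ℝ, c = r • (b - a) +ᵥ a := by
        unfold orient at h
        by_cases h1 : b.1 - a.1 = 0
        · have h2 : b.2 - a.2 ≠ 0 := fun h2 => hab (Prod.ext (by linarith) (by linarith))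
          refine ⟨(c.2 - a.2) / (b.2 - a.2), Prod.ext ?_ ?_⟩
          · have : (b.2 - a.2) * (c.1 - a.1) = 0 := by rw [h1] at h; linarith
            have := (mul_eq_zero.1 this).resolve_left h2
            simp [h1]; linarith
          · simp [h2]
        · refine ⟨(c.1 - a.1) / (b.1 - a.1), Prod.ext ?_ ?_⟩
          · simp [h1]
          · simp only [vadd_eq_add, Prod.snd_add, Prod.smul_snd, Prod.snd_sub, smul_eq_mul]
            field_simp
            linarith
      intro p hp
      simp only [Set.mem_insert_iff, Set.mem_singleton_iff] at hp
      rcases hp with rfl | rfl | rfl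
      · exact ⟨0, by simp⟩
      · exact ⟨1, by simp⟩
      · exact hc

theorem GeneralPosition.orient_ne_zero {X : Set Plane} (h : GeneralPosition X) {a b c : Plane}
    (ha : a ∈ X) (hb : b ∈ X) (hc : c ∈ X) (hab : a ≠ b) (hac : a ≠ c) (hbc : b ≠ c) :
    orient a b c ≠ 0 :=
  fun h0 => h a ha b hb c hc hab hac hbc ((collinear_iff_orient a b c).2 h0)

/-! ## Triangles -/

/-- The point `p` is inside the positively oriented triangle `abc`. -/
def InTriangle (a b c p : Plane) : Prop :=
  0 < orient a b p ∧ 0 < orient b c p ∧ 0 < orient c a p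

theorem orient_add_add (a b c p : Plane) :
    orient a b p + orient b c p + orient c a p = orient a b c := by
  unfold orient; ring

theorem InTriangle.rotate {a b c p : Plane} (h : InTriangle a b c p) : InTriangle b c a p :=
  ⟨h.2.1, h.2.2, h.1⟩

theorem InTriangle.orient_pos {a b c p : Plane} (h : InTriangle a b c p) : 0 < orient a b c := by
  rw [← orient_add_add a b c p]
  exact add_pos (add_pos h.1 h.2.1) h.2.2

theorem barycentric (a b c p : Plane) (h : orient a b c ≠ 0) :
    p = (orient b c p / orient a b c) • a + (orient c a p / orient a b c) • b
      + (orient a b p / orient a b c) • c := by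
  refine Prod.ext ?_ ?_ <;>
  · simp only [Prod.fst_add, Prod.snd_add, Prod.smul_fst, Prod.smul_snd, smul_eq_mul]
    field_simp
    unfold orient
    ring

theorem mem_of_orient_nonneg {a b c p : Plane} (h : 0 < orient a b c) (h1 : 0 ≤ orient a b p)
    (h2 : 0 ≤ orient b c p) (h3 : 0 ≤ orient c a p) {S : Set Plane} (hS : Convex ℝ S)
    (ha : a ∈ S) (hb : b ∈ S) (hc : c ∈ S) : p ∈ S := by
  rw [barycentric a b c p h.ne']
  have := hS.sum_mem (t := (Finset.univ : Finset (Fin 3)))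
    (w := ![orient b c p / orient a b c, orient c a p / orient a b c,
      orient a b p / orient a b c]) (z := ![a, b, c]) ?_ ?_ ?_
  · simpa [Fin.sum_univ_three] using this
  · intro i _
    fin_cases i <;> simp <;> positivity
  · simp only [Fin.sum_univ_three, Matrix.cons_val_zero, Matrix.cons_val_one, Matrix.cons_val]
    field_simp
    rw [← orient_add_add a b c p]; ring
  · intro i _
    fin_cases i <;> simp [ha, hb, hc]

theorem InTriangle.mem_of_convex {a b c p : Plane} (h : InTriangle a b c p) {S : Set Plane}
    (hS : Convex ℝ S) (ha : a ∈ S) (hb : b ∈ S) (hc : c ∈ S) : p ∈ S :=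
  mem_of_orient_nonneg h.orient_pos h.1.le h.2.1.le h.2.2.le hS ha hb hc

theorem InTriangle.mem_convexHull {a b c p : Plane} (h : InTriangle a b c p) :
    p ∈ convexHull ℝ ({a, b, c} : Set Plane) :=
  h.mem_of_convex (convex_convexHull ℝ _) (subset_convexHull ℝ _ (by simp))
    (subset_convexHull ℝ _ (by simp)) (subset_convexHull ℝ _ (by simp))

theorem continuous_orient (a b : Plane) : Continuous fun p => orient a b p := by
  unfold orient
  fun_prop

theorem mem_interior_triangle {a b c : Plane} (h : 0 < orient a b c) (p : Plane) :
    p ∈ interior (convexHull ℝ ({a, b, c} : Set Plane)) ↔ InTriangle a b c p := by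
  constructor
  · have key : ∀ a b c : Plane, 0 < orient a b c →
        p ∈ interior (convexHull ℝ ({a, b, c} : Set Plane)) → 0 < orient a b p := by
      intro a b c h hp
      have hsub : convexHull ℝ ({a, b, c} : Set Plane) ⊆ {z | 0 ≤ orient a b z} := by
        refine convexHull_min ?_ (convex_orient_nonneg a b)
        intro z hz
        simp only [Set.mem_insert_iff, Set.mem_singleton_iff] at hz
        rcases hz with rfl | rfl | rfl <;> simp [h.le]
      have hp' : {z : Plane | 0 ≤ orient a b z} ∈ nhds p :=
        Filter.mem_of_superset (mem_interior_iff_mem_nhds.1 hp) hsub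
      -- Moving an interior point slightly away from `c`, parallel to `ac`, stays inside the closed
      -- half-plane of `ab`, so the inequality at the point itself is strict.
      have hc : Filter.Tendsto (fun ε : ℝ => p - ε • (c - a)) (nhdsWithin 0 (Set.Ioi 0))
          (nhds p) := by
        have : Continuous fun ε : ℝ => p - ε • (c - a) := by fun_prop
        have := (this.tendsto 0).mono_left (nhdsWithin_le_nhds (s := Set.Ioi 0))
        simpa using this
      obtain ⟨ε, hε, hε0⟩ := ((hc.eventually hp').and self_mem_nhdsWithin).exists
      have : orient a b (p - ε • (c - a)) = orient a b p - ε * orient a b c := by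
        simp only [orient, Prod.fst_sub, Prod.snd_sub, Prod.smul_fst, Prod.smul_snd, smul_eq_mul]
        ring
      rw [this] at hε
      have : 0 < ε * orient a b c := mul_pos hε0 h
      linarith
    intro hp
    refine ⟨key a b c h hp, key b c a (by rwa [← orient_rotate]) ?_,
      key c a b (by rwa [orient_rotate, ← orient_rotate, orient_rotate]) ?_⟩
    · rwa [show ({b, c, a} : Set Plane) = {a, b, c} by ext; simp; tauto]
    · rwa [show ({c, a, b} : Set Plane) = {a, b, c} by ext; simp; tauto]
  · intro hp
    have hopen : IsOpen {z | InTriangle a b c z} :=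
      ((isOpen_lt continuous_const (continuous_orient a b)).inter
        ((isOpen_lt continuous_const (continuous_orient b c)).inter
          (isOpen_lt continuous_const (continuous_orient c a))))
    exact interior_maximal (fun z (hz : InTriangle a b c z) => hz.mem_convexHull) hopen hp

/-! ## Vertices of the convex hull -/

theorem hullVertices_subset (Z : Set Plane) : hullVertices Z ⊆ Z := extremePoints_convexHull_subset

/-- A hull point other than `p` lies on a segment from `p` to some point of `H`, at a positive
parameter. If `p` were a proper convex combination of two hull points, these segments would express
`p` as a combination of points of `H`. -/
theorem mem_hullVertices_of_convex {Z H : Set Plane} {p : Plane} (hp : p ∈ Z) (hH : Convex ℝ H)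
    (hZ : ∀ z ∈ Z, z ≠ p → z ∈ H) (hpH : p ∉ H) : p ∈ hullVertices Z := by
  have hseg : ∀ x ∈ convexHull ℝ Z, x = p ∨ ∃ c ∈ H, ∃ t : ℝ, 0 < t ∧ t ≤ 1 ∧
      x = (1 - t) • p + t • c := by
    intro x hx
    by_cases hne : (Z \ {p}).Nonempty
    · rw [← Set.insert_sdiff_self_of_mem hp, convexHull_insert hne] at hx
      obtain ⟨q, hq, c, hc, hxs⟩ := mem_convexJoin.1 hx
      obtain rfl : q = p := hq
      obtain ⟨a, b, ha, hb, hab, rfl⟩ := hxs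
      have hcH : c ∈ H := convexHull_min (fun z hz => hZ z hz.1 hz.2) hH hc
      rcases hb.eq_or_lt with rfl | hb
      · left
        obtain rfl : a = 1 := by linarith
        simp
      · exact Or.inr ⟨c, hcH, b, hb, by linarith, by rw [← hab]; simp⟩
    · rw [Set.not_nonempty_iff_eq_empty, Set.sdiff_eq_empty] at hne
      exact Or.inl (by simpa using convexHull_mono (𝕜 := ℝ) hne hx)
  refine mem_extremePoints_iff_left.2 ⟨subset_convexHull ℝ Z hp, ?_⟩
  rintro x₁ h₁ x₂ h₂ ⟨a, b, ha, hb, hab, he⟩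
  by_contra hne
  obtain ⟨c₁, hc₁, t₁, ht₁, -, rfl⟩ := (hseg x₁ h₁).resolve_left hne
  rcases hseg x₂ h₂ with rfl | ⟨c₂, hc₂, t₂, ht₂, -, rfl⟩
  · apply hpH
    have : x₂ = c₁ := by
      have h0 : (a * t₁) • (c₁ - x₂) = 0 := by
        have : a • ((1 - t₁) • x₂ + t₁ • c₁) + b • x₂ - (a + b) • x₂ = 0 := by
          rw [he, hab]; simp
        rw [← this]; module
      have := (smul_eq_zero.1 h0).resolve_left (by positivity)
      exact (sub_eq_zero.1 this).symm
    rwa [this]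
  · apply hpH
    have hs : 0 < a * t₁ + b * t₂ := by positivity
    have : p = (a * t₁ / (a * t₁ + b * t₂)) • c₁ + (b * t₂ / (a * t₁ + b * t₂)) • c₂ := by
      have h0 : (a * t₁ + b * t₂) • p = (a * t₁) • c₁ + (b * t₂) • c₂ := by
        rw [← sub_eq_zero]
        have : p - (a • ((1 - t₁) • p + t₁ • c₁) + b • ((1 - t₂) • p + t₂ • c₂))
            + (a + b - 1) • p = 0 := by rw [he, hab]; simp
        rw [← this]; module
      have h1 : p = (a * t₁ + b * t₂)⁻¹ • ((a * t₁) • c₁ + (b * t₂) • c₂) := by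
        rw [← h0, smul_smul, inv_mul_cancel₀ hs.ne', one_smul]
      rw [smul_add, smul_smul, smul_smul] at h1
      rw [div_eq_inv_mul, div_eq_inv_mul]
      exact h1
    rw [this]
    exact hH hc₁ hc₂ (by positivity) (by positivity) (by field_simp)

theorem notMem_convexHull_of_mem_hullVertices {Z S : Set Plane} {p : Plane}
    (hp : p ∈ hullVertices Z) (hS : S ⊆ Z) (hpS : p ∉ S) : p ∉ convexHull ℝ S := by
  intro h
  have := ((convex_convexHull ℝ Z).mem_extremePoints_iff_mem_sdiff_convexHull_sdiff).1 hp
  refine this.2 (convexHull_mono ?_ h)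
  exact fun z hz => ⟨subset_convexHull ℝ Z (hS hz), fun h => hpS (h ▸ hz)⟩

theorem not_inTriangle_of_mem_hullVertices {Z : Set Plane} {a b c p : Plane}
    (hp : p ∈ hullVertices Z) (ha : a ∈ Z) (hb : b ∈ Z) (hc : c ∈ Z) : ¬ InTriangle a b c p := by
  intro h
  have hne : p ∉ ({a, b, c} : Set Plane) := by
    rintro (rfl | rfl | rfl)
    · simpa using h.1
    · simpa using h.1
    · simpa using h.2.1
  refine notMem_convexHull_of_mem_hullVertices hp ?_ hne h.mem_convexHull
  rintro z (rfl | rfl | rfl) <;> assumption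

theorem hullVertices_nonempty {Z : Set Plane} (hf : Z.Finite) (hZ : Z.Nonempty) :
    (hullVertices Z).Nonempty :=
  (hf.isCompact_convexHull ℝ).extremePoints_nonempty hZ.convexHull

theorem convexHull_hullVertices {Z : Set Plane} (hf : Z.Finite) :
    convexHull ℝ (hullVertices Z) = convexHull ℝ Z := by
  have h := closure_convexHull_extremePoints (hf.isCompact_convexHull ℝ) (convex_convexHull ℝ Z)
  have hc := (hf.subset (hullVertices_subset Z)).isClosed_convexHull ℝ
  rwa [← hullVertices, hc.closure_eq] at h

/-! ## Counterclockwise enumeration of a convex layer -/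

/-- A maximal element is removed and put last. The order axioms are required on `s` only, because
the angular order around a hull vertex is an order only on the other points of the layer. -/
theorem exists_sorted_enumeration {α : Type*} [Inhabited α] [DecidableEq α] (r : α → α → Prop)
    (s : Finset α)
    (total : ∀ a ∈ s, ∀ b ∈ s, a ≠ b → r a b ∨ r b a)
    (trans : ∀ a ∈ s, ∀ b ∈ s, ∀ c ∈ s, r a b → r b c → r a c)
    (irrefl : ∀ a ∈ s, ¬ r a a) :
    ∃ f : ℕ → α, (∀ i < s.card, f i ∈ s) ∧ (∀ a ∈ s, ∃ i < s.card, f i = a) ∧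
      ∀ i j, i < j → j < s.card → r (f i) (f j) := by
  induction s using Finset.strongInduction with
  | _ s ih =>
  rcases s.eq_empty_or_nonempty with rfl | hs
  · exact ⟨fun _ => default, by simp, by simp, by simp⟩
  obtain ⟨m, hm, hmax⟩ : ∃ m ∈ s, ∀ y ∈ s, ¬ r m y := by
    let r' : s → s → Prop := fun a b => r b a
    have : IsTrans s r' := ⟨fun a b c h h' => trans c c.2 b b.2 a a.2 h' h⟩
    have : Std.Irrefl r' := ⟨fun a h => irrefl a a.2 h⟩
    obtain ⟨m, -, hm⟩ := (Finite.wellFounded_of_trans_of_irrefl r').has_min Set.univ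
      ⟨⟨hs.choose, hs.choose_spec⟩, trivial⟩
    exact ⟨m, m.2, fun y hy h => hm ⟨y, hy⟩ trivial h⟩
  have hmem : ∀ a ∈ s.erase m, a ∈ s := fun a ha => Finset.mem_of_mem_erase ha
  obtain ⟨f, hf1, hf2, hf3⟩ := ih (s.erase m) (Finset.erase_ssubset hm)
    (fun a ha b hb => total a (hmem a ha) b (hmem b hb))
    (fun a ha b hb c hc => trans a (hmem a ha) b (hmem b hb) c (hmem c hc))
    (fun a ha => irrefl a (hmem a ha))
  have hcard := Finset.card_erase_add_one hm
  set n := (s.erase m).card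
  refine ⟨fun i => if i = n then m else f i, ?_, ?_, ?_⟩
  · intro i hi
    by_cases h : i = n
    · simpa [h] using hm
    · simpa [h] using hmem _ (hf1 i (by omega))
  · intro a ha
    by_cases h : a = m
    · exact ⟨n, by omega, by simp [h]⟩
    · obtain ⟨i, hi, rfl⟩ := hf2 a (Finset.mem_erase.2 ⟨h, ha⟩)
      exact ⟨i, by omega, by simp [hi.ne]⟩
  · intro i j hij hj
    have hi : i ≠ n := by omega
    by_cases h : j = n
    · have hfi := Finset.mem_erase.1 (hf1 i (by omega))
      simpa [h, hi] using (total _ hfi.2 m hm hfi.1).resolve_right (hmax _ hfi.2)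
    · simpa [h, hi] using hf3 i j hij (by omega)

/-- A discrete intermediate value principle. It finds the fan triangle that contains a point, and
the hull edge through which a line leaves the polygon. -/
theorem exists_step_of_not {P : ℕ → Prop} {a b : ℕ} (hab : a ≤ b) (ha : P a) (hb : ¬ P b) :
    ∃ i, a ≤ i ∧ i < b ∧ P i ∧ ¬ P (i + 1) := by
  induction b, hab using Nat.le_induction with
  | base => exact absurd ha hb
  | succ b hab ih =>
    by_cases h : P b
    · exact ⟨b, hab, by omega, h, hb⟩
    · obtain ⟨i, h1, h2, h3⟩ := ih h
      exact ⟨i, h1, by omega, h3⟩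

/-- `R` is the set of hull vertices of `R ∪ Y`, and every triangle of points of `R` has exactly
one point of `Y` inside. -/
structure LayerPair (R Y : Set Plane) : Prop where
  finite : (R ∪ Y).Finite
  generalPosition : GeneralPosition (R ∪ Y)
  disjoint : Disjoint R Y
  hull : hullVertices (R ∪ Y) = R
  triangle : ∀ a ∈ R, ∀ b ∈ R, ∀ c ∈ R, 0 < orient a b c → ∃! p, p ∈ Y ∧ InTriangle a b c p

/-- `q 0, …, q L` are the points of `R` in counterclockwise order. -/
structure CcwEnum (R Y : Set Plane) (L : ℕ) (q : ℕ → Plane) : Prop where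
  mem : ∀ i ≤ L, q i ∈ R
  surj : ∀ a ∈ R, ∃ i ≤ L, q i = a
  inj : ∀ i j, i < j → j ≤ L → q i ≠ q j
  pos : ∀ i j k, i < j → j < k → k ≤ L → 0 < orient (q i) (q j) (q k)
  edge : ∀ i < L, ∀ z ∈ Y, 0 < orient (q i) (q (i + 1)) z
  last : ∀ z ∈ Y, 0 < orient (q L) (q 0) z

theorem orient_pos_of_not_neg {X : Set Plane} (hX : GeneralPosition X) {a b c : Plane}
    (ha : a ∈ X) (hb : b ∈ X) (hc : c ∈ X) (hab : a ≠ b) (hac : a ≠ c) (hbc : b ≠ c)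
    (h : ¬ orient a b c < 0) : 0 < orient a b c :=
  lt_of_le_of_ne (not_lt.1 h) (hX.orient_ne_zero ha hb hc hab hac hbc).symm

/-- The other vertices are sorted by angle around `p`. Every violation of the cyclic order would put
a vertex inside a triangle of three other vertices. -/
theorem LayerPair.exists_ccwEnum {R Y : Set Plane} (H : LayerPair R Y) (h3 : 3 ≤ R.ncard)
    {p : Plane} (hp : p ∈ R) : ∃ q, CcwEnum R Y (R.ncard - 1) q ∧ q 0 = p := by
  classical
  have hfin : R.Finite := H.finite.subset Set.subset_union_left
  have hgp : GeneralPosition (R ∪ Y) := H.generalPosition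
  have hext : ∀ {a b c d : Plane}, a ∈ R → b ∈ R → c ∈ R → d ∈ R → ¬ InTriangle a b c d :=
    fun ha hb hc hd => not_inTriangle_of_mem_hullVertices (Z := R ∪ Y) (by rwa [H.hull])
      (Or.inl ha) (Or.inl hb) (Or.inl hc)
  set s : Finset Plane := hfin.toFinset.erase p with hs
  have hsm : ∀ {a}, a ∈ s ↔ a ≠ p ∧ a ∈ R := by intro a; simp [hs]
  have hcard : s.card + 1 = R.ncard := by
    rw [hs, Finset.card_erase_add_one (by simpa using hp), Set.ncard_eq_toFinset_card R hfin]
  obtain ⟨f, hf1, hf2, hf3⟩ := exists_sorted_enumeration (fun a b => 0 < orient p a b) s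
    (fun a ha b hb hab => by
      rw [hsm] at ha hb
      rcases lt_or_gt_of_ne (hgp.orient_ne_zero (Or.inl hp) (Or.inl ha.2) (Or.inl hb.2)
        ha.1.symm hb.1.symm hab) with h | h
      · right; rw [orient_swap_right]; linarith
      · exact Or.inl h)
    -- If the angular order failed to be transitive, `p` would lie inside the triangle `abc`.
    (fun a ha b hb c hc hab hbc => by
      rw [hsm] at ha hb hc
      have hac : a ≠ c := by
        rintro rfl
        rw [orient_swap_right] at hbc; linarith
      refine orient_pos_of_not_neg hgp (Or.inl hp) (Or.inl ha.2) (Or.inl hc.2)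
        ha.1.symm hc.1.symm hac fun h => ?_
      refine hext ha.2 hb.2 hc.2 hp ⟨?_, ?_, ?_⟩
      · rwa [← orient_rotate]
      · rwa [← orient_rotate]
      · rw [← orient_rotate, orient_swap_right]; linarith)
    (fun a _ => by simp)
  set L := R.ncard - 1 with hL
  have hsL : s.card = L := by omega
  rw [hsL] at hf1 hf2 hf3
  have hfR : ∀ i < L, f i ≠ p ∧ f i ∈ R := fun i hi => hsm.1 (hf1 i hi)
  have hinj : ∀ i j, i < j → j < L → f i ≠ f j := fun i j hij hj h => by
    have := hf3 i j hij hj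
    simp [h] at this
  let q : ℕ → Plane := fun i => if i = 0 then p else f (i - 1)
  have q0 : q 0 = p := rfl
  have qs : ∀ i, q (i + 1) = f i := fun i => by simp [q]
  have hmem : ∀ i ≤ L, q i ∈ R := by
    rintro (_ | i) hi
    · exact hp
    · rw [qs]; exact (hfR i (by omega)).2
  have hsurj : ∀ a ∈ R, ∃ i ≤ L, q i = a := by
    intro a ha
    by_cases h : a = p
    · exact ⟨0, by omega, by rw [q0, h]⟩
    · obtain ⟨i, hi, rfl⟩ := hf2 a (hsm.2 ⟨h, ha⟩)
      exact ⟨i + 1, by omega, qs i⟩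
  have hinj' : ∀ i j, i < j → j ≤ L → q i ≠ q j := by
    rintro (_ | i) (_ | j) hij hj
    · omega
    · rw [q0, qs]; exact (hfR j (by omega)).1.symm
    · omega
    · rw [qs, qs]; exact hinj i j (by omega) (by omega)
  have hpos : ∀ i j k, i < j → j < k → k ≤ L → 0 < orient (q i) (q j) (q k) := by
    intro i j k hij hjk hk
    have hbase : ∀ j k, 0 < j → j < k → k ≤ L → 0 < orient (q 0) (q j) (q k) := by
      rintro (_ | j) (_ | k) h0 hjk hk
      · omega
      · omega
      · omega
      · rw [q0, qs, qs]; exact hf3 j k (by omega) (by omega)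
    rcases Nat.eq_zero_or_pos i with rfl | hi
    · exact hbase j k hij hjk hk
    · refine orient_pos_of_not_neg hgp (Or.inl (hmem i (by omega))) (Or.inl (hmem j (by omega)))
        (Or.inl (hmem k hk)) (hinj' i j hij (by omega)) (hinj' i k (by omega) hk)
        (hinj' j k hjk hk) fun h => ?_
      -- Were the triple not counterclockwise, `q j` would lie inside the triangle of `q 0`, `q i`
      -- and `q k`.
      refine hext (hmem 0 (by omega)) (hmem i (by omega)) (hmem k hk) (hmem j (by omega))
        ⟨hbase i j hi hij (by omega), ?_, ?_⟩
      · rw [orient_swap_right]; linarith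
      · rw [orient_rotate]; exact hbase j k (by omega) hjk hk
  -- The points of `Y` lie in the convex hull of `R`, so a half-plane bound on `R` passes to `Y`;
  -- general position makes it strict.
  have hedge : ∀ a ∈ R, ∀ b ∈ R, a ≠ b → (∀ z ∈ R, 0 ≤ orient a b z) →
      ∀ z ∈ Y, 0 < orient a b z := by
    intro a ha b hb hab h z hz
    have hzR : ∀ r ∈ R, r ≠ z := fun r hr h => Set.disjoint_left.1 H.disjoint hr (h ▸ hz)
    refine orient_pos_of_not_neg hgp (Or.inl ha) (Or.inl hb) (Or.inr hz) hab (hzR a ha) (hzR b hb)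
      (not_lt.2 ?_)
    apply orient_nonneg_of_mem_convexHull h
    have := convexHull_hullVertices H.finite
    rw [H.hull] at this
    rw [this]
    exact subset_convexHull ℝ _ (Or.inr hz)
  refine ⟨q, ⟨hmem, hsurj, hinj', hpos, ?_, ?_⟩, q0⟩
  · intro i hi
    refine hedge _ (hmem i hi.le) _ (hmem (i + 1) hi) (hinj' i (i + 1) (by omega) hi) ?_
    intro z hz
    obtain ⟨j, hj, rfl⟩ := hsurj z hz
    rcases lt_trichotomy j i with h | rfl | h
    · rw [← orient_rotate]; exact (hpos j i (i + 1) h (by omega) hi).le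
    · simp
    · rcases (show i + 1 ≤ j from h).eq_or_lt with rfl | h
      · simp
      · exact (hpos i (i + 1) j (by omega) h hj).le
  · refine hedge _ (hmem L le_rfl) _ (hmem 0 (by omega)) (hinj' 0 L (by omega) le_rfl).symm ?_
    intro z hz
    obtain ⟨j, hj, rfl⟩ := hsurj z hz
    rcases Nat.eq_zero_or_pos j with rfl | h
    · simp
    · rcases hj.eq_or_lt with rfl | hj
      · simp
      · rw [orient_rotate]; exact (hpos 0 j L h hj le_rfl).le

/-! ## The number of interior points -/

theorem LayerPair.orient_ne_zero {R Y : Set Plane} (H : LayerPair R Y) {a b z : Plane}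
    (ha : a ∈ R) (hb : b ∈ R) (hz : z ∈ Y) (hab : a ≠ b) : orient a b z ≠ 0 :=
  H.generalPosition.orient_ne_zero (Or.inl ha) (Or.inl hb) (Or.inr hz) hab
    (fun h => Set.disjoint_left.1 H.disjoint ha (h ▸ hz))
    (fun h => Set.disjoint_left.1 H.disjoint hb (h ▸ hz))

theorem LayerPair.eq_of_inTriangle {R Y : Set Plane} (H : LayerPair R Y) {a b c z w : Plane}
    (ha : a ∈ R) (hb : b ∈ R) (hc : c ∈ R) (hz : z ∈ Y) (hw : w ∈ Y) (hz' : InTriangle a b c z)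
    (hw' : InTriangle a b c w) : z = w :=
  (H.triangle a ha b hb c hc hz'.orient_pos).unique ⟨hz, hz'⟩ ⟨hw, hw'⟩

/-- The fan from `q 0` has `|R| - 2` triangles. Each contains one point of `Y`, and each point of
`Y` lies in one of them, because it is on no line through two vertices. -/
theorem LayerPair.ncard_eq {R Y : Set Plane} (H : LayerPair R Y) (h3 : 3 ≤ R.ncard) :
    R.ncard = Y.ncard + 2 := by
  obtain ⟨p, hp⟩ : R.Nonempty := Set.nonempty_of_ncard_ne_zero (by omega)
  obtain ⟨q, e, -⟩ := H.exists_ccwEnum h3 hp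
  set L := R.ncard - 1 with hL
  have ht : ∀ i, 1 ≤ i → i < L → ∃ t, t ∈ Y ∧ InTriangle (q 0) (q i) (q (i + 1)) t := fun i hi hiL =>
    (H.triangle _ (e.mem 0 (by omega)) _ (e.mem i (by omega)) _ (e.mem (i + 1) (by omega))
      (e.pos 0 i (i + 1) (by omega) (by omega) (by omega))).exists
  choose! t htY htri using ht
  have himg : Y = t '' (Finset.Ico 1 L : Set ℕ) := by
    ext y
    constructor
    · intro hy
      obtain ⟨i, hi1, hiL, hi, hi'⟩ := exists_step_of_not
        (P := fun i => 0 < orient (q 0) (q i) y) (a := 1) (b := L) (by omega)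
        (e.edge 0 (by omega) y hy)
        (by have := e.last y hy
            rw [orient_swap] at this
            intro h; linarith)
      refine ⟨i, by simp; omega, ?_⟩
      refine H.eq_of_inTriangle (e.mem 0 (by omega)) (e.mem i (by omega)) (e.mem (i + 1) (by omega))
        (htY i hi1 hiL) hy (htri i hi1 hiL) ⟨hi, e.edge i hiL y hy, ?_⟩
      have hne := H.orient_ne_zero (e.mem 0 (by omega)) (e.mem (i + 1) (by omega)) hy
        (e.inj 0 (i + 1) (by omega) (by omega))
      rw [orient_swap, neg_pos]
      exact lt_of_le_of_ne (not_lt.1 hi') hne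
    · rintro ⟨i, hi, rfl⟩
      simp only [Finset.coe_Ico, Set.mem_Ico] at hi
      exact htY i hi.1 hi.2
  -- Different fan triangles are separated by a ray from `q 0`: the earlier point is on the right of
  -- the ray to `q (i + 1)`, the later one on its left.
  have hlt : ∀ i j, 1 ≤ i → i < j → j < L → t i ≠ t j := by
    intro i j hi hij hj h
    have h1 := (htri i hi (by omega)).2.2
    have h2 := (htri j (by omega) hj).1
    rw [← h] at h2
    have hY := htY i hi (by omega)
    rw [orient_swap, neg_pos] at h1
    have : 0 < orient (q 0) (q (i + 1)) (t i) := by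
      rcases (show i + 1 ≤ j from hij).eq_or_lt with rfl | hij
      · exact h2
      · exact orient_trans (x := q 1) (e.pos 0 1 (i + 1) (by omega) (by omega) (by omega))
          (e.pos 0 1 j (by omega) (by omega) (by omega)) (e.edge 0 (by omega) _ hY)
          (e.pos 0 (i + 1) j (by omega) (by omega) (by omega)) h2
    linarith
  have hY : Y.ncard = L - 1 := by
    rw [himg, Set.InjOn.ncard_image, Set.ncard_coe_finset, Nat.card_Ico]
    intro i hi j hj hij
    simp only [Finset.coe_Ico, Set.mem_Ico] at hi hj
    rcases lt_trichotomy i j with h | h | h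
    · exact absurd hij (hlt i j hi.1 h hj.2)
    · exact h
    · exact absurd hij.symm (hlt j i hj.1 h hi.2)
  omega

/-! ## Ears -/

/-- `p'` follows `p` on the boundary of the convex hull of `R ∪ Y`. -/
structure IsHullEdge (R Y : Set Plane) (p p' : Plane) : Prop where
  left_mem : p ∈ R
  right_mem : p' ∈ R
  ne : p ≠ p'
  pos : ∀ z ∈ R ∪ Y, z ≠ p → z ≠ p' → 0 < orient p p' z

theorem CcwEnum.isHullEdge {R Y : Set Plane} {L : ℕ} {q : ℕ → Plane} (e : CcwEnum R Y L q)
    {i : ℕ} (hi : i < L) : IsHullEdge R Y (q i) (q (i + 1)) := by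
  refine ⟨e.mem i hi.le, e.mem (i + 1) hi, e.inj i (i + 1) (by omega) hi, ?_⟩
  rintro z (hz | hz) h1 h2
  · obtain ⟨j, hj, rfl⟩ := e.surj z hz
    rcases lt_trichotomy j i with h | rfl | h
    · rw [← orient_rotate]; exact e.pos j i (i + 1) h (by omega) hi
    · exact absurd rfl h1
    · rcases (show i + 1 ≤ j from h).eq_or_lt with rfl | h
      · exact absurd rfl h2
      · exact e.pos i (i + 1) j (by omega) h hj
  · exact e.edge i hi z hz

theorem CcwEnum.isHullEdge_last {R Y : Set Plane} {L : ℕ} {q : ℕ → Plane} (e : CcwEnum R Y L q)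
    (hL : 0 < L) : IsHullEdge R Y (q L) (q 0) := by
  refine ⟨e.mem L le_rfl, e.mem 0 hL.le, (e.inj 0 L hL le_rfl).symm, ?_⟩
  rintro z (hz | hz) h1 h2
  · obtain ⟨j, hj, rfl⟩ := e.surj z hz
    have h0 : j ≠ 0 := by rintro rfl; exact h2 rfl
    have h0' : j ≠ L := by rintro rfl; exact h1 rfl
    rw [orient_rotate]
    exact e.pos 0 j L (by omega) (by omega) le_rfl
  · exact e.last z hz

theorem IsHullEdge.right_unique {R Y : Set Plane} {p a b : Plane} (ha : IsHullEdge R Y p a)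
    (hb : IsHullEdge R Y p b) : a = b := by
  by_contra h
  have h1 := ha.pos b (Or.inl hb.right_mem) hb.ne.symm (Ne.symm h)
  have h2 := hb.pos a (Or.inl ha.right_mem) ha.ne.symm h
  rw [orient_swap_right] at h1
  linarith

theorem IsHullEdge.left_unique {R Y : Set Plane} {p a b : Plane} (ha : IsHullEdge R Y a p)
    (hb : IsHullEdge R Y b p) : a = b := by
  by_contra h
  have h1 := ha.pos b (Or.inl hb.left_mem) (Ne.symm h) hb.ne
  have h2 := hb.pos a (Or.inl ha.left_mem) h ha.ne
  rw [orient_rotate] at h1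
  rw [orient_swap] at h2
  linarith

/-- The point `y` is the interior point in the triangle cut off at the vertex `p`. -/
def IsEarPoint (R Y : Set Plane) (p y : Plane) : Prop :=
  y ∈ Y ∧ ∃ a b, IsHullEdge R Y a p ∧ IsHullEdge R Y p b ∧ InTriangle a p b y

theorem IsEarPoint.inTriangle {R Y : Set Plane} {p y a b : Plane} (h : IsEarPoint R Y p y)
    (ha : IsHullEdge R Y a p) (hb : IsHullEdge R Y p b) : InTriangle a p b y := by
  obtain ⟨-, a', b', ha', hb', ht⟩ := h
  rwa [ha.left_unique ha', hb.right_unique hb']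

theorem LayerPair.exists_isEarPoint {R Y : Set Plane} (H : LayerPair R Y) (h3 : 3 ≤ R.ncard)
    {p : Plane} (hp : p ∈ R) : ∃ y, IsEarPoint R Y p y := by
  obtain ⟨q, e, rfl⟩ := H.exists_ccwEnum h3 hp
  set L := R.ncard - 1
  obtain ⟨y, ⟨hy, ht⟩, -⟩ := H.triangle _ (e.mem L le_rfl) _ hp _ (e.mem 1 (by omega))
    (by rw [orient_rotate]; exact e.pos 0 1 L (by omega) (by omega) le_rfl)
  exact ⟨y, hy, _, _, e.isHullEdge_last (by omega), e.isHullEdge (i := 0) (by omega), ht⟩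

/-- The chord `q L`, `q 1` cuts off the ear at `q 0`. The ear at a vertex not adjacent to `q 0` lies
on the other side of this chord. -/
theorem LayerPair.adjacent_of_isEarPoint {R Y : Set Plane} (H : LayerPair R Y)
    (h3 : 3 ≤ R.ncard) {p p' y : Plane} (hp : p ∈ R) (hp' : p' ∈ R) (hne : p ≠ p')
    (h : IsEarPoint R Y p y) (h' : IsEarPoint R Y p' y) :
    IsHullEdge R Y p p' ∨ IsHullEdge R Y p' p := by
  obtain ⟨q, e, rfl⟩ := H.exists_ccwEnum h3 hp
  set L := R.ncard - 1
  obtain ⟨i, hi, rfl⟩ := e.surj p' hp'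
  have hi0 : i ≠ 0 := by rintro rfl; exact hne rfl
  obtain ⟨i, rfl⟩ := Nat.exists_eq_succ_of_ne_zero hi0
  rcases hi.eq_or_lt with hiL | hiL
  · rw [hiL]; exact Or.inr (e.isHullEdge_last (by omega))
  rcases Nat.eq_zero_or_pos i with rfl | hi1
  · exact Or.inl (e.isHullEdge (by omega))
  exfalso
  have t := h.inTriangle (e.isHullEdge_last (by omega)) (e.isHullEdge (i := 0) (by omega))
  have t' := h'.inTriangle (e.isHullEdge (i := i) (by omega)) (e.isHullEdge (i := i + 1) hiL)
  have hhalf : ∀ j, 1 ≤ j → j ≤ L → 0 ≤ orient (q L) (q 1) (q j) := by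
    intro j h1 hj
    rcases h1.eq_or_lt with rfl | h1
    · simp
    rcases hj.eq_or_lt with rfl | hj
    · simp
    rw [orient_rotate]; exact (e.pos 1 j L h1 hj le_rfl).le
  have := t'.mem_of_convex (convex_orient_nonneg (q L) (q 1)) (hhalf i (by omega) (by omega))
    (hhalf (i + 1) (by omega) (by omega)) (hhalf (i + 2) (by omega) (by omega))
  have h2 := t.2.2
  rw [orient_swap] at h2
  simp only [Set.mem_ofPred_eq, zero_add] at this h2
  linarith

/-- The chord `ab` cuts off only the ear triangle, in which `y` is the only point of `Y`. The open
half-plane beyond the chord contains the other points of `Y` but not `y`. -/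
theorem LayerPair.isEarPoint_mem_hullVertices {R Y : Set Plane} (H : LayerPair R Y) {p y : Plane}
    (h : IsEarPoint R Y p y) : y ∈ hullVertices Y := by
  obtain ⟨hy, a, b, ha, hb, ht⟩ := h
  have hab : a ≠ b := by rintro rfl; simpa using ht.orient_pos
  refine mem_hullVertices_of_convex hy (convex_orient_pos a b) ?_ ?_
  · intro z hz hzy
    have hne := H.orient_ne_zero ha.left_mem hb.right_mem hz hab
    refine lt_of_le_of_ne (not_lt.1 fun hlt => hzy ?_) hne.symm
    have hzR : ∀ r ∈ R, z ≠ r := fun r hr h => Set.disjoint_left.1 H.disjoint hr (h ▸ hz)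
    refine H.eq_of_inTriangle ha.left_mem ha.right_mem hb.right_mem hz hy ⟨?_, ?_, ?_⟩ ht
    · exact ha.pos z (Or.inr hz) (hzR _ ha.left_mem) (hzR _ ha.right_mem)
    · exact hb.pos z (Or.inr hz) (hzR _ hb.left_mem) (hzR _ hb.right_mem)
    · rw [orient_swap]; linarith
  · have := ht.2.2
    rw [orient_swap] at this
    simp only [Set.mem_ofPred_eq, not_lt]
    linarith

/-- The mirror image of `orient_trans`, for points on the right of `ox`. -/
theorem orient_trans' {o x a b c : Plane} (hxa : 0 < orient x o a) (hxb : 0 < orient x o b)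
    (hxc : 0 < orient x o c) (hab : 0 < orient o a b) (hbc : 0 < orient o b c) :
    0 < orient o a c := by
  have key : orient x o b * orient o a c
      = orient x o a * orient o b c + orient x o c * orient o a b := by
    unfold orient; ring
  have : 0 < orient x o b * orient o a c := by rw [key]; positivity
  exact (pos_iff_pos_of_mul_pos this).1 hxb

/-- The interior point `y` belongs to the hull edge `pp'`. -/
structure IsTwinEdge (R Y : Set Plane) (p p' y : Plane) : Prop extends IsHullEdge R Y p p' where
  mem : y ∈ Y
  inTriangle : ∀ z ∈ R, z ≠ p → z ≠ p' → InTriangle p p' z y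

/-- The point `y` lies in the ears at both ends of the edge, and the intersection of these two ears
lies in every triangle on the edge with third vertex in `R`. -/
theorem LayerPair.isTwinEdge {R Y : Set Plane} (H : LayerPair R Y)
    (h3 : 3 ≤ R.ncard) {p p' y : Plane} (hpp : IsHullEdge R Y p p')
    (h : IsEarPoint R Y p y) (h' : IsEarPoint R Y p' y) : IsTwinEdge R Y p p' y := by
  refine { hpp with mem := h.1, inTriangle := ?_ }
  intro z hz hzp hzp'
  obtain ⟨q, e, rfl⟩ := H.exists_ccwEnum h3 hpp.left_mem
  set L := R.ncard - 1
  have h01 := e.isHullEdge (i := 0) (by omega)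
  obtain rfl := hpp.right_unique h01
  simp only [zero_add] at *
  obtain ⟨i, hi, rfl⟩ := e.surj z hz
  have hi0 : i ≠ 0 := by rintro rfl; exact hzp rfl
  have hi1 : i ≠ 1 := by rintro rfl; exact hzp' rfl
  have t := h.inTriangle (e.isHullEdge_last (by omega)) h01
  have t' := h'.inTriangle h01 (e.isHullEdge (i := 1) (by omega))
  refine ⟨t'.1, ?_, ?_⟩
  · rcases hi.eq_or_lt with rfl | hi
    · exact t.2.2
    · exact orient_trans' (x := q 0) (e.pos 0 1 i (by omega) (by omega) (by omega))
        (e.pos 0 1 L (by omega) (by omega) (by omega)) t'.1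
        (e.pos 1 i L (by omega) (by omega) (by omega)) t.2.2
  · rcases (show 2 ≤ i by omega).eq_or_lt with rfl | hi2
    · exact t'.2.2
    · rw [orient_rotate]
      refine orient_trans (x := q 1) t'.1 (e.pos 0 1 2 (by omega) (by omega) (by omega))
        (e.pos 0 1 i (by omega) (by omega) (by omega)) ?_
        (e.pos 0 2 i (by omega) (by omega) (by omega))
      rw [← orient_rotate]
      exact t'.2.2

/-- Three vertices with a common ear point would be pairwise adjacent, which needs a hull with only
three vertices. -/
theorem LayerPair.no_three_isEarPoint {R Y : Set Plane} (H : LayerPair R Y)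
    (h4 : 4 ≤ R.ncard) {p a b y : Plane} (hp : p ∈ R) (ha : a ∈ R) (hb : b ∈ R)
    (hpa : p ≠ a) (hpb : p ≠ b) (hab : a ≠ b)
    (h : IsEarPoint R Y p y) (h' : IsEarPoint R Y a y) (h'' : IsEarPoint R Y b y) : False := by
  wlog hd : IsHullEdge R Y p a generalizing a b
  · have hd' := (H.adjacent_of_isEarPoint (by omega) hp ha hpa h h').resolve_left hd
    refine this hb ha hpb hpa hab.symm h'' h' ?_
    refine (H.adjacent_of_isEarPoint (by omega) hp hb hpb h h'').resolve_right fun hbp => ?_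
    exact hab (hd'.left_unique hbp)
  have hd' := (H.adjacent_of_isEarPoint (by omega) hp hb hpb h h'').resolve_left
    fun hpb' => hab (hd.right_unique hpb')
  obtain ⟨q, e, rfl⟩ := H.exists_ccwEnum (by omega) hp
  set L := R.ncard - 1
  obtain rfl := hd.right_unique (e.isHullEdge (i := 0) (by omega))
  obtain rfl := hd'.left_unique (e.isHullEdge_last (by omega))
  have hp2 := e.pos 1 2 L (by omega) (by omega) (by omega)
  have hp0 := e.pos 0 1 L (by omega) (by omega) (by omega)
  simp only [zero_add] at *
  rcases H.adjacent_of_isEarPoint (by omega) ha hb hab h' h'' with hc | hc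
  · have := hc.pos (q 2) (Or.inl (e.mem 2 (by omega))) (e.inj 1 2 (by omega) (by omega)).symm
      (e.inj 2 L (by omega) (by omega))
    rw [orient_swap_right] at this
    linarith
  · have := hc.pos (q 0) (Or.inl (e.mem 0 (by omega))) (e.inj 0 L (by omega) (by omega))
      (e.inj 0 1 (by omega) (by omega))
    rw [orient_swap, ← orient_rotate] at this
    linarith

/-- If the outer layer has twice as many points as the next one, then its points are paired up by
the twin edges. -/
theorem LayerPair.exists_twins {R Y : Set Plane} (H : LayerPair R Y) (h4 : 4 ≤ R.ncard)
    (hcard : R.ncard = 2 * (hullVertices Y).ncard) :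
    ∃ P P' : Plane → Plane, (∀ y ∈ hullVertices Y, IsTwinEdge R Y (P y) (P' y) y) ∧
      (∀ p ∈ R, ∃ y ∈ hullVertices Y, p = P y ∨ p = P' y) ∧
      (∀ y ∈ hullVertices Y, ∀ z ∈ hullVertices Y, P y = P z ∨ P' y = P' z ∨ P y = P' z →
        y = z) := by
  classical
  have hRf : R.Finite := H.finite.subset Set.subset_union_left
  have hYf : Y.Finite := H.finite.subset Set.subset_union_right
  have hSf : (hullVertices Y).Finite := hYf.subset (hullVertices_subset Y)
  choose! f hf using fun p (hp : p ∈ R) => H.exists_isEarPoint (by omega) hp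
  have hfS : ∀ p ∈ R, f p ∈ hullVertices Y := fun p hp => H.isEarPoint_mem_hullVertices (hf p hp)
  have hsum := Finset.card_eq_sum_card_fiberwise (s := hRf.toFinset) (t := hSf.toFinset) (f := f)
    (fun p hp => by simpa using hfS p (by simpa using hp))
  have hle : ∀ y ∈ hSf.toFinset, (hRf.toFinset.filter fun p => f p = y).card ≤ 2 := by
    intro y _
    by_contra hgt
    obtain ⟨a, ha, b, hb, c, hc, hab, hac, hbc⟩ := Finset.two_lt_card.1 (not_le.1 hgt)
    simp only [Finset.mem_filter, Set.Finite.mem_toFinset] at ha hb hc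
    exact H.no_three_isEarPoint h4 ha.1 hb.1 hc.1 hab hac hbc (ha.2 ▸ hf a ha.1) (hb.2 ▸ hf b hb.1)
      (hc.2 ▸ hf c hc.1)
  -- The fibres of the ear map have at most two elements, and by `hcard` they have two on average.
  have hall : ∀ y ∈ hSf.toFinset, (hRf.toFinset.filter fun p => f p = y).card = 2 := by
    refine (Finset.sum_eq_sum_iff_of_le hle).1 ?_
    rw [← hsum, Finset.sum_const, smul_eq_mul, ← Set.ncard_eq_toFinset_card R hRf,
      ← Set.ncard_eq_toFinset_card _ hSf, hcard, mul_comm]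
  have hpair : ∀ y ∈ hullVertices Y, ∃ p p', IsTwinEdge R Y p p' y ∧
      ∀ r ∈ R, f r = y ↔ r = p ∨ r = p' := by
    intro y hy
    obtain ⟨a, b, hab, hfib⟩ := Finset.card_eq_two.1 (hall y (by simpa using hy))
    have hmem : ∀ r, (r ∈ R ∧ f r = y) ↔ r = a ∨ r = b := by
      intro r
      have := Finset.ext_iff.1 hfib r
      simpa using this
    have ha := (hmem a).2 (Or.inl rfl)
    have hb := (hmem b).2 (Or.inr rfl)
    have ea := ha.2 ▸ hf a ha.1
    have eb := hb.2 ▸ hf b hb.1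
    rcases H.adjacent_of_isEarPoint (by omega) ha.1 hb.1 hab ea eb with h | h
    · exact ⟨a, b, H.isTwinEdge (by omega) h ea eb, fun r hr => by rw [← hmem]; tauto⟩
    · exact ⟨b, a, H.isTwinEdge (by omega) h eb ea, fun r hr => by rw [or_comm, ← hmem]; tauto⟩
  choose! P P' hT hfib using hpair
  refine ⟨P, P', hT, ?_, ?_⟩
  · intro p hp
    exact ⟨f p, hfS p hp, (hfib _ (hfS p hp) p hp).1 rfl⟩
  · intro y hy z hz h
    have e1 := (hfib y hy _ (hT y hy).left_mem).2 (Or.inl rfl)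
    have e2 := (hfib y hy _ (hT y hy).right_mem).2 (Or.inr rfl)
    have e3 := (hfib z hz _ (hT z hz).left_mem).2 (Or.inl rfl)
    have e4 := (hfib z hz _ (hT z hz).right_mem).2 (Or.inr rfl)
    rcases h with h | h | h
    · rw [← e1, h, e3]
    · rw [← e2, h, e4]
    · rw [← e1, h, e4]

/-! ## Twin edges form clusters with their interior points -/

/-- The three-term Grassmann–Plücker relation for the vectors from `z` to the other four points. -/
theorem orient_mul_identity (z a b c d : Plane) :
    orient z a b * orient z c d - orient z a c * orient z b d + orient z a d * orient z b c = 0 := by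
  unfold orient; ring

/-- A line through `z` that crosses two edges of a convex polygon stays between the two sides
that join the edges. -/
theorem orient_nonneg_of_crossing {z w p p' r s : Plane} (h1 : 0 < orient z w p)
    (h2 : orient z w p' < 0) (h3 : orient z w r < 0) (h4 : 0 < orient z w s)
    (h5 : 0 < orient p p' z) (h6 : 0 < orient r s z) (h7 : 0 < orient p' r p)
    (h8 : 0 < orient p' r s) : 0 ≤ orient p' r z := by
  by_contra! hneg
  rw [← orient_rotate] at h5 h6 hneg
  rw [← orient_add_add _ _ _ z, ← orient_rotate z p' r, ← orient_rotate z r p,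
    ← orient_rotate z p p'] at h7
  rw [← orient_add_add _ _ _ z, ← orient_rotate z p' r, ← orient_rotate z r s,
    ← orient_rotate z s p'] at h8
  rw [orient_swap_right z p r] at h7
  rw [orient_swap_right z p' s] at h8
  -- The relations `i1`, `i2`, `i3` determine the signs of `z p r`, `z p' s`, `z p s`. Then all
  -- three contributions to `i4` are positive, although they sum to zero.
  have i1 := orient_mul_identity z w p p' r
  have i2 := orient_mul_identity z w p' r s
  have i3 := orient_mul_identity z p p' r s
  have i4 := orient_mul_identity z w p p' s
  have hpr : 0 < orient z p r := by
    by_contra! h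
    nlinarith [mul_nonneg_of_nonpos_of_nonpos h2.le h, mul_pos_of_neg_of_neg h3 (neg_neg_of_pos h5),
      mul_neg_of_pos_of_neg h1 hneg]
  have hps : 0 < orient z p' s := by
    by_contra! h
    nlinarith [mul_nonneg_of_nonpos_of_nonpos h3.le h, mul_neg_of_neg_of_pos h2 h6,
      mul_neg_of_pos_of_neg h4 hneg]
  have hps' : 0 < orient z p s := by
    have hA : orient z p r * orient z p' s < orient z p p' * orient z r s :=
      mul_lt_mul'' (by linarith) (by linarith) hpr.le hps.le
    by_contra! h
    nlinarith [mul_nonneg_of_nonpos_of_nonpos h hneg.le]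
  nlinarith [mul_pos h1 hps, mul_neg_of_neg_of_pos h2 hps', mul_pos h4 h5]

theorem orient_reflect (z w x : Plane) : orient z (z + z - w) x = -orient z w x := by
  simp only [orient, Prod.fst_sub, Prod.snd_sub, Prod.fst_add, Prod.snd_add]
  ring

/-- A line through two interior points crosses two hull edges `pp'` and `rs`; both points lie
in the quadrilateral `pp'rs`. -/
theorem LayerPair.orient_pos_of_crossing {R Y : Set Plane} (H : LayerPair R Y)
    {z w p p' r s : Plane} (hz : z ∈ Y) (e : IsHullEdge R Y p p') (e' : IsHullEdge R Y r s)
    (h1 : 0 < orient z w p) (h2 : orient z w p' < 0) (h3 : orient z w r < 0)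
    (h4 : 0 < orient z w s)
    (hr : r ≠ p' → 0 < orient p' r p ∧ 0 < orient p' r s) :
    r = p' ∨ 0 < orient p' r z := by
  by_cases hrp : r = p'
  · exact Or.inl hrp
  · have hzR : ∀ r ∈ R, z ≠ r := fun r hr h => Set.disjoint_left.1 H.disjoint hr (h ▸ hz)
    have hne := H.orient_ne_zero e.right_mem e'.left_mem hz (Ne.symm hrp)
    refine Or.inr (lt_of_le_of_ne ?_ hne.symm)
    exact orient_nonneg_of_crossing h1 h2 h3 h4
      (e.pos z (Or.inr hz) (hzR _ e.left_mem) (hzR _ e.right_mem))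
      (e'.pos z (Or.inr hz) (hzR _ e'.left_mem) (hzR _ e'.right_mem)) (hr hrp).1 (hr hrp).2

/-- The diagonal from `p` to `r` splits the quadrilateral `pp'rs`. The triangle `pp'r` has only `y`
inside, so both points are in the triangle `prs`, which has room for one. The disjunctions allow the
quadrilateral to degenerate to a triangle on `pp'`, where already one point would contradict the
uniqueness of `y`. -/
theorem IsTwinEdge.eq_of_quadrilateral {R Y : Set Plane} (H : LayerPair R Y)
    {p p' y r s z w : Plane} (T : IsTwinEdge R Y p p' y) (hr : r ∈ R) (hs : s ∈ R)
    (hrp : r ≠ p) (hsp : s ≠ p') (hz : z ∈ Y) (hw : w ∈ Y) (hzy : z ≠ y) (hwy : w ≠ y)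
    (hrz : r = p' ∨ 0 < orient p' r z) (hrw : r = p' ∨ 0 < orient p' r w)
    (hsz : s = p ∨ 0 < orient s p z) (hsw : s = p ∨ 0 < orient s p w)
    (hrsz : 0 < orient r s z) (hrsw : 0 < orient r s w) : z = w := by
  have hY : ∀ x ∈ Y, ∀ r ∈ R, x ≠ r := fun x hx r hr h =>
    Set.disjoint_left.1 H.disjoint hr (h ▸ hx)
  have edge : ∀ x ∈ Y, 0 < orient p p' x := fun x hx =>
    T.pos x (Or.inr hx) (hY x hx _ T.left_mem) (hY x hx _ T.right_mem)
  have tri : ∀ r ∈ R, r ≠ p → r ≠ p' → ∀ x ∈ Y, InTriangle p p' r x → x = y :=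
    fun r hr h h' x hx hxt => H.eq_of_inTriangle T.left_mem T.right_mem hr hx T.mem hxt
      (T.inTriangle r hr h h')
  rcases eq_or_ne r p' with rfl | hrp'
  · rcases eq_or_ne s p with rfl | hsp'
    · have := edge z hz
      rw [orient_swap] at this
      linarith
    · exact absurd (tri s hs hsp' hsp z hz ⟨edge z hz, hrsz, hsz.resolve_left hsp'⟩) hzy
  · rcases eq_or_ne s p with rfl | hsp'
    · exact absurd (tri r hr hrp hrp' z hz ⟨edge z hz, hrz.resolve_left hrp', hrsz⟩) hzy
    · have key : ∀ x ∈ Y, x ≠ y → 0 < orient p' r x → 0 < orient r s x → 0 < orient s p x →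
          InTriangle p r s x := by
        intro x hx hxy h1 h2 h3
        have hne := H.orient_ne_zero T.left_mem hr hx hrp.symm
        refine ⟨lt_of_le_of_ne (not_lt.1 fun h => hxy ?_) hne.symm, h2, h3⟩
        exact tri r hr hrp hrp' x hx ⟨edge x hx, h1, by rw [orient_swap]; linarith⟩
      exact H.eq_of_inTriangle T.left_mem hr hs hz hw
        (key z hz hzy (hrz.resolve_left hrp') hrsz (hsz.resolve_left hsp'))
        (key w hw hwy (hrw.resolve_left hrp') hrsw (hsw.resolve_left hsp'))

/-- If the line `zw` separated `p` from `p'`, it would leave the polygon through another hull edge,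
and both `z` and `w` would lie in the quadrilateral spanned by the two edges. -/
theorem IsTwinEdge.pos_of_pos {R Y : Set Plane} (H : LayerPair R Y) (h4 : 4 ≤ R.ncard)
    {p p' y z w : Plane} (T : IsTwinEdge R Y p p' y) (hz : z ∈ Y) (hw : w ∈ Y) (hzy : z ≠ y)
    (hwy : w ≠ y) (hzw : z ≠ w) (hp : 0 < orient z w p) : 0 < orient z w p' := by
  have hY : ∀ x ∈ Y, ∀ r ∈ R, x ≠ r := fun x hx r hr h =>
    Set.disjoint_left.1 H.disjoint hr (h ▸ hx)
  have hne : ∀ r ∈ R, orient z w r ≠ 0 := fun r hr =>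
    H.generalPosition.orient_ne_zero (Or.inr hz) (Or.inr hw) (Or.inl hr) hzw (hY z hz r hr)
      (hY w hw r hr)
  refine lt_of_le_of_ne (not_lt.1 fun hp' => hzw ?_) (hne p' T.right_mem).symm
  obtain ⟨q, e, rfl⟩ := H.exists_ccwEnum (by omega) T.right_mem
  set L := R.ncard - 1
  obtain rfl := T.toIsHullEdge.left_unique (e.isHullEdge_last (by omega))
  obtain ⟨i, -, hiL, hi, hi'⟩ := exists_step_of_not (P := fun i => orient z w (q i) < 0)
    (Nat.zero_le L) hp' (not_lt.2 hp.le)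
  have hi' : 0 < orient z w (q (i + 1)) :=
    lt_of_le_of_ne (not_lt.1 hi') (hne _ (e.mem _ hiL)).symm
  have hL := e.isHullEdge_last (by omega)
  have hE := e.isHullEdge hiL
  have hiq : q i ≠ q L := e.inj i L hiL le_rfl
  have hi0 : q i ≠ q 0 → 0 < i := fun h => Nat.pos_of_ne_zero (by rintro rfl; exact h rfl)
  have hiL' : q (i + 1) ≠ q L → i + 1 < L := fun h =>
    lt_of_le_of_ne hiL (by intro h'; exact h (by rw [h']))
  have c1 : q i ≠ q 0 → 0 < orient (q 0) (q i) (q L) ∧ 0 < orient (q 0) (q i) (q (i + 1)) :=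
    fun h => ⟨e.pos 0 i L (hi0 h) hiL le_rfl, e.pos 0 i (i + 1) (hi0 h) (by omega) hiL⟩
  have c2 : q L ≠ q (i + 1) → 0 < orient (q (i + 1)) (q L) (q i) ∧
      0 < orient (q (i + 1)) (q L) (q 0) := fun h =>
    ⟨by rw [← orient_rotate]; exact e.pos i (i + 1) L (by omega) (hiL' h.symm) le_rfl,
     by rw [← orient_rotate]; exact e.pos 0 (i + 1) L (by omega) (hiL' h.symm) le_rfl⟩
  have k1 : ∀ x w', x ∈ Y → (∀ r, orient x w' r = orient z w r) →
      (q i = q 0 ∨ 0 < orient (q 0) (q i) x) := fun x w' hx hf =>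
    H.orient_pos_of_crossing (w := w') hx hL hE (by rwa [hf]) (by rwa [hf]) (by rwa [hf])
      (by rwa [hf]) c1
  have k2 : ∀ x w', x ∈ Y → (∀ r, orient x w' r = -orient z w r) →
      (q L = q (i + 1) ∨ 0 < orient (q (i + 1)) (q L) x) := fun x w' hx hf =>
    H.orient_pos_of_crossing (w := w') hx hE hL (by rw [hf]; linarith) (by rw [hf]; linarith)
      (by rw [hf]; linarith) (by rw [hf]; linarith) c2
  -- `orient_pos_of_crossing` locates only the base point of the directed line. To locate `w`, the
  -- same directed line is based at `w`, with the reflection of `z` in `w` as second point; this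
  -- reflection need not belong to the set.
  have hw1 : ∀ r, orient w (w + w - z) r = orient z w r := fun r => by
    rw [orient_reflect, orient_swap, neg_neg]
  refine T.eq_of_quadrilateral H (e.mem i hiL.le) (e.mem (i + 1) hiL) hiq
    (e.inj 0 (i + 1) (by omega) hiL).symm hz hw hzy hwy
    (k1 z w hz fun _ => rfl) (k1 w _ hw hw1)
    ((k2 z _ hz (orient_reflect z w)).imp_left Eq.symm)
    ((k2 w z hw fun r => orient_swap _ _ _).imp_left Eq.symm)
    (hE.pos z (Or.inr hz) (hY z hz _ hE.left_mem) (hY z hz _ hE.right_mem))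
    (hE.pos w (Or.inr hw) (hY w hw _ hE.left_mem) (hY w hw _ hE.right_mem))

theorem IsTwinEdge.mem_of_convex {R Y : Set Plane} {p p' y z : Plane} (T : IsTwinEdge R Y p p' y)
    {S : Set Plane} (hS : Convex ℝ S) (hz : z ∈ R) (hzp : z ≠ p) (hzp' : z ≠ p') (h : z ∈ S)
    (hp : p ∈ S) (hp' : p' ∈ S) : y ∈ S :=
  (T.inTriangle z hz hzp hzp').mem_of_convex hS hp hp' h

/-- If only `y` were on the other side, all remaining vertices would be there too, since `y` is in
every triangle that they form with `p` and `p'`. The line would then cross the two hull edges next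
to `pp'`, and `z` and `w` would lie in the quadrilateral of `p`, `p'` and their outer neighbours. -/
theorem IsTwinEdge.pos_of_pos_inner {R Y : Set Plane} (H : LayerPair R Y) (h4 : 4 ≤ R.ncard)
    {p p' y z w : Plane} (T : IsTwinEdge R Y p p' y) (hz : z ∈ Y) (hw : w ∈ Y) (hzy : z ≠ y)
    (hwy : w ≠ y) (hzw : z ≠ w) (hp : 0 < orient z w p) (hp' : 0 < orient z w p') :
    0 < orient z w y := by
  have hY : ∀ x ∈ Y, ∀ r ∈ R, x ≠ r := fun x hx r hr h =>
    Set.disjoint_left.1 H.disjoint hr (h ▸ hx)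
  have hne : ∀ r ∈ R, orient z w r ≠ 0 := fun r hr =>
    H.generalPosition.orient_ne_zero (Or.inr hz) (Or.inr hw) (Or.inl hr) hzw (hY z hz r hr)
      (hY w hw r hr)
  have hney := H.generalPosition.orient_ne_zero (Or.inr hz) (Or.inr hw) (Or.inr T.mem) hzw hzy hwy
  refine lt_of_le_of_ne (not_lt.1 fun hy => hzw ?_) hney.symm
  have hR : ∀ r ∈ R, r ≠ p → r ≠ p' → orient z w r < 0 := by
    intro r hr hrp hrp'
    by_contra! h
    have := T.mem_of_convex (convex_orient_nonneg z w) hr hrp hrp' h hp.le hp'.le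
    simp only [Set.mem_ofPred_eq] at this
    linarith
  obtain ⟨q, e, rfl⟩ := H.exists_ccwEnum (by omega) T.right_mem
  obtain ⟨L, hL⟩ : ∃ L, R.ncard - 1 = L + 1 := ⟨R.ncard - 2, by omega⟩
  rw [hL] at e
  obtain rfl := T.toIsHullEdge.left_unique (e.isHullEdge_last (by omega))
  have e1 := e.isHullEdge (i := 0) (by omega)
  have e2 := e.isHullEdge (i := L) (by omega)
  simp only [zero_add] at e1
  have h1 := hR (q 1) e1.right_mem (e.inj 1 (L + 1) (by omega) le_rfl) e1.ne.symm
  have h2 := hR (q L) e2.left_mem e2.ne (e.inj 0 L (by omega) (by omega)).symm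
  have c : q L ≠ q 1 → 0 < orient (q 1) (q L) (q 0) ∧ 0 < orient (q 1) (q L) (q (L + 1)) := fun _ =>
    ⟨by rw [← orient_rotate]; exact e.pos 0 1 L (by omega) (by omega) (by omega),
     e.pos 1 L (L + 1) (by omega) (by omega) le_rfl⟩
  have hq : q L ≠ q 1 := (e.inj 1 L (by omega) (by omega)).symm
  have k : ∀ x w', x ∈ Y → (∀ r, orient x w' r = orient z w r) → 0 < orient (q 1) (q L) x :=
    fun x w' hx hf => (H.orient_pos_of_crossing (w := w') hx e1 e2 (by rwa [hf]) (by rwa [hf])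
      (by rwa [hf]) (by rwa [hf]) c).resolve_left hq
  have hw1 : ∀ r, orient w (w + w - z) r = orient z w r := fun r => by
    rw [orient_reflect, orient_swap, neg_neg]
  exact T.eq_of_quadrilateral H e1.right_mem e2.left_mem (e.inj 1 (L + 1) (by omega) le_rfl)
    (e.inj 0 L (by omega) (by omega)).symm hz hw hzy hwy
    (Or.inr (e.edge 0 (by omega) z hz)) (Or.inr (e.edge 0 (by omega) w hw))
    (Or.inr (e.edge L (by omega) z hz)) (Or.inr (e.edge L (by omega) w hw))
    (k z w hz fun _ => rfl) (k w _ hw hw1)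

/-- The three points `p`, `p'`, `y` lie on the same side of the line `zw`. -/
def SameSide (p p' y z w : Plane) : Prop :=
  (0 < orient z w p ∧ 0 < orient z w p' ∧ 0 < orient z w y) ∨
  (0 < orient w z p ∧ 0 < orient w z p' ∧ 0 < orient w z y)

theorem SameSide.symm {p p' y z w : Plane} (h : SameSide p p' y z w) : SameSide p p' y w z :=
  Or.symm h

theorem InTriangle.orient_pos_left {a b c p x : Plane} (t : InTriangle a b c p)
    (ha : 0 < orient x c a) (hb : 0 < orient x c b) : 0 < orient x c p := by
  have key : orient a b c * orient x c p = orient b c p * orient x c a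
      + orient c a p * orient x c b := by unfold orient; ring
  have : 0 < orient a b c * orient x c p := by
    rw [key]
    exact add_pos (mul_pos t.2.1 ha) (mul_pos t.2.2 hb)
  exact (pos_iff_pos_of_mul_pos this).1 t.orient_pos

theorem InTriangle.orient_pos_right {a b c p x : Plane} (t : InTriangle a b c p)
    (ha : 0 < orient c x a) (hb : 0 < orient c x b) : 0 < orient c x p := by
  have key : orient a b c * orient c x p = orient b c p * orient c x a
      + orient c a p * orient c x b := by unfold orient; ring
  have : 0 < orient a b c * orient c x p := by
    rw [key]
    exact add_pos (mul_pos t.2.1 ha) (mul_pos t.2.2 hb)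
  exact (pos_iff_pos_of_mul_pos this).1 t.orient_pos

/-- If the line `zw` separates `p` and `p'`, then either `w` is inside `pp'z`, where the only
possible point is `y`, or the hull vertex `z` is inside `pp'w`. Once `p` and `p'` are on one side,
`y` is there as well because it lies in the triangle `pp'z`. -/
theorem IsTwinEdge.sameSide_outer {R Y : Set Plane} (H : LayerPair R Y)
    {p p' y z w : Plane} (T : IsTwinEdge R Y p p' y) (hz : z ∈ R) (hw : w ∈ R ∪ Y)
    (hzp : z ≠ p) (hzp' : z ≠ p') (hwp : w ≠ p) (hwp' : w ≠ p') (hwy : w ≠ y)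
    (hzw : z ≠ w) : SameSide p p' y z w := by
  have ht := T.inTriangle z hz hzp hzp'
  have hext : ∀ {a b c d : Plane}, a ∈ R ∪ Y → b ∈ R ∪ Y → c ∈ R ∪ Y → d ∈ R →
      ¬ InTriangle a b c d :=
    fun ha hb hc hd => not_inTriangle_of_mem_hullVertices (by rwa [H.hull]) ha hb hc
  have h1 := H.generalPosition.orient_ne_zero (Or.inl hz) hw (Or.inl T.left_mem) hzw hzp hwp
  have h2 := H.generalPosition.orient_ne_zero (Or.inl hz) hw (Or.inl T.right_mem) hzw hzp' hwp'
  have ez := T.pos z (Or.inl hz) hzp hzp'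
  have ew := T.pos w hw hwp hwp'
  rcases lt_or_gt_of_ne h1 with h1 | h1 <;> rcases lt_or_gt_of_ne h2 with h2 | h2
  · rw [orient_swap, neg_lt_zero] at h1 h2
    exact Or.inr ⟨h1, h2, ht.orient_pos_left h1 h2⟩
  · exfalso
    have t : InTriangle p p' z w := by
      refine ⟨ew, by rwa [orient_rotate], ?_⟩
      rw [orient_swap_right]
      linarith
    rcases hw with hw | hw
    · exact hext (Or.inl T.left_mem) (Or.inl T.right_mem) (Or.inl hz) hw t
    · exact hwy (H.eq_of_inTriangle T.left_mem T.right_mem hz hw T.mem t ht)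
  · exfalso
    refine hext (Or.inl T.left_mem) (Or.inl T.right_mem) hw hz ⟨ez, ?_, ?_⟩
    · rw [← orient_rotate, orient_swap_right]
      linarith
    · rwa [← orient_rotate]
  · exact Or.inl ⟨h1, h2, ht.orient_pos_right h1 h2⟩

/-- No line through two other points separates the points of a twin edge and its interior point. -/
theorem IsTwinEdge.sameSide {R Y : Set Plane} (H : LayerPair R Y) (h4 : 4 ≤ R.ncard)
    {p p' y z w : Plane} (T : IsTwinEdge R Y p p' y) (hz : z ∈ R ∪ Y) (hw : w ∈ R ∪ Y)
    (hzp : z ≠ p) (hzp' : z ≠ p') (hzy : z ≠ y) (hwp : w ≠ p) (hwp' : w ≠ p') (hwy : w ≠ y)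
    (hzw : z ≠ w) : SameSide p p' y z w := by
  rcases id hz with hz' | hz'
  · exact T.sameSide_outer H hz' hw hzp hzp' hwp hwp' hwy hzw
  rcases id hw with hw' | hw'
  · exact (T.sameSide_outer H hw' hz hwp hwp' hzp hzp' hzy hzw.symm).symm
  have h1 := H.generalPosition.orient_ne_zero hz hw (Or.inl T.left_mem) hzw hzp hwp
  rcases lt_or_gt_of_ne h1 with h1 | h1
  · rw [orient_swap, neg_lt_zero] at h1
    have h2 := T.pos_of_pos H h4 hw' hz' hwy hzy hzw.symm h1
    exact Or.inr ⟨h1, h2, T.pos_of_pos_inner H h4 hw' hz' hwy hzy hzw.symm h1 h2⟩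
  · have h2 := T.pos_of_pos H h4 hz' hw' hzy hwy hzw h1
    exact Or.inl ⟨h1, h2, T.pos_of_pos_inner H h4 hz' hw' hzy hwy hzw h1 h2⟩

/-- For `z` in `R` these are two sides of the triangle `pp'z` around `y`. An inner point on the
wrong side of `py` would lie with `y` in the ear at `p'`; on the wrong side of `yp'`, in the ear at
`p`. -/
theorem IsTwinEdge.external {R Y : Set Plane} (H : LayerPair R Y) (h4 : 4 ≤ R.ncard)
    {p p' y z : Plane} (T : IsTwinEdge R Y p p' y) (hz : z ∈ R ∪ Y) (hzp : z ≠ p) (hzp' : z ≠ p')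
    (hzy : z ≠ y) : 0 < orient p y z ∧ 0 < orient y p' z := by
  have hY : ∀ x ∈ Y, ∀ r ∈ R, x ≠ r := fun x hx r hr h =>
    Set.disjoint_left.1 H.disjoint hr (h ▸ hx)
  rcases hz with hz | hz
  · have t := T.inTriangle z hz hzp hzp'
    exact ⟨by rw [orient_rotate, orient_rotate]; exact t.2.2,
      by rw [orient_rotate]; exact t.2.1⟩
  have hyz := H.generalPosition.orient_ne_zero (Or.inl T.left_mem) (Or.inr T.mem) (Or.inr hz)
    (hY _ T.mem _ T.left_mem).symm hzp.symm hzy.symm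
  have hyz' := H.generalPosition.orient_ne_zero (Or.inr T.mem) (Or.inl T.right_mem) (Or.inr hz)
    (hY _ T.mem _ T.right_mem) hzy.symm hzp'.symm
  have hez := T.pos z (Or.inr hz) hzp hzp'
  obtain ⟨q, e, rfl⟩ := H.exists_ccwEnum (by omega) T.left_mem
  set L := R.ncard - 1
  have h01 := e.isHullEdge (i := 0) (by omega)
  obtain rfl := T.right_unique h01
  simp only [zero_add] at *
  have t2 := T.inTriangle (q 2) (e.mem 2 (by omega)) (e.inj 0 2 (by omega) (by omega)).symm
    (e.inj 1 2 (by omega) (by omega)).symm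
  have tL := T.inTriangle (q L) (e.mem L le_rfl) (e.inj 0 L (by omega) (by omega)).symm
    (e.inj 1 L (by omega) (by omega)).symm
  constructor
  · refine lt_of_le_of_ne (not_lt.1 fun h => hzy ?_) hyz.symm
    refine H.eq_of_inTriangle T.left_mem T.right_mem (e.mem 2 (by omega)) hz T.mem
      ⟨hez, e.edge 1 (by omega) z hz, ?_⟩ t2
    rw [orient_rotate]
    refine orient_trans (x := q 1) (b := y) hez t2.1 (e.pos 0 1 2 (by omega) (by omega) (by omega))
      ?_ ?_
    · rw [orient_swap_right]; linarith
    · rw [← orient_rotate]; exact t2.2.2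
  · refine lt_of_le_of_ne (not_lt.1 fun h => hzy ?_) hyz'.symm
    refine H.eq_of_inTriangle T.left_mem T.right_mem (e.mem L le_rfl) hz T.mem
      ⟨hez, ?_, e.last z hz⟩ tL
    refine orient_trans' (x := q 0) (b := y) (e.pos 0 1 L (by omega) (by omega) (by omega)) t2.1
      hez tL.2.1 ?_
    rw [orient_swap]; linarith

/-! ## The orientation of triples of nodes of a binary tree -/

/-- The triples of nodes whose labels are positively oriented by the separation conditions. -/
inductive PosTriple : List ℕ → List ℕ → List ℕ → Prop
  | internal (m u v w : List ℕ) (hu : m ++ [0] <+: u) (hv : m ++ [1] <+: v)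
      (h0 : ¬ m ++ [0] <+: w) (h1 : ¬ m ++ [1] <+: w) : PosTriple u v w
  | left (m a z : List ℕ) (ha : m ++ [0] <+: a) (hz : ¬ m <+: z) : PosTriple a m z
  | right (m b z : List ℕ) (hb : m ++ [1] <+: b) (hz : ¬ m <+: z) : PosTriple m b z
  | rotate (u v w : List ℕ) (h : PosTriple u v w) : PosTriple v w u

/-- The labeling `x` of the nodes in `N` is an internal and external separation. -/
def Separated (N : Set (List ℕ)) (x : List ℕ → Plane) : Prop :=
  ∀ u ∈ N, ∀ v ∈ N, ∀ w ∈ N, PosTriple u v w → 0 < orient (x u) (x v) (x w)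

theorem Separated.mono {N N' : Set (List ℕ)} {x : List ℕ → Plane} (h : Separated N' x)
    (hN : N ⊆ N') : Separated N x :=
  fun u hu v hv w hw => h u (hN hu) v (hN hv) w (hN hw)

theorem eq_of_append_singleton_prefix {m u : List ℕ} {i j : ℕ} (hi : m ++ [i] <+: u)
    (hj : m ++ [j] <+: u) : i = j := by
  have := (List.prefix_of_prefix_length_le hi hj (by simp)).eq_of_length (by simp)
  simpa using this

theorem exists_append_singleton_prefix {m u : List ℕ} (h : m <+: u) (hne : m ≠ u) :
    ∃ i, m ++ [i] <+: u ∧ i ∈ u := by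
  obtain ⟨t, rfl⟩ := h
  cases t with
  | nil => simp at hne
  | cons i t => exact ⟨i, ⟨t, by simp⟩, by simp⟩

theorem prefix_of_append_singleton_prefix {m u : List ℕ} {i : ℕ} (h : m ++ [i] <+: u) : m <+: u :=
  (List.prefix_append m [i]).trans h

theorem not_append_singleton_prefix_self (m : List ℕ) (i : ℕ) : ¬ m ++ [i] <+: m := by
  intro h
  simpa using h.length_le

/-- If `m` is the meet of `u` and `v` then every common prefix of `u` and `v` is a prefix of `m`. -/
theorem prefix_meet {m c u v : List ℕ} {i j : ℕ} (hij : i ≠ j) (hu : m ++ [i] <+: u)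
    (hv : m ++ [j] <+: v) (hcu : c <+: u) (hcv : c <+: v) : c <+: m := by
  rcases List.prefix_or_prefix_of_prefix hcu (prefix_of_append_singleton_prefix hu) with h | h
  · exact h
  by_cases hmc : m = c
  · rw [hmc]
  obtain ⟨k, hk, -⟩ := exists_append_singleton_prefix h hmc
  exact absurd ((eq_of_append_singleton_prefix hu (hk.trans hcu)).trans
    (eq_of_append_singleton_prefix hv (hk.trans hcv)).symm) hij

theorem node_cases {u v : List ℕ} (hu : ∀ i ∈ u, i < 2) (hv : ∀ i ∈ v, i < 2) (huv : u ≠ v) :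
    (∃ m, m ++ [0] <+: u ∧ m ++ [1] <+: v) ∨ (∃ m, m ++ [1] <+: u ∧ m ++ [0] <+: v) ∨
      (u ++ [0] <+: v ∨ u ++ [1] <+: v) ∨ (v ++ [0] <+: u ∨ v ++ [1] <+: u) := by
  induction u generalizing v with
  | nil =>
    obtain ⟨i, hi, hiv⟩ := exists_append_singleton_prefix (List.nil_prefix (l := v)) huv
    have := hv i hiv
    right; right; left
    interval_cases i <;> simp_all
  | cons a u ih =>
    cases v with
    | nil =>
      right; right; right
      have := hu a (by simp)
      interval_cases a
      · left; simp
      · right; simp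
    | cons b v =>
      have ha := hu a (by simp)
      have hb := hv b (by simp)
      by_cases hab : a = b
      · subst hab
        have huv' : u ≠ v := by rintro rfl; exact huv rfl
        rcases ih (fun i hi => hu i (by simp [hi])) (fun i hi => hv i (by simp [hi])) huv' with
          ⟨m, h1, h2⟩ | ⟨m, h1, h2⟩ | h | h
        · exact Or.inl ⟨a :: m, by simpa using h1, by simpa using h2⟩
        · exact Or.inr (Or.inl ⟨a :: m, by simpa using h1, by simpa using h2⟩)
        · exact Or.inr (Or.inr (Or.inl (by simpa using h)))
        · exact Or.inr (Or.inr (Or.inr (by simpa using h)))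
      · have : (a = 0 ∧ b = 1) ∨ (a = 1 ∧ b = 0) := by omega
        rcases this with ⟨rfl, rfl⟩ | ⟨rfl, rfl⟩
        · exact Or.inl ⟨[], by simp, by simp⟩
        · exact Or.inr (Or.inl ⟨[], by simp, by simp⟩)

/-- All the nodes outside a subtree are on the same side of two nodes of the subtree. -/
theorem posTriple_of_outside {u w c : List ℕ} (hu : ∀ i ∈ u, i < 2) (hw : ∀ i ∈ w, i < 2)
    (huw : u ≠ w) (hcu : c <+: u) (hcw : c <+: w) :
    (∀ v, ¬ c <+: v → PosTriple u w v) ∨ (∀ v, ¬ c <+: v → PosTriple w u v) := by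
  have hsub : ∀ {m v : List ℕ} {i : ℕ}, c <+: m → ¬ c <+: v → ¬ m ++ [i] <+: v :=
    fun hcm hv h => hv (hcm.trans (prefix_of_append_singleton_prefix h))
  rcases node_cases hu hw huw with ⟨m, h1, h2⟩ | ⟨m, h1, h2⟩ | (h | h) | (h | h)
  · have hcm := prefix_meet (by simp) h1 h2 hcu hcw
    exact Or.inl fun v hv => .internal m u w v h1 h2 (hsub hcm hv) (hsub hcm hv)
  · have hcm := prefix_meet (by simp) h1 h2 hcu hcw
    exact Or.inr fun v hv => .internal m w u v h2 h1 (hsub hcm hv) (hsub hcm hv)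
  · exact Or.inr fun v hv => .left u w v h fun h' => hv (hcu.trans h')
  · exact Or.inl fun v hv => .right u w v h fun h' => hv (hcu.trans h')
  · exact Or.inl fun v hv => .left w u v h fun h' => hv (hcw.trans h')
  · exact Or.inr fun v hv => .right w u v h fun h' => hv (hcw.trans h')

theorem PosTriple.rotate' {u v w : List ℕ} (h : PosTriple u v w) : PosTriple w u v :=
  (h.rotate).rotate

/-- The combinatorial reason that separation determines the order type. If `u` and `v` diverge at
`m`, then either `w` avoids both branches, which is an internal triple, or it shares a branch with
one of them and the third node is outside that branch, so `posTriple_of_outside` applies. If one of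
`u`, `v` lies below the other, the external triples and the same argument suffice. -/
theorem posTriple_trichotomy {u v w : List ℕ} (hu : ∀ i ∈ u, i < 2) (hv : ∀ i ∈ v, i < 2)
    (hw : ∀ i ∈ w, i < 2) (huv : u ≠ v) (huw : u ≠ w) (hvw : v ≠ w) :
    PosTriple u v w ∨ PosTriple v u w := by
  have diverge : ∀ {u v : List ℕ} (m : List ℕ), (∀ i ∈ u, i < 2) → (∀ i ∈ v, i < 2) →
      u ≠ w → v ≠ w → m ++ [0] <+: u → m ++ [1] <+: v → PosTriple u v w ∨ PosTriple v u w := by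
    intro u v m hu hv huw hvw h0 h1
    by_cases hw0 : m ++ [0] <+: w
    · have hv0 : ¬ m ++ [0] <+: v := fun h => by
        simpa using eq_of_append_singleton_prefix h h1
      rcases posTriple_of_outside hu hw huw h0 hw0 with h | h
      · exact Or.inr (h v hv0).rotate'
      · exact Or.inl (h v hv0).rotate
    by_cases hw1 : m ++ [1] <+: w
    · have hu1 : ¬ m ++ [1] <+: u := fun h => by
        simpa using eq_of_append_singleton_prefix h h0
      rcases posTriple_of_outside hv hw hvw h1 hw1 with h | h
      · exact Or.inl (h u hu1).rotate'
      · exact Or.inr (h u hu1).rotate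
    exact Or.inl (.internal m u v w h0 h1 hw0 hw1)
  have below : ∀ {u v : List ℕ}, (∀ i ∈ u, i < 2) → (∀ i ∈ v, i < 2) → u ≠ w → v ≠ w →
      (u ++ [0] <+: v ∨ u ++ [1] <+: v) → PosTriple u v w ∨ PosTriple v u w := by
    intro u v hu hv huw hvw h
    by_cases huw' : u <+: w
    · obtain ⟨j, hj, hjw⟩ := exists_append_singleton_prefix huw' huw
      have hj2 := hw j hjw
      have key : ∀ i, u ++ [i] <+: v → u ++ [i] <+: w → PosTriple u v w ∨ PosTriple v u w := by
        intro i hiv hiw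
        rcases posTriple_of_outside hv hw hvw hiv hiw with h | h
        · exact Or.inl (h u (not_append_singleton_prefix_self u i)).rotate'
        · exact Or.inr (h u (not_append_singleton_prefix_self u i)).rotate
      have hint : ∀ {v w : List ℕ}, u ++ [0] <+: v → u ++ [1] <+: w → PosTriple v w u :=
        fun h h' => .internal u _ _ u h h' (not_append_singleton_prefix_self u 0)
          (not_append_singleton_prefix_self u 1)
      interval_cases j
      · rcases h with h | h
        · exact key 0 h hj
        · exact Or.inr (hint hj h).rotate
      · rcases h with h | h
        · exact Or.inl (hint h hj).rotate'
        · exact key 1 h hj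
    · rcases h with h | h
      · exact Or.inr (.left u v w h huw')
      · exact Or.inl (.right u v w h huw')
  rcases node_cases hu hv huv with ⟨m, h1, h2⟩ | ⟨m, h1, h2⟩ | h | h
  · exact diverge m hu hv huw hvw h1 h2
  · exact (diverge m hv hu hvw huw h2 h1).symm
  · exact below hu hv huw hvw h
  · exact (below hv hu hvw huw h).symm

/-- The orientation does not change if a node is replaced by one of its descendants. -/
theorem PosTriple.descend {u v w : List ℕ} (h : PosTriple u v w) :
    (∀ u', u <+: u' → ¬ u <+: v → ¬ u <+: w → PosTriple u' v w) ∧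
    (∀ v', v <+: v' → ¬ v <+: w → ¬ v <+: u → PosTriple u v' w) ∧
    (∀ w', w <+: w' → ¬ w <+: u → ¬ w <+: v → PosTriple u v w') := by
  have key : ∀ {c a z z' : List ℕ}, c <+: a → z <+: z' → ¬ z <+: a → ¬ c <+: z → ¬ c <+: z' := by
    intro c a z z' hca hzz hza hcz h
    rcases List.prefix_or_prefix_of_prefix h hzz with h' | h'
    · exact hcz h'
    · exact hza (h'.trans hca)
  induction h with
  | internal m u v w hu hv h0 h1 =>
    exact ⟨fun u' h _ _ => .internal m u' v w (hu.trans h) hv h0 h1,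
      fun v' h _ _ => .internal m u v' w hu (hv.trans h) h0 h1,
      fun w' h hwu hwv => .internal m u v w' hu hv (key hu h hwu h0) (key hv h hwv h1)⟩
  | left m a z ha hz =>
    have hma := prefix_of_append_singleton_prefix ha
    exact ⟨fun a' h _ _ => .left m a' z (ha.trans h) hz, fun m' _ _ h => absurd hma h,
      fun z' h hza _ => .left m a z' ha (key hma h hza hz)⟩
  | right m b z hb hz =>
    have hmb := prefix_of_append_singleton_prefix hb
    exact ⟨fun m' _ h _ => absurd hmb h, fun b' h _ _ => .right m b' z (hb.trans h) hz,
      fun z' h _ hzb => .right m b z' hb (key hmb h hzb hz)⟩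
  | rotate u v w _ ih =>
    exact ⟨fun v' h h1 h2 => (ih.2.1 v' h h1 h2).rotate, fun w' h h1 h2 => (ih.2.2 w' h h1 h2).rotate,
      fun u' h h1 h2 => (ih.1 u' h h1 h2).rotate⟩

/-! ## Separated labelings determine the order type -/

theorem Separated.sign_eq {N : Set (List ℕ)} {x y : List ℕ → Plane} (hx : Separated N x)
    (hy : Separated N y) (hN : ∀ u ∈ N, ∀ i ∈ u, i < 2) {u v w : List ℕ} (hu : u ∈ N) (hv : v ∈ N)
    (hw : w ∈ N) :
    SignType.sign (orient (y u) (y v) (y w)) = SignType.sign (orient (x u) (x v) (x w)) := by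
  by_cases huv : u = v
  · simp [huv]
  by_cases huw : u = w
  · simp [huw]
  by_cases hvw : v = w
  · simp [hvw]
  rcases posTriple_trichotomy (hN u hu) (hN v hv) (hN w hw) huv huw hvw with h | h
  · rw [sign_pos (hx u hu v hv w hw h), sign_pos (hy u hu v hv w hw h)]
  · have h1 := hx v hv u hu w hw h
    have h2 := hy v hv u hu w hw h
    rw [orient_swap] at h1 h2
    rw [sign_neg (by linarith), sign_neg (by linarith)]

theorem Separated.sameOrderType {N X Y : Set _} {x y : List ℕ → Plane} (hx : Separated N x)
    (hy : Separated N y) (hN : ∀ u ∈ N, ∀ i ∈ u, i < 2) (hX : Set.BijOn x N X)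
    (hY : Set.BijOn y N Y) : SameOrderType X Y := by
  refine ⟨(Set.BijOn.equiv x hX).symm.trans (Set.BijOn.equiv y hY), ?_⟩
  have key : ∀ a : X, ∃ u ∈ N, x u = a ∧
      (((Set.BijOn.equiv x hX).symm.trans (Set.BijOn.equiv y hY)) a : Plane) = y u := by
    intro a
    refine ⟨(Set.BijOn.equiv x hX).symm a, Subtype.coe_prop _, ?_, rfl⟩
    exact congrArg Subtype.val ((Set.BijOn.equiv x hX).apply_symm_apply a)
  intro a b c
  obtain ⟨u, hu, hxu, hyu⟩ := key a
  obtain ⟨v, hv, hxv, hyv⟩ := key b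
  obtain ⟨w, hw, hxw, hyw⟩ := key c
  rw [hyu, hyv, hyw, ← hxu, ← hxv, ← hxw]
  exact hx.sign_eq hy hN hu hv hw

/-! ## Separated labelings of nested almost convex sets -/

/-- The sets of binary words that occur as the nodes of the labeled trees of unbounded height. -/
structure Forest (T : Set (List ℕ)) : Prop where
  binary : ∀ u ∈ T, ∀ i ∈ u, i < 2
  append : ∀ u ∈ T, ∀ i < 2, u ++ [i] ∈ T
  nil_notMem : [] ∉ T
  zero_mem : [0] ∈ T
  -- The empty word is a meet but carries no label. In the second forest `[1]` has no label either,
  -- but it is never a meet.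
  meet : ∀ m u v, u ∈ T → v ∈ T → m ++ [0] <+: u → m ++ [1] <+: v → m ≠ [] → m ∈ T
  outside : ∀ v ∈ T, ∀ j, v.length < j → ∃ c ∈ T, c.length = j ∧ ¬ v <+: c
  -- A supporting line at `v` in combinatorial form. The first alternative is for an innermost layer
  -- with a single node.
  boundary : ∀ v ∈ T, (∀ z ∈ T, z.length ≤ v.length → z = v) ∨
    ∃ v' ∈ T, v'.length = v.length ∧ v' ≠ v ∧
      ((∀ z ∈ T, z.length ≤ v.length → z ≠ v → z ≠ v' → PosTriple v v' z) ∨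
        (∀ z ∈ T, z.length ≤ v.length → z ≠ v → z ≠ v' → PosTriple v' v z))

/-- The nodes of level at most `k`. -/
def truncation (T : Set (List ℕ)) (k : ℕ) : Set (List ℕ) := {u ∈ T | u.length ≤ k}

/-- The nodes of level `k`. -/
def levelSet (T : Set (List ℕ)) (k : ℕ) : Set (List ℕ) := {u ∈ T | u.length = k}

theorem truncation_mono (T : Set (List ℕ)) {j k : ℕ} (h : j ≤ k) :
    truncation T j ⊆ truncation T k := fun _ hu => ⟨hu.1, hu.2.trans h⟩

namespace Forest

variable {T : Set (List ℕ)}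

theorem append_replicate (F : Forest T) {u : List ℕ} (hu : u ∈ T) (n : ℕ) :
    u ++ List.replicate n 0 ∈ T := by
  induction n with
  | zero => simpa using hu
  | succ n ih =>
    rw [List.replicate_succ', ← List.append_assoc]
    exact F.append _ ih 0 (by norm_num)

theorem exists_below (F : Forest T) {u : List ℕ} (hu : u ∈ T) {j : ℕ} (hj : u.length ≤ j) :
    ∃ a ∈ T, a.length = j ∧ u <+: a :=
  ⟨_, F.append_replicate hu (j - u.length), by simp; omega, List.prefix_append _ _⟩

theorem exists_level (F : Forest T) {j : ℕ} (hj : 1 ≤ j) : ∃ a ∈ T, a.length = j := by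
  obtain ⟨a, ha, h, -⟩ := F.exists_below F.zero_mem (j := j) (by simpa using hj)
  exact ⟨a, ha, h⟩

theorem finite_truncation (F : Forest T) (k : ℕ) : (truncation T k).Finite := by
  refine ((List.finite_length_le (Fin 2) k).image (List.map Fin.val)).subset ?_
  rintro u ⟨hu, hk⟩
  refine ⟨u.attach.map fun i => ⟨i.1, F.binary u hu i.1 i.2⟩, by simpa using hk, ?_⟩
  simp [List.map_map, Function.comp_def]

theorem truncation_zero (F : Forest T) : truncation T 0 = ∅ := by
  ext u
  simp only [truncation, Set.mem_ofPred_eq, Set.mem_empty_iff_false, iff_false, not_and]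
  intro hu h
  have : u = [] := List.length_eq_zero_iff.1 (by omega)
  exact F.nil_notMem (this ▸ hu)

/-- Internal separation at `m` handles the side `ab`, external separation at `m` the two sides at
`c`. -/
theorem inTriangle_meet (F : Forest T) {j : ℕ} {x : List ℕ → Plane}
    (hx : Separated (truncation T j) x) {m a b c : List ℕ} (ha : a ∈ truncation T j)
    (hb : b ∈ truncation T j) (hc : c ∈ truncation T j) (hm0 : m ++ [0] <+: a)
    (hm1 : m ++ [1] <+: b) (hmc : ¬ m <+: c) :
    m ∈ T ∧ m.length < j ∧ InTriangle (x a) (x b) (x c) (x m) := by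
  have hm : m ∈ T := F.meet m a b ha.1 hb.1 hm0 hm1 (by rintro rfl; simp at hmc)
  have hmj : m.length < j := by
    have := hm0.length_le.trans ha.2
    simp at this; omega
  have hmt : m ∈ truncation T j := ⟨hm, hmj.le⟩
  refine ⟨hm, hmj, ?_, ?_, ?_⟩
  · exact hx a ha b hb m hmt (.internal m a b m hm0 hm1 (not_append_singleton_prefix_self m 0)
      (not_append_singleton_prefix_self m 1))
  · rw [← orient_rotate]
    exact hx m hmt b hb c hc (.right m b c hm1 hmc)
  · rw [orient_rotate]
    exact hx a ha m hmt c hc (.left m a c hm0 hmc)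

/-- A line from a vertex of a triangle through an inner point separates the other two vertices. If
`z` and `a` share a branch at `m`, then `b` and `c` are outside it and hence on one side of the line
`za`; a common branch with `b` is excluded likewise. If `z` is not below `m`, then `a` and `b` are
on the side of the line `cz` on which `m` is, by `PosTriple.descend`. -/
theorem eq_meet_of_inTriangle (F : Forest T) {j : ℕ} {x : List ℕ → Plane}
    (hx : Separated (truncation T j) x) {m a b c z : List ℕ} (ha : a ∈ T)
    (hb : b ∈ T) (hc : c ∈ T) (haj : a.length = j) (hbj : b.length = j) (hcj : c.length = j)
    (hm0 : m ++ [0] <+: a) (hm1 : m ++ [1] <+: b) (hmc : ¬ m <+: c) (hz : z ∈ T)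
    (hzj : z.length < j) (ht : InTriangle (x a) (x b) (x c) (x z)) : z = m := by
  have hat : a ∈ truncation T j := ⟨ha, haj.le⟩
  have hbt : b ∈ truncation T j := ⟨hb, hbj.le⟩
  have hct : c ∈ truncation T j := ⟨hc, hcj.le⟩
  have hzt : z ∈ truncation T j := ⟨hz, hzj.le⟩
  obtain ⟨h1, h2, h3⟩ := ht
  have side : ∀ {p u v : List ℕ}, p ∈ truncation T j → u ∈ truncation T j → v ∈ truncation T j →
      0 < orient (x u) (x p) (x z) → 0 < orient (x p) (x v) (x z) →
      (PosTriple z p u ∧ PosTriple z p v) ∨ (PosTriple p z u ∧ PosTriple p z v) → False := by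
    intro p u v hp hu hv h h' hh
    rcases hh with ⟨k1, k2⟩ | ⟨k1, k2⟩
    · have := hx z hzt p hp u hu k1
      rw [orient_rotate, orient_swap] at this
      linarith
    · have := hx p hp z hzt v hv k2
      rw [orient_swap_right] at this
      linarith
  have hzm : ¬ z.length = j := hzj.ne
  by_cases hz0 : m ++ [0] <+: z
  · have hza : z ≠ a := by rintro rfl; exact hzm haj
    have hb0 : ¬ m ++ [0] <+: b := fun h => by simpa using eq_of_append_singleton_prefix h hm1
    have hc0 : ¬ m ++ [0] <+: c := fun h => hmc (prefix_of_append_singleton_prefix h)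
    refine (side hat hct hbt h3 h1 ?_).elim
    exact (posTriple_of_outside (F.binary z hz) (F.binary a ha) hza hz0 hm0).imp
      (fun h => ⟨h c hc0, h b hb0⟩) (fun h => ⟨h c hc0, h b hb0⟩)
  by_cases hz1 : m ++ [1] <+: z
  · have hzb : z ≠ b := by rintro rfl; exact hzm hbj
    have ha1 : ¬ m ++ [1] <+: a := fun h => by simpa using eq_of_append_singleton_prefix h hm0
    have hc1 : ¬ m ++ [1] <+: c := fun h => hmc (prefix_of_append_singleton_prefix h)
    refine (side hbt hat hct h1 h2 ?_).elim
    exact (posTriple_of_outside (F.binary z hz) (F.binary b hb) hzb hz1 hm1).imp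
      (fun h => ⟨h a ha1, h c hc1⟩) (fun h => ⟨h a ha1, h c hc1⟩)
  by_contra hne
  have hmz : ¬ m <+: z := by
    intro h
    obtain ⟨i, hi, hiz⟩ := exists_append_singleton_prefix h (Ne.symm hne)
    have := F.binary z hz i hiz
    interval_cases i <;> contradiction
  have hmcne : m ≠ c := by rintro rfl; exact hmc List.prefix_rfl
  have hcz : c ≠ z := by rintro rfl; exact hzm hcj
  have hma := prefix_of_append_singleton_prefix hm0
  have hmb := prefix_of_append_singleton_prefix hm1
  have hm : m ∈ T := (F.inTriangle_meet hx hat hbt hct hm0 hm1 hmc).1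
  rcases posTriple_trichotomy (F.binary m hm) (F.binary c hc) (F.binary z hz) hmcne
    (Ne.symm hne) hcz with h | h
  · have := hx a hat c hct z hzt (h.descend.1 a hma hmc hmz)
    rw [orient_swap] at this
    linarith
  · have := hx c hct b hbt z hzt (h.descend.2.1 b hmb hmz hmc)
    rw [orient_swap] at this
    linarith

theorem existsUnique_of_meet (F : Forest T) {j : ℕ} {x : List ℕ → Plane}
    (hx : Separated (truncation T j) x) {m a b c : List ℕ} (ha : a ∈ levelSet T j)
    (hb : b ∈ levelSet T j) (hc : c ∈ levelSet T j) (hm0 : m ++ [0] <+: a)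
    (hm1 : m ++ [1] <+: b) (hc0 : ¬ m ++ [0] <+: c) (hc1 : ¬ m ++ [1] <+: c) :
    ∃ m ∈ T, m.length < j ∧ InTriangle (x a) (x b) (x c) (x m) ∧
      ∀ z ∈ T, z.length < j → InTriangle (x a) (x b) (x c) (x z) → z = m := by
  have hmc : ¬ m <+: c := by
    intro h
    have hne : m ≠ c := by
      rintro rfl
      have h1 := hm0.length_le
      have h2 := ha.2
      have h3 := hc.2
      simp at h1; omega
    obtain ⟨i, hi, hic⟩ := exists_append_singleton_prefix h hne
    have := F.binary c hc.1 i hic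
    interval_cases i <;> contradiction
  obtain ⟨h1, h2, h3⟩ := F.inTriangle_meet hx ⟨ha.1, ha.2.le⟩ ⟨hb.1, hb.2.le⟩ ⟨hc.1, hc.2.le⟩
    hm0 hm1 hmc
  exact ⟨m, h1, h2, h3, fun z hz hzj hzt => F.eq_meet_of_inTriangle hx ha.1 hb.1 hc.1 ha.2 hb.2
    hc.2 hm0 hm1 hmc hz hzj hzt⟩

theorem existsUnique_inTriangle (F : Forest T) {j : ℕ} {x : List ℕ → Plane}
    (hx : Separated (truncation T j) x) {a b c : List ℕ} (h : PosTriple a b c)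
    (ha : a ∈ levelSet T j) (hb : b ∈ levelSet T j) (hc : c ∈ levelSet T j) :
    ∃ m ∈ T, m.length < j ∧ InTriangle (x a) (x b) (x c) (x m) ∧
      ∀ z ∈ T, z.length < j → InTriangle (x a) (x b) (x c) (x z) → z = m := by
  induction h with
  | internal m u v w hu hv h0 h1 => exact F.existsUnique_of_meet hx ha hb hc hu hv h0 h1
  | left m a z h _ =>
    have h1 := h.length_le
    have h2 := ha.2
    have h3 := hb.2
    simp at h1; omega
  | right m a z h _ =>
    have h1 := h.length_le
    have h2 := ha.2
    have h3 := hb.2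
    simp at h1; omega
  | rotate u v w _ ih =>
    obtain ⟨m, h1, h2, h3, h4⟩ := ih hc ha hb
    exact ⟨m, h1, h2, h3.rotate, fun z hz hzj hzt => h4 z hz hzj hzt.rotate.rotate⟩

/-- A node above level `j` lies inside the triangle of two level-`j` descendants from its two
branches and a level-`j` node not below it. For a node of level `j`, the field `boundary` provides a
supporting line. -/
theorem hullVertices_image (F : Forest T) {j : ℕ} {x : List ℕ → Plane}
    (hx : Separated (truncation T j) x) (hinj : Set.InjOn x (truncation T j)) :
    hullVertices (x '' truncation T j) = x '' levelSet T j := by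
  ext p
  constructor
  · intro hp
    obtain ⟨v, hv, rfl⟩ := hullVertices_subset _ hp
    refine ⟨v, ⟨hv.1, hv.2.eq_or_lt.resolve_right fun hlt => ?_⟩, rfl⟩
    obtain ⟨a, ha, haj, hva⟩ := F.exists_below (F.append v hv.1 0 (by norm_num)) (j := j)
      (by simpa using hlt)
    obtain ⟨b, hb, hbj, hvb⟩ := F.exists_below (F.append v hv.1 1 (by norm_num)) (j := j)
      (by simpa using hlt)
    obtain ⟨c, hc, hcj, hvc⟩ := F.outside v hv.1 j hlt
    have hat : a ∈ truncation T j := ⟨ha, haj.le⟩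
    have hbt : b ∈ truncation T j := ⟨hb, hbj.le⟩
    have hct : c ∈ truncation T j := ⟨hc, hcj.le⟩
    exact not_inTriangle_of_mem_hullVertices hp ⟨a, hat, rfl⟩ ⟨b, hbt, rfl⟩ ⟨c, hct, rfl⟩
      (F.inTriangle_meet hx hat hbt hct hva hvb hvc).2.2
  · rintro ⟨v, ⟨hv, rfl⟩, rfl⟩
    have hvt : v ∈ truncation T v.length := ⟨hv, le_rfl⟩
    rcases F.boundary v hv with h | ⟨v', hv', hlen, hne, h⟩
    · refine mem_hullVertices_of_convex (H := ∅) ⟨v, hvt, rfl⟩ convex_empty ?_ (by simp)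
      rintro _ ⟨z, hz, rfl⟩ hzv
      exact absurd (by rw [h z hz.1 hz.2]) hzv
    · have hvt' : v' ∈ truncation T v.length := ⟨hv', hlen.le⟩
      have hxne : x v ≠ x v' := fun he => hne (hinj hvt hvt' he).symm
      -- The supporting line passes through `x v'`, so this point is added to the open half-plane;
      -- the union remains convex.
      have hconv : ∀ a b : Plane, (a = x v' ∨ b = x v') →
          Convex ℝ {z | 0 < orient a b z ∨ z = x v'} := by
        intro a b hab z hz w hw s t hs ht hst
        have h0 : orient a b (x v') = 0 := by rcases hab with rfl | rfl <;> simp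
        have hpos : ∀ {z}, (0 < orient a b z ∨ z = x v') → 0 ≤ orient a b z := by
          rintro z (h | rfl)
          · exact h.le
          · exact h0.ge
        simp only [Set.mem_ofPred_eq] at hz hw ⊢
        rw [orient_combo a b z w hst]
        rcases hs.eq_or_lt with rfl | hs
        · obtain rfl : t = 1 := by linarith
          simpa using hw
        rcases ht.eq_or_lt with rfl | ht
        · obtain rfl : s = 1 := by linarith
          simpa using hz
        rcases id hz with h | h
        · exact Or.inl (add_pos_of_pos_of_nonneg (mul_pos hs h) (mul_nonneg ht.le (hpos hw)))
        rcases id hw with h' | h'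
        · exact Or.inl (add_pos_of_nonneg_of_pos (mul_nonneg hs.le (hpos hz)) (mul_pos ht h'))
        · right
          rw [h, h', ← add_smul, hst, one_smul]
      rcases h with h | h
      · refine mem_hullVertices_of_convex ⟨v, hvt, rfl⟩ (hconv (x v) (x v') (Or.inr rfl)) ?_ ?_
        · rintro _ ⟨z, hz, rfl⟩ hzv
          by_cases hzv' : z = v'
          · exact Or.inr (by rw [hzv'])
          · exact Or.inl (hx v hvt v' hvt' z hz
              (h z hz.1 hz.2 (by rintro rfl; exact hzv rfl) hzv'))
        · simpa using hxne
      · refine mem_hullVertices_of_convex ⟨v, hvt, rfl⟩ (hconv (x v') (x v) (Or.inl rfl)) ?_ ?_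
        · rintro _ ⟨z, hz, rfl⟩ hzv
          by_cases hzv' : z = v'
          · exact Or.inr (by rw [hzv'])
          · exact Or.inl (hx v' hvt' v hvt z hz
              (h z hz.1 hz.2 (by rintro rfl; exact hzv rfl) hzv'))
        · simpa using hxne

theorem truncation_diff_levelSet (j : ℕ) :
    truncation T (j + 1) \ levelSet T (j + 1) = truncation T j := by
  ext u
  simp only [truncation, levelSet, Set.mem_sdiff, Set.mem_ofPred_eq]
  constructor
  · rintro ⟨⟨h1, h2⟩, h3⟩
    exact ⟨h1, by have : u.length ≠ j + 1 := fun h => h3 ⟨h1, h⟩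
                  omega⟩
  · rintro ⟨h1, h2⟩
    exact ⟨⟨h1, by omega⟩, fun h => by omega⟩

theorem levelSet_subset_truncation (j : ℕ) : levelSet T j ⊆ truncation T j :=
  fun _ hu => ⟨hu.1, hu.2.le⟩

theorem iterate_peel_image (F : Forest T) {k : ℕ} {x : List ℕ → Plane}
    (hx : Separated (truncation T k) x) (hinj : Set.InjOn x (truncation T k)) {i : ℕ}
    (hi : i ≤ k) : peel^[i] (x '' truncation T k) = x '' truncation T (k - i) := by
  induction i with
  | zero => simp
  | succ i ih =>
    rw [Function.iterate_succ_apply', ih (by omega), peel]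
    obtain ⟨j, hj⟩ : ∃ j, k - i = j + 1 := ⟨k - i - 1, by omega⟩
    have hsub : truncation T (j + 1) ⊆ truncation T k := truncation_mono T (by omega)
    rw [hj, F.hullVertices_image (hx.mono hsub) (hinj.mono hsub),
      ← (hinj.mono hsub).image_sdiff_subset (levelSet_subset_truncation _),
      truncation_diff_levelSet, show k - (i + 1) = j by omega]

theorem numLayers_image (F : Forest T) {k : ℕ} {x : List ℕ → Plane}
    (hx : Separated (truncation T k) x) (hinj : Set.InjOn x (truncation T k)) :
    numLayers (x '' truncation T k) = k := by
  refine le_antisymm (Nat.sInf_le ?_) (le_csInf ⟨k, ?_⟩ ?_)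
  · rw [Set.mem_ofPred_eq, F.iterate_peel_image hx hinj le_rfl]
    simp [F.truncation_zero]
  · rw [Set.mem_ofPred_eq, F.iterate_peel_image hx hinj le_rfl]
    simp [F.truncation_zero]
  · intro i hi
    by_contra! hlt
    rw [Set.mem_ofPred_eq, F.iterate_peel_image hx hinj hlt.le, Set.image_eq_empty] at hi
    obtain ⟨a, ha, hj⟩ := F.exists_level (j := k - i) (by omega)
    have : a ∈ truncation T (k - i) := ⟨ha, hj.le⟩
    rw [hi] at this
    exact this

theorem layer_image (F : Forest T) {k : ℕ} {x : List ℕ → Plane}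
    (hx : Separated (truncation T k) x) (hinj : Set.InjOn x (truncation T k)) {j : ℕ}
    (hj : j ≤ k) : layer (x '' truncation T k) j = x '' levelSet T j := by
  have hsub : truncation T j ⊆ truncation T k := truncation_mono T hj
  rw [layer, F.numLayers_image hx hinj, F.iterate_peel_image hx hinj (by omega),
    show k - (k - j) = j by omega, F.hullVertices_image (hx.mono hsub) (hinj.mono hsub)]

theorem innerLayers_image (F : Forest T) {k : ℕ} {x : List ℕ → Plane}
    (hx : Separated (truncation T k) x) (hinj : Set.InjOn x (truncation T k)) {j : ℕ}
    (hj : j ≤ k) : innerLayers (x '' truncation T k) j = x '' truncation T j := by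
  ext p
  constructor
  · rintro ⟨i, h1, hi, hp⟩
    rw [F.layer_image hx hinj (hi.trans hj)] at hp
    obtain ⟨u, hu, rfl⟩ := hp
    exact ⟨u, ⟨hu.1, hu.2.trans_le hi⟩, rfl⟩
  · rintro ⟨u, hu, rfl⟩
    have h0 : u.length ≠ 0 := fun h => F.nil_notMem (List.length_eq_zero_iff.1 h ▸ hu.1)
    refine ⟨u.length, by omega, hu.2, ?_⟩
    rw [F.layer_image hx hinj (hu.2.trans hj)]
    exact ⟨u, ⟨hu.1, rfl⟩, rfl⟩

theorem isNestedAlmostConvex_image (F : Forest T) {k : ℕ} {x : List ℕ → Plane}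
    (hx : Separated (truncation T k) x) (hinj : Set.InjOn x (truncation T k)) :
    IsNestedAlmostConvex (x '' truncation T k) := by
  have hnum := F.numLayers_image hx hinj
  have hsub : ∀ {j}, j ≤ k → truncation T j ⊆ truncation T k := fun h => truncation_mono T h
  refine ⟨(F.finite_truncation k).image x, ?_, ?_, ?_⟩
  · intro j _ hj
    rw [hnum] at hj
    rw [F.innerLayers_image hx hinj hj]
    rintro _ ⟨u, hu, rfl⟩ _ ⟨v, hv, rfl⟩ _ ⟨w, hw, rfl⟩ huv huw hvw h
    rw [collinear_iff_orient] at h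
    have hu' := hsub hj hu
    have hv' := hsub hj hv
    have hw' := hsub hj hw
    rcases posTriple_trichotomy (F.binary u hu.1) (F.binary v hv.1) (F.binary w hw.1)
      (by rintro rfl; exact huv rfl) (by rintro rfl; exact huw rfl)
      (by rintro rfl; exact hvw rfl) with h' | h'
    · exact (hx u hu' v hv' w hw' h').ne' h
    · have := hx v hv' u hu' w hw' h'
      rw [orient_swap] at this
      linarith
  · intro j _ hj
    rw [hnum] at hj
    rw [F.innerLayers_image hx hinj hj, F.layer_image hx hinj hj,
      F.hullVertices_image (hx.mono (hsub hj)) (hinj.mono (hsub hj))]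
  · intro j h1 hj
    rw [hnum] at hj
    rw [F.innerLayers_image hx hinj (by omega), F.layer_image hx hinj hj]
    rintro _ ⟨a, ha, rfl⟩ _ ⟨b, hb, rfl⟩ _ ⟨c, hc, rfl⟩ hab hac hbc
    have key : ∀ {a b c : List ℕ}, a ∈ levelSet T j → b ∈ levelSet T j → c ∈ levelSet T j →
        PosTriple a b c → ∃! p, p ∈ x '' truncation T (j - 1) ∧
          p ∈ interior (convexHull ℝ {x a, x b, x c}) := by
      intro a b c ha hb hc h
      obtain ⟨m, hm, hmj, ht, hu⟩ := F.existsUnique_inTriangle (hx.mono (hsub hj)) h ha hb hc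
      simp only [mem_interior_triangle ht.orient_pos]
      refine ⟨x m, ⟨⟨m, ⟨hm, by omega⟩, rfl⟩, ht⟩, ?_⟩
      rintro _ ⟨⟨z, hz, rfl⟩, hzt⟩
      rw [hu z hz.1 (by have := hz.2; omega) hzt]
    rcases posTriple_trichotomy (F.binary a ha.1) (F.binary b hb.1) (F.binary c hc.1)
      (by rintro rfl; exact hab rfl) (by rintro rfl; exact hac rfl)
      (by rintro rfl; exact hbc rfl) with h' | h'
    · exact key ha hb hc h'
    · rw [Set.insert_comm]
      exact key hb ha hc h'

end Forest

/-! ## Extending a labeling by one layer -/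

theorem PosTriple.ne {u v w : List ℕ} (h : PosTriple u v w) : u ≠ v ∧ v ≠ w ∧ w ≠ u := by
  induction h with
  | internal m u v w hu hv h0 h1 =>
    refine ⟨?_, ?_, ?_⟩
    · rintro rfl
      simpa using eq_of_append_singleton_prefix hu hv
    · rintro rfl; exact h1 hv
    · rintro rfl; exact h0 hu
  | left m a z ha hz =>
    refine ⟨?_, ?_, ?_⟩
    · rintro rfl; exact not_append_singleton_prefix_self a 0 ha
    · rintro rfl; exact hz List.prefix_rfl
    · rintro rfl; exact hz (prefix_of_append_singleton_prefix ha)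
  | right m b z hb hz =>
    refine ⟨?_, ?_, ?_⟩
    · rintro rfl; exact not_append_singleton_prefix_self m 1 hb
    · rintro rfl; exact hz (prefix_of_append_singleton_prefix hb)
    · rintro rfl; exact hz List.prefix_rfl
  | rotate u v w _ ih => exact ⟨ih.2.1, ih.2.2, ih.1⟩

/-- The node itself if its level is at most `j`, and the parent otherwise. -/
def ancestor (j : ℕ) (u : List ℕ) : List ℕ := if u.length ≤ j then u else u.dropLast

theorem ancestor_of_le {j : ℕ} {u : List ℕ} (h : u.length ≤ j) : ancestor j u = u := if_pos h

theorem ancestor_append {j : ℕ} {m : List ℕ} (h : m.length = j) (i : ℕ) :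
    ancestor j (m ++ [i]) = m := by simp [ancestor, h]

theorem ancestor_prefix (j : ℕ) (u : List ℕ) : ancestor j u <+: u := by
  unfold ancestor
  split
  · exact List.prefix_rfl
  · exact List.dropLast_prefix u

theorem prefix_ancestor {j : ℕ} {m u : List ℕ} (hm : m.length ≤ j) (h : m <+: u)
    (hu : u.length ≤ j + 1) : m <+: ancestor j u := by
  unfold ancestor
  split
  · exact h
  · refine List.prefix_of_prefix_length_le h (List.dropLast_prefix u) ?_
    simp; omega

/-- The extension of a labeling to the next level. -/
noncomputable def extendLabeling (j : ℕ) (x : List ℕ → Plane) (P P' : Plane → Plane)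
    (u : List ℕ) : Plane :=
  if u.length ≤ j then x u
  else if u.getLast? = some 0 then P (x u.dropLast) else P' (x u.dropLast)

/-- The two ends of the twin edge of `x m` label the two children of `m`. A positive triple with a
branching node above level `j` stays positive when new nodes are replaced by their parents, so its
orientation is inherited. A triple that branches at a node of level `j` is positive because `PP'` is
a hull edge or by `IsTwinEdge.external`. -/
theorem LayerPair.exists_extension {R Y : Set Plane} (H : LayerPair R Y) (h4 : 4 ≤ R.ncard)
    (hcard : R.ncard = 2 * (hullVertices Y).ncard) {T : Set (List ℕ)} (F : Forest T) {j : ℕ}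
    (hpar : ∀ u ∈ T, u.length = j + 1 → u.dropLast ∈ T) {x : List ℕ → Plane}
    (hbij : Set.BijOn x (truncation T j) Y) (hlevel : x '' levelSet T j = hullVertices Y)
    (hsep : Separated (truncation T j) x) :
    ∃ x', Set.BijOn x' (truncation T (j + 1)) (R ∪ Y) ∧ x' '' levelSet T (j + 1) = R ∧
      Separated (truncation T (j + 1)) x' := by
  obtain ⟨P, P', hT, hcover, hPinj⟩ := H.exists_twins h4 hcard
  set x' := extendLabeling j x P P' with hx'
  have hin : ∀ u, u.length ≤ j → x' u = x u := fun u hu => if_pos hu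
  have hleft : ∀ m, m.length = j → x' (m ++ [0]) = P (x m) := fun m hm => by
    simp [hx', extendLabeling, hm]
  have hright : ∀ m, m.length = j → x' (m ++ [1]) = P' (x m) := fun m hm => by
    simp [hx', extendLabeling, hm]
  have hleaf : ∀ u ∈ T, u.length = j + 1 → ∃ m ∈ levelSet T j, u = m ++ [0] ∨ u = m ++ [1] := by
    intro u hu hlen
    have hne : u ≠ [] := by rintro rfl; simp at hlen
    have hlast := F.binary u hu _ (List.getLast_mem hne)
    refine ⟨u.dropLast, ⟨hpar u hu hlen, by simp [hlen]⟩, ?_⟩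
    rw [← List.dropLast_append_getLast hne]
    interval_cases u.getLast hne <;> simp
  have hcases : ∀ u ∈ truncation T (j + 1), u ∈ truncation T j ∨
      ∃ m ∈ levelSet T j, u = m ++ [0] ∨ u = m ++ [1] := by
    rintro u ⟨hu, hlen⟩
    rcases hlen.eq_or_lt with h | h
    · exact Or.inr (hleaf u hu h)
    · exact Or.inl ⟨hu, by omega⟩
  have hxT : ∀ m ∈ levelSet T j, IsTwinEdge R Y (P (x m)) (P' (x m)) (x m) := fun m hm =>
    hT _ (hlevel ▸ ⟨m, hm, rfl⟩)
  have hmapR : ∀ u ∈ levelSet T (j + 1), x' u ∈ R := by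
    rintro u ⟨hu, hlen⟩
    obtain ⟨m, hm, rfl | rfl⟩ := hleaf u hu hlen
    · rw [hleft m hm.2]; exact (hxT m hm).left_mem
    · rw [hright m hm.2]; exact (hxT m hm).right_mem
  have hmapY : ∀ u ∈ truncation T j, x' u ∈ Y := fun u hu => by
    rw [hin u hu.2]; exact hbij.mapsTo hu
  have hsplit : ∀ u ∈ truncation T (j + 1), u ∈ truncation T j ∨ u ∈ levelSet T (j + 1) := by
    rintro u ⟨hu, hlen⟩
    rcases hlen.eq_or_lt with h | h
    · exact Or.inr ⟨hu, h⟩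
    · exact Or.inl ⟨hu, by omega⟩
  have hinj : Set.InjOn x' (truncation T (j + 1)) := by
    have hxinj : ∀ m ∈ levelSet T j, ∀ n ∈ levelSet T j, x m = x n → m = n := fun m hm n hn h =>
      hbij.injOn (Forest.levelSet_subset_truncation _ hm)
        (Forest.levelSet_subset_truncation _ hn) h
    have hmem : ∀ m ∈ levelSet T j, x m ∈ hullVertices Y := fun m hm => hlevel ▸ ⟨m, hm, rfl⟩
    intro u hu v hv huv
    rcases hsplit u hu with hu' | hu' <;> rcases hsplit v hv with hv' | hv'
    · rw [hin u hu'.2, hin v hv'.2] at huv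
      exact hbij.injOn hu' hv' huv
    · exact absurd (hmapY u hu') (huv ▸ Set.disjoint_left.1 H.disjoint (hmapR v hv'))
    · exact absurd (hmapY v hv') (huv ▸ Set.disjoint_left.1 H.disjoint (hmapR u hu'))
    · obtain ⟨m, hm, hum⟩ := hleaf u hu'.1 hu'.2
      obtain ⟨n, hn, hvn⟩ := hleaf v hv'.1 hv'.2
      have hmn : m = n := by
        refine hxinj m hm n hn ?_
        rcases hum with rfl | rfl <;> rcases hvn with rfl | rfl <;>
          simp only [hleft m hm.2, hright m hm.2, hleft n hn.2, hright n hn.2] at huv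
        · exact hPinj _ (hmem m hm) _ (hmem n hn) (Or.inl huv)
        · exact hPinj _ (hmem m hm) _ (hmem n hn) (Or.inr (Or.inr huv))
        · exact (hPinj _ (hmem n hn) _ (hmem m hm) (Or.inr (Or.inr huv.symm))).symm
        · exact hPinj _ (hmem m hm) _ (hmem n hn) (Or.inr (Or.inl huv))
      subst hmn
      rcases hum with rfl | rfl <;> rcases hvn with rfl | rfl
      · rfl
      · rw [hleft m hm.2, hright m hm.2] at huv
        exact absurd huv (hxT m hm).ne
      · rw [hleft m hm.2, hright m hm.2] at huv
        exact absurd huv.symm (hxT m hm).ne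
      · rfl
  have happ : ∀ m ∈ levelSet T j, ∀ i < 2, m ++ [i] ∈ levelSet T (j + 1) := fun m hm i hi =>
    ⟨F.append m hm.1 i hi, by simp [hm.2]⟩
  have himg : x' '' levelSet T (j + 1) = R := by
    refine Set.Subset.antisymm ?_ ?_
    · rintro _ ⟨u, hu, rfl⟩
      exact hmapR u hu
    · intro p hp
      obtain ⟨y, hy, h⟩ := hcover p hp
      rw [← hlevel] at hy
      obtain ⟨m, hm, rfl⟩ := hy
      rcases h with rfl | rfl
      · exact ⟨m ++ [0], happ m hm 0 (by norm_num), hleft m hm.2⟩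
      · exact ⟨m ++ [1], happ m hm 1 (by norm_num), hright m hm.2⟩
  have hmap : Set.MapsTo x' (truncation T (j + 1)) (R ∪ Y) := fun u hu =>
    (hsplit u hu).elim (fun h => Or.inr (hmapY u h)) (fun h => Or.inl (hmapR u h))
  refine ⟨x', ⟨hmap, hinj, ?_⟩, himg, ?_⟩
  · rintro p (hp | hp)
    · rw [← himg] at hp
      obtain ⟨u, hu, rfl⟩ := hp
      exact ⟨u, ⟨hu.1, hu.2.le⟩, rfl⟩
    · obtain ⟨u, hu, rfl⟩ := hbij.surjOn hp
      exact ⟨u, truncation_mono T (by omega) hu, hin u hu.2⟩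
  have hanc : ∀ u ∈ truncation T (j + 1), ancestor j u ∈ truncation T j := by
    intro u hu
    rcases hcases u hu with h | ⟨m, hm, rfl | rfl⟩
    · rwa [ancestor_of_le h.2]
    · rw [ancestor_append hm.2]; exact Forest.levelSet_subset_truncation _ hm
    · rw [ancestor_append hm.2]; exact Forest.levelSet_subset_truncation _ hm
  have hup : ∀ u ∈ truncation T j, u ∈ truncation T (j + 1) := fun u hu =>
    truncation_mono T (by omega) hu
  have hidem : ∀ u ∈ truncation T (j + 1), ancestor j (ancestor j u) = ancestor j u :=
    fun u hu => ancestor_of_le (hanc u hu).2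
  -- labels of nodes outside the cluster of `m`
  have hnot : ∀ m ∈ levelSet T j, ∀ z ∈ truncation T (j + 1), ancestor j z ≠ m →
      x' z ≠ P (x m) ∧ x' z ≠ P' (x m) ∧ x' z ≠ x m := by
    intro m hm z hz hne
    have hmt := Forest.levelSet_subset_truncation _ hm
    have hlt : ∀ i < 2, m ++ [i] ∈ truncation T (j + 1) := fun i hi =>
      Forest.levelSet_subset_truncation _ (happ m hm i hi)
    rw [← hleft m hm.2, ← hright m hm.2, ← hin m hm.2.le]
    refine ⟨fun h => hne ?_, fun h => hne ?_, fun h => hne ?_⟩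
    · rw [hinj hz (hlt 0 (by norm_num)) h, ancestor_append hm.2]
    · rw [hinj hz (hlt 1 (by norm_num)) h, ancestor_append hm.2]
    · rw [hinj hz (hup m hmt) h, ancestor_of_le hm.2.le]
  -- Passing from a parent to its child does not cross the line through two labels outside the
  -- parent's cluster, by `IsTwinEdge.sameSide`.
  have hmove : ∀ u ∈ truncation T (j + 1), ∀ z ∈ truncation T (j + 1), ∀ w ∈ truncation T (j + 1),
      z ≠ w → ancestor j z ≠ ancestor j u → ancestor j w ≠ ancestor j u →
      0 < orient (x' (ancestor j u)) (x' z) (x' w) → 0 < orient (x' u) (x' z) (x' w) := by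
    intro u hu z hz w hw hzw hzu hwu h
    rcases hcases u hu with hu' | ⟨m, hm, hum⟩
    · rwa [ancestor_of_le hu'.2] at h
    have hum' : ancestor j u = m := by rcases hum with rfl | rfl <;> exact ancestor_append hm.2 _
    rw [hum'] at hzu hwu h
    rw [hin m hm.2.le] at h
    obtain ⟨z1, z2, z3⟩ := hnot m hm z hz hzu
    obtain ⟨w1, w2, w3⟩ := hnot m hm w hw hwu
    have hs := (hxT m hm).sameSide H h4 (hmap hz) (hmap hw) z1 z2 z3 w1 w2 w3
      fun h => hzw (hinj hz hw h)
    rw [orient_rotate] at h ⊢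
    rcases hs with hs | hs
    · rcases hum with rfl | rfl
      · rw [hleft m hm.2]; exact hs.1
      · rw [hright m hm.2]; exact hs.2.1
    · have := hs.2.2
      rw [orient_swap] at this
      linarith
  have hmoves : ∀ u ∈ truncation T (j + 1), ∀ v ∈ truncation T (j + 1), ∀ w ∈ truncation T (j + 1),
      PosTriple (ancestor j u) (ancestor j v) (ancestor j w) →
      0 < orient (x' u) (x' v) (x' w) := by
    intro u hu v hv w hw h
    obtain ⟨huv, hvw, hwu⟩ := h.ne
    have hau := hup _ (hanc u hu)
    have hav := hup _ (hanc v hv)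
    have haw := hup _ (hanc w hw)
    have h0 := hsep _ (hanc u hu) _ (hanc v hv) _ (hanc w hw) h
    rw [← hin _ (hanc u hu).2, ← hin _ (hanc v hv).2, ← hin _ (hanc w hw).2] at h0
    -- The three nodes are replaced one at a time, each rotated into the first position.
    have h1 := hmove u hu _ hav _ haw hvw (by rw [hidem v hv]; exact huv.symm)
      (by rw [hidem w hw]; exact hwu) h0
    rw [orient_rotate] at h1
    have h2 := hmove v hv _ haw u hu (by rintro he; rw [← he, hidem w hw] at hwu; exact hwu rfl)
      (by rw [hidem w hw]; exact hvw.symm) huv h1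
    rw [orient_rotate] at h2
    have h3 := hmove w hw u hu v hv (by rintro rfl; exact huv rfl) hwu.symm hvw h2
    rwa [orient_rotate] at h3
  have hchild : ∀ {m u : List ℕ} {i : ℕ}, m.length = j → u ∈ truncation T (j + 1) →
      m ++ [i] <+: u → u = m ++ [i] ∧ m ∈ levelSet T j := by
    intro m u i hm hu h
    have he := h.eq_of_length_le (by simpa [hm] using hu.2)
    subst he
    refine ⟨rfl, ?_, hm⟩
    have := hpar _ hu.1 (by simp [hm])
    simpa using this
  have hlen : ∀ {m u : List ℕ} {i : ℕ}, u ∈ truncation T (j + 1) → m ++ [i] <+: u →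
      m.length ≤ j := by
    intro m u i hu h
    have := h.length_le.trans hu.2
    simpa using this
  intro u hu v hv w hw h
  induction h with
  | internal m u v w h0 h1 hw0 hw1 =>
    rcases (hlen hu h0).eq_or_lt with hm | hm
    · obtain ⟨rfl, hml⟩ := hchild hm hu h0
      obtain ⟨rfl, -⟩ := hchild hm hv h1
      rw [hleft m hm, hright m hm]
      refine (hxT m hml).pos _ (hmap hw) ?_ ?_
      · rw [← hleft m hm]
        exact fun h => hw0 ((hinj hw hu h).symm ▸ List.prefix_rfl)
      · rw [← hright m hm]
        exact fun h => hw1 ((hinj hw hv h).symm ▸ List.prefix_rfl)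
    · exact hmoves u hu v hv w hw (.internal m _ _ _
        (prefix_ancestor (by simpa using hm) h0 hu.2) (prefix_ancestor (by simpa using hm) h1 hv.2)
        (fun h => hw0 (h.trans (ancestor_prefix j w))) (fun h => hw1 (h.trans (ancestor_prefix j w))))
  | left m a z ha hz =>
    rcases (hlen hu ha).eq_or_lt with hm | hm
    · obtain ⟨rfl, hml⟩ := hchild hm hu ha
      have hza : ancestor j z ≠ m := fun h => hz (h ▸ ancestor_prefix j z)
      obtain ⟨z1, z2, z3⟩ := hnot m hml z hw hza
      rw [hleft m hm, hin m hm.le]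
      exact ((hxT m hml).external H h4 (hmap hw) z1 z2 z3).1
    · refine hmoves a hu m hv z hw ?_
      rw [ancestor_of_le hm.le]
      exact .left m _ _ (prefix_ancestor (by simpa using hm) ha hu.2)
        (fun h => hz (h.trans (ancestor_prefix j z)))
  | right m b z hb hz =>
    rcases (hlen hv hb).eq_or_lt with hm | hm
    · obtain ⟨rfl, hml⟩ := hchild hm hv hb
      have hza : ancestor j z ≠ m := fun h => hz (h ▸ ancestor_prefix j z)
      obtain ⟨z1, z2, z3⟩ := hnot m hml z hw hza
      rw [hright m hm, hin m hm.le]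
      exact ((hxT m hml).external H h4 (hmap hw) z1 z2 z3).2
    · refine hmoves m hu b hv z hw ?_
      rw [ancestor_of_le hm.le]
      exact .right m _ _ (prefix_ancestor (by simpa using hm) hb hv.2)
        (fun h => hz (h.trans (ancestor_prefix j z)))
  | rotate u v w _ ih =>
    rw [← orient_rotate]
    exact ih hw hu hv

/-! ## The two forests -/

/-- The nodes of the complete binary tree other than the root. -/
def forest1 : Set (List ℕ) := {w | w ≠ [] ∧ ∀ i ∈ w, i < 2}

/-- The nodes below `[0]` or `[1, 0]`. -/
def forest2 : Set (List ℕ) := {w | (∀ i ∈ w, i < 2) ∧ ([0] <+: w ∨ [1, 0] <+: w)}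

theorem binary_append {u : List ℕ} {i : ℕ} (hu : ∀ i ∈ u, i < 2) (hi : i < 2) :
    ∀ k ∈ u ++ [i], k < 2 := by
  intro k hk
  rcases List.mem_append.1 hk with h | h
  · exact hu k h
  · simp at h; omega

theorem binary_of_prefix {u v : List ℕ} (h : u <+: v) (hv : ∀ i ∈ v, i < 2) : ∀ i ∈ u, i < 2 :=
  fun i hi => hv i (h.subset hi)

theorem posTriple_siblings {m z : List ℕ} {n : ℕ} (hn : m.length + 1 = n) (hz : z.length ≤ n)
    (h0 : z ≠ m ++ [0]) (h1 : z ≠ m ++ [1]) : PosTriple (m ++ [0]) (m ++ [1]) z := by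
  have h : ∀ i, m ++ [i] <+: z → z = m ++ [i] := fun i h =>
    (h.eq_of_length_le (by simp; omega)).symm
  exact .internal m _ _ z List.prefix_rfl List.prefix_rfl (fun h' => h0 (h 0 h'))
    (fun h' => h1 (h 1 h'))

/-- A node whose parent has two children is on the boundary. -/
theorem boundary_of_siblings {T : Set (List ℕ)} {m : List ℕ} (h0 : m ++ [0] ∈ T)
    (h1 : m ++ [1] ∈ T) {i : ℕ} (hi : i < 2) :
    ∃ v' ∈ T, v'.length = (m ++ [i]).length ∧ v' ≠ m ++ [i] ∧
      ((∀ z ∈ T, z.length ≤ (m ++ [i]).length → z ≠ m ++ [i] → z ≠ v' →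
        PosTriple (m ++ [i]) v' z) ∨
      (∀ z ∈ T, z.length ≤ (m ++ [i]).length → z ≠ m ++ [i] → z ≠ v' →
        PosTriple v' (m ++ [i]) z)) := by
  interval_cases i
  · exact ⟨m ++ [1], h1, by simp, by simp, Or.inl fun z _ hz h h' =>
      posTriple_siblings (by simp) hz h h'⟩
  · exact ⟨m ++ [0], h0, by simp, by simp, Or.inr fun z _ hz h h' =>
      posTriple_siblings (by simp) hz h' h⟩

theorem isForest_forest1 : Forest forest1 where
  binary u hu := hu.2
  append u hu i hi := ⟨by simp, binary_append hu.2 hi⟩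
  nil_notMem h := h.1 rfl
  zero_mem := ⟨by simp, by simp⟩
  meet m u v hu _ hmu _ hm := ⟨hm, binary_of_prefix (prefix_of_append_singleton_prefix hmu) hu.2⟩
  outside v hv j hj := by
    obtain ⟨i, t, rfl⟩ := List.exists_cons_of_ne_nil hv.1
    have hi := hv.2 i (by simp)
    refine ⟨(1 - i) :: List.replicate (j - 1) 0, ⟨by simp, ?_⟩, by simp at hj ⊢; omega, ?_⟩
    · intro k hk
      rcases List.mem_cons.1 hk with rfl | h
      · omega
      · rw [List.eq_of_mem_replicate h]; norm_num
    · simp only [List.cons_prefix_cons, not_and]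
      omega
  boundary v hv := by
    right
    have h := List.dropLast_append_getLast hv.1
    have hm : ∀ i ∈ v.dropLast, i < 2 := binary_of_prefix (List.dropLast_prefix v) hv.2
    rw [← h]
    exact boundary_of_siblings (T := forest1) ⟨by simp, binary_append hm (by norm_num)⟩
      ⟨by simp, binary_append hm (by norm_num)⟩ (hv.2 _ (List.getLast_mem hv.1))

theorem dropLast_mem_forest1 {u : List ℕ} (hu : u ∈ forest1) (h : 1 < u.length) :
    u.dropLast ∈ forest1 :=
  ⟨fun h' => by have := congrArg List.length h'; simp at this; omega,
    binary_of_prefix (List.dropLast_prefix u) hu.2⟩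

theorem dropLast_mem_forest2 {u : List ℕ} (hu : u ∈ forest2) (h : 2 < u.length) :
    u.dropLast ∈ forest2 := by
  refine ⟨binary_of_prefix (List.dropLast_prefix u) hu.1, hu.2.imp (fun h' => ?_) (fun h' => ?_)⟩
  · exact List.prefix_of_prefix_length_le h' (List.dropLast_prefix u) (by simp; omega)
  · exact List.prefix_of_prefix_length_le h' (List.dropLast_prefix u) (by simp; omega)

theorem forest2_cases {u : List ℕ} (hu : u ∈ forest2) (h : u.length ≤ 2) :
    u = [0] ∨ u = [0, 0] ∨ u = [0, 1] ∨ u = [1, 0] := by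
  obtain ⟨h2, ⟨t, rfl⟩ | ⟨t, rfl⟩⟩ := hu
  · rcases t with _ | ⟨i, _ | ⟨k, t⟩⟩
    · simp
    · have := h2 i (by simp)
      interval_cases i <;> simp
    · simp at h
  · rcases t with _ | ⟨i, t⟩
    · simp
    · simp at h

theorem append_mem_forest2 {u : List ℕ} (hu : u ∈ forest2) {i : ℕ} (hi : i < 2) :
    u ++ [i] ∈ forest2 :=
  ⟨binary_append hu.1 hi, hu.2.imp (fun h => h.trans (List.prefix_append _ _))
    (fun h => h.trans (List.prefix_append _ _))⟩

theorem isForest_forest2 : Forest forest2 where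
  binary u hu := hu.1
  append u hu i hi := append_mem_forest2 hu hi
  nil_notMem h := by simpa using h.2
  zero_mem := ⟨by simp, by simp⟩
  meet m u v hu hv hmu hmv hm := by
    refine ⟨binary_of_prefix (prefix_of_append_singleton_prefix hmu) hu.1, ?_⟩
    have key : ∀ {c : List ℕ}, c <+: u → c.length ≤ m.length → c <+: m := fun h hlen =>
      List.prefix_of_prefix_length_le h (prefix_of_append_singleton_prefix hmu) hlen
    have hpos := List.length_pos_iff.2 hm
    rcases hu.2 with h | h
    · exact Or.inl (key h (by simp; omega))
    · rcases (show 1 ≤ m.length from hpos).eq_or_lt with h1 | h1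
      · have h1' : [1] <+: m := List.prefix_of_prefix_length_le
          ((show [1] <+: [1, 0] from ⟨[0], rfl⟩).trans h)
          (prefix_of_append_singleton_prefix hmu) (by simp [← h1])
        obtain rfl : [1] = m := h1'.eq_of_length (by simp [← h1])
        -- Here `m = [1]` and `v` begins with `[1, 1]`, which no word of the forest does.
        rcases hv.2 with h' | h'
        · simpa using List.prefix_of_prefix_length_le h' hmv (by simp)
        · simpa using eq_of_append_singleton_prefix (m := [1]) h' hmv
      · exact Or.inr (key h (by simp; omega))
  outside v hv j hj := by
    have h0 : ∀ n, ∀ k ∈ List.replicate n 0, k < 2 := fun n k hk => by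
      rw [List.eq_of_mem_replicate hk]; norm_num
    rcases hv.2 with h | h
    · have := h.length_le
      simp at this
      refine ⟨[1, 0] ++ List.replicate (j - 2) 0, ⟨?_, Or.inr (List.prefix_append _ _)⟩,
        by simp; omega, fun h' => ?_⟩
      · intro k hk
        rcases List.mem_append.1 hk with hk | hk
        · simp at hk; omega
        · exact h0 _ k hk
      · simpa using h.trans h'
    · have := h.length_le
      simp at this
      refine ⟨[0] ++ List.replicate (j - 1) 0, ⟨?_, Or.inl (List.prefix_append _ _)⟩,
        by simp; omega, fun h' => ?_⟩
      · intro k hk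
        rcases List.mem_append.1 hk with hk | hk
        · simp at hk; omega
        · exact h0 _ k hk
      · simpa using h.trans h'
  boundary v hv := by
    by_cases hlen : v.length ≤ 2
    · rcases forest2_cases hv hlen with rfl | rfl | rfl | rfl
      · left
        intro z hz hz1
        rcases forest2_cases hz (by simp at hz1; omega) with rfl | rfl | rfl | rfl <;> simp at hz1 ⊢
      · exact Or.inr (boundary_of_siblings (T := forest2) (m := [0]) ⟨by simp, by simp⟩ ⟨by simp, by simp⟩
          (i := 0) (by norm_num))
      · exact Or.inr (boundary_of_siblings (T := forest2) (m := [0]) ⟨by simp, by simp⟩ ⟨by simp, by simp⟩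
          (i := 1) (by norm_num))
      -- The sibling `[1, 1]` is absent; the supporting line at `[1, 0]` goes through the first
      -- vertex `[0, 0]` of the triangle.
      · refine Or.inr ⟨[0, 0], ⟨by simp, by simp⟩, rfl, by simp, Or.inl ?_⟩
        intro z hz hzl h1 h2
        rcases forest2_cases hz hzl with rfl | rfl | rfl | rfl
        · exact PosTriple.rotate' (.left [0] [0, 0] [1, 0] (by simp) (by simp))
        · exact absurd rfl h2
        · exact PosTriple.rotate' (.internal [0] [0, 0] [0, 1] [1, 0] (by simp) (by simp)
            (by simp) (by simp))
        · exact absurd rfl h1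
    · right
      have hne : v ≠ [] := by rintro rfl; simp at hlen
      have hm := dropLast_mem_forest2 hv (not_le.1 hlen)
      rw [← List.dropLast_append_getLast hne]
      exact boundary_of_siblings (append_mem_forest2 hm (by norm_num))
        (append_mem_forest2 hm (by norm_num)) (hv.1 _ (List.getLast_mem hne))

/-! ## The layers of a finite set -/

theorem peel_subset (X : Set Plane) : peel X ⊆ X := Set.sdiff_subset

theorem iterate_peel_subset (X : Set Plane) (i : ℕ) : peel^[i] X ⊆ X := by
  induction i with
  | zero => exact subset_rfl
  | succ i ih =>
    rw [Function.iterate_succ_apply']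
    exact (peel_subset _).trans ih

theorem exists_iterate_peel_eq_empty {X : Set Plane} (hX : X.Finite) : ∃ i, peel^[i] X = ∅ := by
  induction hn : X.ncard using Nat.strong_induction_on generalizing X with
  | _ n ih =>
    rcases X.eq_empty_or_nonempty with rfl | hne
    · exact ⟨0, rfl⟩
    · obtain ⟨p, hp⟩ := hullVertices_nonempty hX hne
      have hlt : (peel X).ncard < n := by
        rw [← hn]
        refine Set.ncard_lt_ncard ⟨peel_subset X, fun h => ?_⟩ hX
        exact (h (hullVertices_subset X hp)).2 hp
      obtain ⟨i, hi⟩ := ih _ hlt (hX.subset (peel_subset X)) rfl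
      exact ⟨i + 1, hi⟩

theorem iterate_peel_numLayers {X : Set Plane} (hX : X.Finite) : peel^[numLayers X] X = ∅ :=
  Nat.sInf_mem (exists_iterate_peel_eq_empty hX)

theorem innerLayers_zero (X : Set Plane) : innerLayers X 0 = ∅ := by
  ext p
  simp only [innerLayers, Set.mem_ofPred_eq, Set.mem_empty_iff_false, iff_false]
  rintro ⟨i, h1, h2, -⟩
  omega

theorem innerLayers_succ (X : Set Plane) (j : ℕ) :
    innerLayers X (j + 1) = layer X (j + 1) ∪ innerLayers X j := by
  ext p
  constructor
  · rintro ⟨i, h1, h2, hp⟩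
    rcases h2.eq_or_lt with rfl | h2
    · exact Or.inl hp
    · exact Or.inr ⟨i, h1, by omega, hp⟩
  · rintro (hp | ⟨i, h1, h2, hp⟩)
    · exact ⟨j + 1, by omega, le_rfl, hp⟩
    · exact ⟨i, h1, by omega, hp⟩

theorem peel_iterate_sub {X : Set Plane} {j : ℕ} (hj : j < numLayers X) :
    peel (peel^[numLayers X - (j + 1)] X) = peel^[numLayers X - j] X := by
  rw [← Function.iterate_succ_apply' peel, show (numLayers X - (j + 1)).succ = numLayers X - j by
    omega]

/-- Peeling proceeds from the outside while layers are numbered from the inside, so the `j` inner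
layers are what remains after `numLayers X - j` peelings. -/
theorem innerLayers_eq {X : Set Plane} (hX : X.Finite) {j : ℕ} (hj : j ≤ numLayers X) :
    innerLayers X j = peel^[numLayers X - j] X := by
  induction j with
  | zero => rw [innerLayers_zero, Nat.sub_zero, iterate_peel_numLayers hX]
  | succ j ih =>
    rw [innerLayers_succ, ih (by omega), ← peel_iterate_sub hj, layer, peel,
      Set.union_sdiff_cancel (hullVertices_subset _)]

theorem layer_eq {X : Set Plane} (hX : X.Finite) {j : ℕ} (hj : j ≤ numLayers X) :
    layer X j = hullVertices (innerLayers X j) := by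
  rw [innerLayers_eq hX hj, layer]

theorem innerLayers_numLayers {X : Set Plane} (hX : X.Finite) :
    innerLayers X (numLayers X) = X := by
  rw [innerLayers_eq hX le_rfl, Nat.sub_self, Function.iterate_zero, id]

theorem layer_nonempty {X : Set Plane} (hX : X.Finite) {j : ℕ} (h1 : 1 ≤ j)
    (hj : j ≤ numLayers X) : (layer X j).Nonempty := by
  refine hullVertices_nonempty (hX.subset (iterate_peel_subset _ _)) ?_
  rw [Set.nonempty_iff_ne_empty]
  intro h
  have : numLayers X ≤ numLayers X - j := Nat.sInf_le h
  omega

theorem disjoint_layer_innerLayers {X : Set Plane} (hX : X.Finite) {j : ℕ}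
    (hj : j < numLayers X) : Disjoint (layer X (j + 1)) (innerLayers X j) := by
  rw [innerLayers_eq hX hj.le, ← peel_iterate_sub hj, layer, peel]
  exact Set.disjoint_sdiff_right

theorem IsNestedAlmostConvex.layerPair {X : Set Plane} (hX : IsNestedAlmostConvex X) {j : ℕ}
    (hj : j < numLayers X) : LayerPair (layer X (j + 1)) (innerLayers X j) where
  finite := by
    rw [← innerLayers_succ, innerLayers_eq hX.finite hj]
    exact hX.finite.subset (iterate_peel_subset _ _)
  generalPosition := by
    rw [← innerLayers_succ]
    exact hX.generalPosition (j + 1) (by omega) hj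
  disjoint := disjoint_layer_innerLayers hX.finite hj
  hull := by
    rw [← innerLayers_succ]
    exact hX.vertices (j + 1) (by omega) hj
  triangle a ha b hb c hc h := by
    have hne : a ≠ b ∧ a ≠ c ∧ b ≠ c := by
      refine ⟨?_, ?_, ?_⟩ <;> rintro rfl <;> simp at h
    have := hX.triangle (j + 1) (by omega) hj a ha b hb c hc hne.1 hne.2.1 hne.2.2
    simpa only [mem_interior_triangle h, Nat.add_sub_cancel] using this

/-- A point of `Y` lies in the hull of `R` but on no line through two points of `R`, so this hull is
neither a point nor a segment. -/
theorem LayerPair.three_le {R Y : Set Plane} (H : LayerPair R Y) (hY : Y.Nonempty) :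
    3 ≤ R.ncard := by
  have hfin : R.Finite := H.finite.subset Set.subset_union_left
  obtain ⟨y, hy⟩ := hY
  have hyR : ∀ r ∈ R, r ≠ y := fun r hr h => Set.disjoint_left.1 H.disjoint hr (h ▸ hy)
  have hmem : y ∈ convexHull ℝ R := by
    have := convexHull_hullVertices H.finite
    rw [H.hull] at this
    rw [this]
    exact subset_convexHull ℝ _ (Or.inr hy)
  by_contra! hlt
  have hcases : R.ncard = 0 ∨ R.ncard = 1 ∨ R.ncard = 2 := by omega
  rcases hcases with h | h | h
  · rw [Set.ncard_eq_zero hfin] at h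
    simp [h] at hmem
  · obtain ⟨a, rfl⟩ := Set.ncard_eq_one.1 h
    simp only [convexHull_singleton, Set.mem_singleton_iff] at hmem
    exact hyR a rfl hmem.symm
  · obtain ⟨a, b, hab, rfl⟩ := Set.ncard_eq_two.1 h
    refine H.orient_ne_zero (a := a) (b := b) (by simp) (by simp) hy hab (le_antisymm ?_ ?_)
    · have : 0 ≤ orient b a y := orient_nonneg_of_mem_convexHull
        (by rintro p (rfl | rfl) <;> simp) hmem
      rw [orient_swap] at this
      linarith
    · exact orient_nonneg_of_mem_convexHull (by rintro p (rfl | rfl) <;> simp) hmem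

/-! ## Every nested almost convex set has a separated labeling -/

/-- A separated labeling of the `j` inner layers. -/
structure LayerLabeling (X : Set Plane) (T : Set (List ℕ)) (j : ℕ) (x : List ℕ → Plane) : Prop where
  bijOn : Set.BijOn x (truncation T j) (innerLayers X j)
  image : x '' levelSet T j = layer X j
  separated : Separated (truncation T j) x

/-- The hypothesis `|X_j| + 2 = 2 |R_j|` is an invariant: with `|R_{j+1}| = |X_j| + 2` it gives the
doubling of the layers and reproduces itself. -/
theorem IsNestedAlmostConvex.ncard_succ {X : Set Plane} (hX : IsNestedAlmostConvex X) {j : ℕ}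
    (h1 : 1 ≤ j) (hj : j < numLayers X)
    (hcard : (innerLayers X j).ncard + 2 = 2 * (layer X j).ncard) :
    (layer X (j + 1)).ncard = 2 * (layer X j).ncard ∧
      (innerLayers X (j + 1)).ncard + 2 = 2 * (layer X (j + 1)).ncard := by
  have H := hX.layerPair hj
  have hne : (innerLayers X j).Nonempty := by
    obtain ⟨p, hp⟩ := layer_nonempty hX.finite h1 hj.le
    exact ⟨p, j, h1, le_rfl, hp⟩
  have h := H.ncard_eq (H.three_le hne)
  refine ⟨by omega, ?_⟩
  rw [innerLayers_succ, Set.ncard_union_eq H.disjoint (H.finite.subset Set.subset_union_left)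
    (H.finite.subset Set.subset_union_right)]
  omega

theorem LayerLabeling.succ {X : Set Plane} (hX : IsNestedAlmostConvex X) {T : Set (List ℕ)}
    (F : Forest T) {j : ℕ} (h1 : 1 ≤ j) (hj : j < numLayers X)
    (hcard : (innerLayers X j).ncard + 2 = 2 * (layer X j).ncard)
    (h2 : 2 ≤ (layer X j).ncard)
    (hpar : ∀ u ∈ T, u.length = j + 1 → u.dropLast ∈ T) {x : List ℕ → Plane}
    (hx : LayerLabeling X T j x) : ∃ x', LayerLabeling X T (j + 1) x' := by
  have h := (hX.ncard_succ h1 hj hcard).1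
  have hl := layer_eq hX.finite hj.le
  obtain ⟨x', h1, h2, h3⟩ := (hX.layerPair hj).exists_extension (by omega) (by rw [h, hl]) F hpar
    hx.bijOn (by rw [hx.image, hl]) hx.separated
  exact ⟨x', by rwa [innerLayers_succ], h2, h3⟩

/-- With at least three points, `ncard_eq` for the empty set of inner points would give exactly two.
-/
theorem IsNestedAlmostConvex.ncard_layer_one {X : Set Plane} (hX : IsNestedAlmostConvex X)
    (hk : 1 ≤ numLayers X) : (layer X 1).ncard = 1 ∨ (layer X 1).ncard = 2 := by
  have H := hX.layerPair (j := 0) hk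
  have hpos := (Set.ncard_pos (H.finite.subset Set.subset_union_left)).2
    (layer_nonempty hX.finite le_rfl hk)
  have hlt : (layer X 1).ncard < 3 := by
    by_contra! h
    have := H.ncard_eq h
    rw [innerLayers_zero, Set.ncard_empty] at this
    simp at this; omega
  simp only [zero_add] at hpos
  omega

theorem innerLayers_one (X : Set Plane) : innerLayers X 1 = layer X 1 := by
  rw [innerLayers_succ, innerLayers_zero, Set.union_empty]

theorem forest1_cases {u : List ℕ} (hu : u ∈ forest1) (h : u.length ≤ 1) : u = [0] ∨ u = [1] := by
  obtain ⟨h1, h2⟩ := hu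
  rcases u with _ | ⟨i, _ | ⟨k, t⟩⟩
  · exact absurd rfl h1
  · have := h2 i (by simp)
    interval_cases i <;> simp
  · simp at h

/-- The hypothesis is an implication so that the empty set is included, as the type 1 set with no
layers. -/
theorem IsNestedAlmostConvex.typeOne {X : Set Plane} (hX : IsNestedAlmostConvex X)
    (h1 : 1 ≤ numLayers X → (layer X 1).ncard = 2) :
    IsTypeOne X ∧ X.ncard = 2 ^ (numLayers X + 1) - 2 ∧
      ∃ x, Set.BijOn x (truncation forest1 (numLayers X)) X ∧
        Separated (truncation forest1 (numLayers X)) x := by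
  have main : ∀ j, j + 1 ≤ numLayers X → (layer X (j + 1)).ncard = 2 ^ (j + 1) ∧
      (innerLayers X (j + 1)).ncard + 2 = 2 * (layer X (j + 1)).ncard ∧
      ∃ x, LayerLabeling X forest1 (j + 1) x := by
    intro j hj
    induction j with
    | zero =>
      have h2 := h1 hj
      refine ⟨by simpa using h2, by simp only [zero_add, innerLayers_one]; omega, ?_⟩
      obtain ⟨a, b, hab, hl⟩ := Set.ncard_eq_two.1 h2
      have htr : truncation forest1 1 = {[0], [1]} := by
        ext u
        constructor
        · intro hu; exact forest1_cases hu.1 hu.2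
        · rintro (rfl | rfl) <;> exact ⟨⟨by simp, by simp⟩, by simp⟩
      have hlv : levelSet forest1 1 = {[0], [1]} := by
        ext u
        constructor
        · intro hu; exact forest1_cases hu.1 hu.2.le
        · rintro (rfl | rfl) <;> exact ⟨⟨by simp, by simp⟩, by simp⟩
      refine ⟨fun u => if u = [0] then a else b, ?_, ?_, ?_⟩
      · rw [zero_add, innerLayers_one, hl, htr]
        refine ⟨?_, ?_, ?_⟩
        · rintro u (rfl | rfl) <;> simp
        · rintro u (rfl | rfl) v (rfl | rfl) <;> simp [hab, hab.symm]
        · rintro p (rfl | rfl)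
          · exact ⟨[0], by simp, by simp⟩
          · exact ⟨[1], by simp, by simp⟩
      · rw [zero_add, hl, hlv, Set.image_pair]
        simp
      · intro u hu v hv w hw h
        rw [zero_add, htr] at hu hv hw
        -- A positive triple needs three distinct nodes, but only two are available.
        have := h.ne
        rcases hu with rfl | rfl <;> rcases hv with rfl | rfl <;> rcases hw with rfl | rfl <;>
          simp at this
    | succ j ih =>
      obtain ⟨i1, i2, x, hx⟩ := ih (by omega)
      obtain ⟨k1, k2⟩ := hX.ncard_succ (by omega) hj i2
      refine ⟨by rw [k1, i1]; ring, k2, ?_⟩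
      refine hx.succ hX isForest_forest1 (by omega) hj i2 ?_ ?_
      · rw [i1, pow_succ]
        have := Nat.one_le_two_pow (n := j)
        omega
      · intro u hu hlen
        exact dropLast_mem_forest1 hu (by omega)
  refine ⟨?_, ?_⟩
  · intro j hj1 hj
    obtain ⟨j, rfl⟩ : ∃ i, j = i + 1 := ⟨j - 1, by omega⟩
    exact (main j hj).1
  rcases Nat.eq_zero_or_pos (numLayers X) with h0 | hpos
  · have hX0 := innerLayers_numLayers hX.finite
    rw [h0, innerLayers_zero] at hX0
    rw [h0, ← hX0, isForest_forest1.truncation_zero]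
    exact ⟨by simp, fun _ => 0, Set.bijOn_empty _, fun u hu => absurd hu (Set.notMem_empty u)⟩
  · obtain ⟨j, hj⟩ : ∃ i, numLayers X = i + 1 := ⟨numLayers X - 1, by omega⟩
    obtain ⟨i1, i2, x, hx⟩ := main j (by omega)
    have hX0 := innerLayers_numLayers hX.finite
    rw [hj] at hX0 ⊢
    rw [hX0] at i2
    refine ⟨?_, x, ?_, hx.separated⟩
    · rw [pow_succ, ← i1]; omega
    · have := hx.bijOn
      rwa [hX0] at this

/-- The start of the type 2 induction is a triangle around one point. `LayerLabeling.succ` cannot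
produce it, because the innermost layer has only one point. The center gets `[0]`, and the vertices
in counterclockwise order get `[0, 0]`, `[0, 1]`, `[1, 0]`. -/
theorem IsNestedAlmostConvex.exists_labeling_two {X : Set Plane} (hX : IsNestedAlmostConvex X)
    (hk : 2 ≤ numLayers X) (h1 : (layer X 1).ncard = 1) :
    (layer X 2).ncard = 3 ∧ ∃ x, LayerLabeling X forest2 2 x := by
  have H := hX.layerPair (j := 1) hk
  obtain ⟨y, hy⟩ := Set.ncard_eq_one.1 h1
  have hin : innerLayers X 1 = {y} := by rw [innerLayers_one, hy]
  have hin2 : innerLayers X 2 = layer X 2 ∪ {y} := by rw [innerLayers_succ, hin]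
  rw [hin] at H
  have h3 := H.three_le (Set.singleton_nonempty y)
  have hcard : (layer X 2).ncard = 3 := by simpa using H.ncard_eq h3
  refine ⟨hcard, ?_⟩
  obtain ⟨p, hp⟩ := layer_nonempty hX.finite (j := 2) (by norm_num) hk
  obtain ⟨q, e, -⟩ := H.exists_ccwEnum h3 hp
  simp only [Nat.reduceAdd, hcard, Nat.reduceSub] at e
  have hlayer : layer X 2 = {q 0, q 1, q 2} := by
    ext z
    constructor
    · intro hz
      obtain ⟨i, hi, rfl⟩ := e.surj z hz
      interval_cases i <;> simp
    · rintro (rfl | rfl | rfl)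
      · exact e.mem 0 (by norm_num)
      · exact e.mem 1 (by norm_num)
      · exact e.mem 2 (by norm_num)
  have htr : truncation forest2 2 = {[0], [0, 0], [0, 1], [1, 0]} := by
    ext u
    constructor
    · intro hu; exact forest2_cases hu.1 hu.2
    · rintro (rfl | rfl | rfl | rfl) <;> exact ⟨⟨by simp, by simp⟩, by simp⟩
  have hlv : levelSet forest2 2 = {[0, 0], [0, 1], [1, 0]} := by
    ext u
    constructor
    · intro hu
      rcases forest2_cases hu.1 hu.2.le with rfl | h
      · simpa using hu.2
      · exact h
    · rintro (rfl | rfl | rfl) <;> exact ⟨⟨by simp, by simp⟩, by simp⟩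
  have hyq : ∀ i ≤ 2, y ≠ q i := fun i hi h =>
    Set.disjoint_left.1 H.disjoint (e.mem i hi) (by rw [← h]; rfl)
  have n0 := hyq 0 (by norm_num)
  have n1 := hyq 1 (by norm_num)
  have n2 := hyq 2 (by norm_num)
  have n01 := e.inj 0 1 (by norm_num) (by norm_num)
  have n02 := e.inj 0 2 (by norm_num) (by norm_num)
  have n12 := e.inj 1 2 (by norm_num) (by norm_num)
  have o := e.pos 0 1 2 (by norm_num) (by norm_num) (by norm_num)
  have o0 := e.edge 0 (by norm_num) y rfl
  have o1 := e.edge 1 (by norm_num) y rfl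
  have o2 := e.last y rfl
  simp only [Nat.reduceAdd] at o0 o1
  let x : List ℕ → Plane := fun u =>
    if u = [0] then y else if u = [0, 0] then q 0 else if u = [0, 1] then q 1 else q 2
  have x0 : x [0] = y := by simp [x]
  have x00 : x [0, 0] = q 0 := by simp [x]
  have x01 : x [0, 1] = q 1 := by simp [x]
  have x10 : x [1, 0] = q 2 := by simp [x]
  refine ⟨x, ?_, ?_, ?_⟩
  · rw [hin2, hlayer, htr]
    refine ⟨?_, ?_, ?_⟩
    · rintro u (rfl | rfl | rfl | rfl) <;> simp [x0, x00, x01, x10]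
    · rintro u (rfl | rfl | rfl | rfl) v (rfl | rfl | rfl | rfl) h <;>
        simp only [x0, x00, x01, x10] at h <;> first | rfl | (exfalso; tauto)
    · rintro z ((rfl | rfl | rfl) | rfl)
      · exact ⟨[0, 0], by simp, x00⟩
      · exact ⟨[0, 1], by simp, x01⟩
      · exact ⟨[1, 0], by simp, x10⟩
      · exact ⟨[0], by simp, x0⟩
  · rw [hlv, hlayer]
    simp only [Set.image_insert_eq, Set.image_singleton, x00, x01, x10]
  · rw [htr]
    intro u hu v hv w hw h
    induction h with
    | internal m u v w hu' hv' h0 h1 =>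
      rcases m with _ | ⟨i, _ | ⟨k, m⟩⟩
      · rcases hw with rfl | rfl | rfl | rfl <;> simp at h0 h1
      · have hu1 : u = [i, 0] := by rcases hu with rfl | rfl | rfl | rfl <;> simp_all
        have hv1 : v = [i, 1] := by rcases hv with rfl | rfl | rfl | rfl <;> simp_all
        subst hu1 hv1
        obtain rfl : i = 0 := by simpa using hv
        rw [x00, x01]
        rcases hw with rfl | rfl | rfl | rfl <;> simp at h0 h1
        · rwa [x0]
        · rwa [x10]
      · rcases hu with rfl | rfl | rfl | rfl <;> simp at hu'
    | left m a z ha hz =>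
      rcases hu with rfl | rfl | rfl | rfl <;> rcases hv with rfl | rfl | rfl | rfl <;>
        rcases hw with rfl | rfl | rfl | rfl <;> simp at ha hz
      rw [x0, x00, x10, orient_rotate, orient_rotate]
      exact o2
    | right m b z hb hz =>
      rcases hu with rfl | rfl | rfl | rfl <;> rcases hv with rfl | rfl | rfl | rfl <;>
        rcases hw with rfl | rfl | rfl | rfl <;> simp at hb hz
      rw [x0, x01, x10, orient_rotate]
      exact o1
    | rotate u v w _ ih =>
      rw [← orient_rotate]
      exact ih hw hu hv

theorem IsNestedAlmostConvex.typeTwo {X : Set Plane} (hX : IsNestedAlmostConvex X)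
    (hk : 1 ≤ numLayers X) (h1 : (layer X 1).ncard = 1) :
    IsTypeTwo X ∧ X.ncard = 3 * 2 ^ (numLayers X - 1) - 2 ∧
      ∃ x, Set.BijOn x (truncation forest2 (numLayers X)) X ∧
        Separated (truncation forest2 (numLayers X)) x := by
  have main : ∀ j, j + 2 ≤ numLayers X → (layer X (j + 2)).ncard = 3 * 2 ^ j ∧
      (innerLayers X (j + 2)).ncard + 2 = 2 * (layer X (j + 2)).ncard ∧
      ∃ x, LayerLabeling X forest2 (j + 2) x := by
    intro j hj
    induction j with
    | zero =>
      obtain ⟨h3, hx⟩ := hX.exists_labeling_two hj h1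
      refine ⟨by simpa using h3, ?_, by simpa using hx⟩
      have H := hX.layerPair (j := 1) hj
      have hu := Set.ncard_union_eq H.disjoint (H.finite.subset Set.subset_union_left)
        (H.finite.subset Set.subset_union_right)
      rw [← innerLayers_succ, innerLayers_one, h1] at hu
      simp only [Nat.reduceAdd, zero_add] at hu ⊢
      omega
    | succ j ih =>
      obtain ⟨i1, i2, x, hx⟩ := ih (by omega)
      obtain ⟨k1, k2⟩ := hX.ncard_succ (j := j + 2) (by omega) (by omega) i2
      refine ⟨?_, k2, ?_⟩
      · rw [show j + 1 + 2 = j + 2 + 1 by ring, k1, i1]; ring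
      refine hx.succ hX isForest_forest2 (by omega) (by omega) i2 ?_ ?_
      · rw [i1]
        have := Nat.one_le_two_pow (n := j)
        omega
      · intro u hu hlen
        exact dropLast_mem_forest2 hu (by omega)
  refine ⟨⟨hk, h1, ?_⟩, ?_⟩
  · intro j hj2 hj
    obtain ⟨j, rfl⟩ : ∃ i, j = i + 2 := ⟨j - 2, by omega⟩
    exact (main j hj).1
  have hX0 := innerLayers_numLayers hX.finite
  rcases hk.eq_or_lt with hk | hk
  · rw [← hk] at hX0 ⊢
    rw [innerLayers_one] at hX0
    obtain ⟨y, hy⟩ := Set.ncard_eq_one.1 h1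
    have htr : truncation forest2 1 = {[0]} := by
      ext u
      constructor
      · intro hu
        rcases forest2_cases hu.1 (hu.2.trans (by norm_num)) with rfl | rfl | rfl | rfl
        · rfl
        all_goals simpa using hu.2
      · rintro rfl; exact ⟨⟨by simp, by simp⟩, by simp⟩
    refine ⟨by rw [← hX0, h1]; norm_num, fun _ => y, ?_, ?_⟩
    · rw [← hX0, hy, htr, Set.bijOn_singleton]
    · rw [htr]
      rintro u rfl v rfl w rfl h
      exact absurd rfl h.ne.1
  · obtain ⟨j, hj⟩ : ∃ i, numLayers X = i + 2 := ⟨numLayers X - 2, by omega⟩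
    obtain ⟨i1, i2, x, hx⟩ := main j (by omega)
    rw [hj] at hX0 ⊢
    rw [hX0] at i2
    refine ⟨?_, x, ?_, hx.separated⟩
    · rw [show j + 2 - 1 = j + 1 by omega, pow_succ]; omega
    · have := hx.bijOn
      rwa [hX0] at this

theorem IsNestedAlmostConvex.classification {X : Set Plane} (hX : IsNestedAlmostConvex X) :
    (IsTypeOne X ∧ X.ncard = 2 ^ (numLayers X + 1) - 2 ∧
      ∃ x, Set.BijOn x (truncation forest1 (numLayers X)) X ∧
        Separated (truncation forest1 (numLayers X)) x) ∨
    (IsTypeTwo X ∧ X.ncard = 3 * 2 ^ (numLayers X - 1) - 2 ∧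
      ∃ x, Set.BijOn x (truncation forest2 (numLayers X)) X ∧
        Separated (truncation forest2 (numLayers X)) x) := by
  by_cases h : 1 ≤ numLayers X ∧ (layer X 1).ncard = 1
  · exact Or.inr (hX.typeTwo h.1 h.2)
  · refine Or.inl (hX.typeOne fun hk => (hX.ncard_layer_one hk).resolve_left fun h1 => h ⟨hk, h1⟩)

/-! ## Coordinates with respect to a corner -/

/-- The point with coordinate `a` along `op` and coordinate `b` along `oq`. -/
noncomputable def cornerPoint (α : Corner) (a b : ℝ) : Plane :=
  α.o + a • (α.p - α.o) + b • (α.q - α.o)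

/-- Corner coordinates are affine, so a change of corner only multiplies orientations by a constant,
which is positive for all corners used. -/
theorem orient_cornerPoint (α : Corner) (a b a' b' a'' b'' : ℝ) :
    orient (cornerPoint α a b) (cornerPoint α a' b') (cornerPoint α a'' b'') =
      orient α.o α.p α.q * ((a' - a) * (b'' - b) - (b' - b) * (a'' - a)) := by
  simp only [orient, cornerPoint, Prod.fst_add, Prod.snd_add, Prod.smul_fst, Prod.smul_snd,
    Prod.fst_sub, Prod.snd_sub, smul_eq_mul]
  ring

theorem cornerPoint_injective {α : Corner} (h : 0 < orient α.o α.p α.q) {a b a' b' : ℝ}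
    (he : cornerPoint α a b = cornerPoint α a' b') : a = a' ∧ b = b' := by
  have h1 : orient (cornerPoint α a b) (cornerPoint α a' b') (cornerPoint α (a + 1) b) = 0 := by
    rw [he]; simp
  have h2 : orient (cornerPoint α a b) (cornerPoint α a' b') (cornerPoint α a (b + 1)) = 0 := by
    rw [he]; simp
  rw [orient_cornerPoint, mul_eq_zero, or_iff_right h.ne'] at h1 h2
  constructor <;> linarith

/-- In coordinates of the parent, the left child has apex `(0, 1/5)` and sides `(1, -1)/5` and `(0,
1)/5`. -/
theorem cornerPoint_childCorner_zero (α : Corner) (a b : ℝ) :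
    cornerPoint (childCorner α 0) a b = cornerPoint α (a / 5) (1 / 5 + b / 5 - a / 5) := by
  simp only [cornerPoint, childCorner, leftPoint, rightPoint, AffineMap.lineMap_apply,
    vsub_eq_sub, vadd_eq_add, if_true]
  module

theorem cornerPoint_childCorner_one (α : Corner) (a b : ℝ) :
    cornerPoint (childCorner α 1) a b = cornerPoint α (1 / 5 + a / 5 - b / 5) (b / 5) := by
  simp only [cornerPoint, childCorner, leftPoint, rightPoint, AffineMap.lineMap_apply,
    vsub_eq_sub, vadd_eq_add, one_ne_zero, if_false]
  module

theorem cornerPoint_zero_zero (α : Corner) : cornerPoint α 0 0 = α.o := by simp [cornerPoint]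

theorem cornerPoint_one_zero (α : Corner) : cornerPoint α 1 0 = α.p := by simp [cornerPoint]

theorem cornerPoint_zero_one (α : Corner) : cornerPoint α 0 1 = α.q := by simp [cornerPoint]

theorem orient_childCorner_pos {α : Corner} (h : 0 < orient α.o α.p α.q) {i : ℕ} (hi : i < 2) :
    0 < orient (childCorner α i).o (childCorner α i).p (childCorner α i).q := by
  rw [← cornerPoint_zero_zero (childCorner α i), ← cornerPoint_one_zero (childCorner α i),
    ← cornerPoint_zero_one (childCorner α i)]
  interval_cases i
  · rw [cornerPoint_childCorner_zero, cornerPoint_childCorner_zero, cornerPoint_childCorner_zero,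
      orient_cornerPoint]
    exact mul_pos h (by norm_num)
  · rw [cornerPoint_childCorner_one, cornerPoint_childCorner_one, cornerPoint_childCorner_one,
      orient_cornerPoint]
    exact mul_pos h (by norm_num)

theorem corner_append (k : ℕ) (u v : List ℕ) :
    corner k (u ++ v) = v.foldl childCorner (corner k u) := by simp [corner, List.foldl_append]

theorem corner_append_singleton (k : ℕ) (u : List ℕ) (i : ℕ) :
    corner k (u ++ [i]) = childCorner (corner k u) i := by simp [corner_append]

theorem orient_corner_pos (k : ℕ) {u : List ℕ} (hu : ∀ i ∈ u, i < 2) :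
    0 < orient (corner k u).o (corner k u).p (corner k u).q := by
  induction u using List.reverseRecOn with
  | nil =>
    simp only [corner, List.foldl_nil, rootCorner, orient, sub_zero, zero_mul]
    positivity
  | append_singleton u i ih =>
    rw [corner_append_singleton]
    exact orient_childCorner_pos (ih fun j hj => hu j (by simp [hj])) (hu i (by simp))

/-- The coordinate, with respect to the corner of a node, of the extreme leaves `n` levels below. -/
noncomputable def extent : ℕ → ℝ
  | 0 => 0
  | n + 1 => (1 + extent n) / 5

theorem extent_nonneg (n : ℕ) : 0 ≤ extent n := by
  induction n with
  | zero => exact le_rfl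
  | succ n ih => rw [extent]; positivity

/-- The value `1/4` is the fixed point of `t ↦ (1 + t) / 5`. -/
theorem extent_lt (n : ℕ) : extent n < 1 / 4 := by
  induction n with
  | zero => norm_num [extent]
  | succ n ih => rw [extent]; linarith

theorem extent_succ_ge (n : ℕ) : 1 / 5 ≤ extent (n + 1) := by
  rw [extent]; linarith [extent_nonneg n]

/-- A node with labeled children has height at least two here, and `6/25` is the extent for height
two. -/
theorem extent_add_two_ge (n : ℕ) : 6 / 25 ≤ extent (n + 2) := by
  rw [extent]; linarith [extent_succ_ge n]

theorem extent_eq (n : ℕ) : extent n * 5 ^ n = (5 ^ n - 1) / 4 := by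
  induction n with
  | zero => simp [extent]
  | succ n ih =>
    rw [extent, pow_succ, show (1 + extent n) / 5 * (5 ^ n * 5) = 5 ^ n + extent n * 5 ^ n by ring,
      ih]
    ring

theorem foldl_replicate_zero (α : Corner) (n : ℕ) :
    ((List.replicate n 0).foldl childCorner α).o = cornerPoint α 0 (extent n) := by
  induction n generalizing α with
  | zero => simp [extent, cornerPoint_zero_zero]
  | succ n ih =>
    rw [List.replicate_succ, List.foldl_cons, ih, cornerPoint_childCorner_zero, extent]
    congr 1 <;> ring

theorem foldl_replicate_one (α : Corner) (n : ℕ) :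
    ((List.replicate n 1).foldl childCorner α).o = cornerPoint α (extent n) 0 := by
  induction n generalizing α with
  | zero => simp [extent, cornerPoint_zero_zero]
  | succ n ih =>
    rw [List.replicate_succ, List.foldl_cons, ih, cornerPoint_childCorner_one, extent]
    congr 1 <;> ring

/-- The point `y_v` is the apex of the corner that the recursion assigns to `v`, so auxiliary points
and labels are handled in the same coordinates. -/
theorem leafPoint_eq (k : ℕ) {v : List ℕ} (hv : v ≠ []) : leafPoint k v = (corner k v).o := by
  obtain ⟨u, i, rfl⟩ := (List.eq_nil_or_concat v).resolve_left hv
  rw [List.concat_eq_append, corner_append_singleton, leafPoint]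
  by_cases hi : i = 0
  · simp [hi, childCorner]
  · simp [hi, childCorner]

/-- The extreme leaves below `u` lie on the two sides of its corner, at the same coordinate by
symmetry, so their midpoint is on the diagonal. -/
theorem nodePoint_eq {k : ℕ} {u : List ℕ} (hu : u.length ≤ k) :
    nodePoint k u = cornerPoint (corner k u) (extent (k + 1 - u.length) / 2)
      (extent (k + 1 - u.length) / 2) := by
  obtain ⟨n, hn⟩ : ∃ n, k + 1 - u.length = n + 1 := ⟨k - u.length, by omega⟩
  rw [nodePoint, firstPoint, lastPoint, hn, leafPoint_eq k (by simp), leafPoint_eq k (by simp),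
    corner_append, corner_append, foldl_replicate_zero, foldl_replicate_one, midpoint_eq_smul_add]
  simp only [cornerPoint, invOf_eq_inv]
  module

/-! ## Points below and outside a node -/

/-- The region of the points of the subtree of a node with corner `α` and height `n`. -/
def Below (α : Corner) (n : ℕ) (z : Plane) : Prop :=
  ∃ a b : ℝ, 0 ≤ a ∧ 0 ≤ b ∧ a + b ≤ extent n ∧ z = cornerPoint α a b

/-- The same region without the parts of its boundary that are on the sides of the corner. -/
def StrictlyBelow (α : Corner) (n : ℕ) (z : Plane) : Prop :=
  ∃ a b : ℝ, 0 < a ∧ 0 < b ∧ a + b ≤ extent n ∧ z = cornerPoint α a b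

/-- The region of the points that are not in the subtree of a node with corner `α`. -/
def Outside (α : Corner) (z : Plane) : Prop :=
  ∃ a b : ℝ, 0 ≤ a ∧ 0 ≤ b ∧ 3 / 4 ≤ a + b ∧ z = cornerPoint α a b

theorem StrictlyBelow.below {α : Corner} {n : ℕ} {z : Plane} (h : StrictlyBelow α n z) :
    Below α n z := by
  obtain ⟨a, b, ha, hb, hab, rfl⟩ := h
  exact ⟨a, b, ha.le, hb.le, hab, rfl⟩

theorem Below.of_child {α : Corner} {n i : ℕ} {z : Plane} (hi : i < 2)
    (h : Below (childCorner α i) n z) : Below α (n + 1) z := by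
  obtain ⟨a, b, ha, hb, hab, rfl⟩ := h
  have hn := extent_lt n
  interval_cases i
  · exact ⟨_, _, by positivity, by linarith, by rw [extent]; linarith,
      cornerPoint_childCorner_zero α a b⟩
  · exact ⟨_, _, by linarith, by positivity, by rw [extent]; linarith,
      cornerPoint_childCorner_one α a b⟩

theorem StrictlyBelow.of_child {α : Corner} {n i : ℕ} {z : Plane} (hi : i < 2)
    (h : StrictlyBelow (childCorner α i) n z) : StrictlyBelow α (n + 1) z := by
  obtain ⟨a, b, ha, hb, hab, rfl⟩ := h
  have hn := extent_lt n
  interval_cases i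
  · exact ⟨_, _, by positivity, by linarith, by rw [extent]; linarith,
      cornerPoint_childCorner_zero α a b⟩
  · exact ⟨_, _, by linarith, by positivity, by rw [extent]; linarith,
      cornerPoint_childCorner_one α a b⟩

theorem strictlyBelow_nodePoint {k : ℕ} {u v : List ℕ} (huv : u <+: v) (hv : ∀ i ∈ v, i < 2)
    (hk : v.length ≤ k) : StrictlyBelow (corner k u) (k + 1 - u.length) (nodePoint k v) := by
  obtain ⟨t, rfl⟩ := huv
  induction t generalizing u with
  | nil =>
    simp only [List.append_nil] at hk ⊢
    obtain ⟨n, hn⟩ : ∃ n, k + 1 - u.length = n + 1 := ⟨k - u.length, by omega⟩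
    have := extent_succ_ge n
    rw [nodePoint_eq hk, hn]
    exact ⟨_, _, by linarith, by linarith, by linarith, rfl⟩
  | cons j s ih =>
    have := ih (u := u ++ [j]) (by simpa using hv) (by simpa using hk)
    rw [corner_append_singleton] at this
    simp only [List.length_append, List.length_singleton, List.append_assoc,
      List.singleton_append] at this
    have h := this.of_child (hv j (by simp))
    have hlen : u.length < k := by simp at hk; omega
    rwa [show k + 1 - (u.length + 1) + 1 = k + 1 - u.length by omega] at h

theorem below_leafPoint {k : ℕ} {u v : List ℕ} (huv : u <+: v) (hv : ∀ i ∈ v, i < 2)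
    (hk : v.length = k + 1) : Below (corner k u) (k + 1 - u.length) (leafPoint k v) := by
  obtain ⟨t, rfl⟩ := huv
  induction t generalizing u with
  | nil =>
    simp only [List.append_nil] at hk ⊢
    rw [leafPoint_eq k (by rintro rfl; simp at hk), hk]
    exact ⟨0, 0, le_rfl, le_rfl, by simp [extent], (cornerPoint_zero_zero _).symm⟩
  | cons j s ih =>
    have := ih (u := u ++ [j]) (by simpa using hv) (by simpa using hk)
    rw [corner_append_singleton] at this
    simp only [List.length_append, List.length_singleton, List.append_assoc,
      List.singleton_append] at this
    have h := this.of_child (hv j (by simp))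
    have hlen : u.length < k + 1 := by simp at hk; omega
    rwa [show k + 1 - (u.length + 1) + 1 = k + 1 - u.length by omega] at h

/-- A coordinate sum of at least `3/4` for the parent becomes at least `5 * (3/4) - 1 = 11/4` for
the child. -/
theorem Outside.child {α : Corner} {i : ℕ} {z : Plane} (hi : i < 2) (h : Outside α z) :
    Outside (childCorner α i) z := by
  obtain ⟨x, y, hx, hy, hxy, rfl⟩ := h
  interval_cases i
  · refine ⟨5 * x, 5 * y - 1 + 5 * x, by positivity, by linarith, by linarith, ?_⟩
    rw [cornerPoint_childCorner_zero]
    congr 1 <;> ring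
  · refine ⟨5 * x - 1 + 5 * y, 5 * y, by linarith, by positivity, by linarith, ?_⟩
    rw [cornerPoint_childCorner_one]
    congr 1 <;> ring

/-- This is the origin of `3/4`: in coordinates of the sibling, the sum is at least one minus a
coordinate below `1/4`. -/
theorem Below.outside_sibling {α : Corner} {i j n : ℕ} {z : Plane} (hi : i < 2) (hj : j < 2)
    (hij : i ≠ j) (h : Below (childCorner α j) n z) : Outside (childCorner α i) z := by
  obtain ⟨a, b, ha, hb, hab, rfl⟩ := h
  have hn := extent_lt n
  interval_cases i <;> interval_cases j
  · exact absurd rfl hij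
  · refine ⟨1 + a - b, a, by linarith, ha, by linarith, ?_⟩
    rw [cornerPoint_childCorner_zero, cornerPoint_childCorner_one]
    congr 1 <;> ring
  · refine ⟨b, 1 + b - a, hb, by linarith, by linarith, ?_⟩
    rw [cornerPoint_childCorner_zero, cornerPoint_childCorner_one]
    congr 1 <;> ring
  · exact absurd rfl hij

/-- In coordinates of the child, the sum is `15c/2 - 1`, at least `4/5`. The value `c = 1/5` of a
node of height one would give only `1/2`. -/
theorem outside_child_of_parent {α : Corner} {i : ℕ} (hi : i < 2) {c : ℝ} (hc : 6 / 25 ≤ c) :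
    Outside (childCorner α i) (cornerPoint α (c / 2) (c / 2)) := by
  interval_cases i
  · refine ⟨5 * (c / 2), 5 * c - 1, by linarith, by linarith, by linarith, ?_⟩
    rw [cornerPoint_childCorner_zero]
    congr 1 <;> ring
  · refine ⟨5 * c - 1, 5 * (c / 2), by linarith, by linarith, by linarith, ?_⟩
    rw [cornerPoint_childCorner_one]
    congr 1 <;> ring

/-- Where the path to `u` leaves the path to `w`, the point is in the sibling's subtree or is the
label of the branching node itself; below that, `Outside.child` propagates. The hypothesis `hself`
concerns the second case, which is void for leaf points. -/
theorem outside_of_not_prefix {k : ℕ} {z : Plane} {u w : List ℕ} (hu : ∀ i ∈ u, i < 2)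
    (hw : ∀ i ∈ w, i < 2)
    (hbelow : ∀ m, m <+: w → Below (corner k m) (k + 1 - m.length) z)
    (hself : w.length < u.length →
      ∃ c : ℝ, 6 / 25 ≤ c ∧ z = cornerPoint (corner k w) (c / 2) (c / 2))
    (h : ¬ u <+: w) : Outside (corner k u) z := by
  induction u using List.reverseRecOn with
  | nil => exact absurd List.nil_prefix h
  | append_singleton m i ih =>
    have hi := hu i (by simp)
    rw [corner_append_singleton]
    by_cases hm : m <+: w
    · by_cases hmw : m = w
      · subst hmw
        obtain ⟨c, hc, rfl⟩ := hself (by simp)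
        exact outside_child_of_parent hi hc
      · obtain ⟨j, hj, hjw⟩ := exists_append_singleton_prefix hm hmw
        have := hbelow _ hj
        rw [corner_append_singleton] at this
        exact this.outside_sibling hi (hw j hjw) (by rintro rfl; exact h hj)
    · exact (ih (fun j hj => hu j (by simp [hj]))
        (fun hlt => hself (by simp; omega)) hm).child hi

theorem outside_nodePoint {k : ℕ} {u w : List ℕ} (hu : ∀ i ∈ u, i < 2) (hw : ∀ i ∈ w, i < 2)
    (huk : u.length ≤ k) (hwk : w.length ≤ k) (h : ¬ u <+: w) :
    Outside (corner k u) (nodePoint k w) := by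
  refine outside_of_not_prefix hu hw (fun m hm => (strictlyBelow_nodePoint hm hw hwk).below) ?_ h
  intro hlt
  refine ⟨_, ?_, nodePoint_eq hwk⟩
  rw [show k + 1 - w.length = k - 1 - w.length + 2 by omega]
  exact extent_add_two_ge _

theorem outside_leafPoint {k : ℕ} {u w : List ℕ} (hu : ∀ i ∈ u, i < 2) (hw : ∀ i ∈ w, i < 2)
    (huk : u.length ≤ k + 1) (hwk : w.length = k + 1) (h : ¬ u <+: w) :
    Outside (corner k u) (leafPoint k w) :=
  outside_of_not_prefix hu hw (fun _ hm => below_leafPoint hm hw hwk) (fun hlt => by omega) h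

/-! ## Separation inequalities -/

/-- A linear form with positive coefficients on `x, y ≥ 0`, `x + y ≥ 3/4` has its minimum at `(3/4,
0)` or `(0, 3/4)`. -/
theorem lt_of_both_lt {d e K x y : ℝ} (hd : 0 < d) (he : 0 < e) (hx : 0 ≤ x) (hy : 0 ≤ y)
    (hxy : 3 / 4 ≤ x + y) (h1 : K < 3 / 4 * d) (h2 : K < 3 / 4 * e) : K < d * y + e * x := by
  rcases le_total d e with h | h
  · nlinarith [mul_nonneg (sub_nonneg.2 h) hx, mul_nonneg hd.le (sub_nonneg.2 hxy)]
  · nlinarith [mul_nonneg (sub_nonneg.2 h) hy, mul_nonneg he.le (sub_nonneg.2 hxy)]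

theorem internal_orient_pos {α : Corner} {n : ℕ} {a b z : Plane} (hα : 0 < orient α.o α.p α.q)
    (ha : Below (childCorner α 0) n a) (hb : Below (childCorner α 1) n b) (hz : Outside α z) :
    0 < orient a b z := by
  obtain ⟨a1, b1, ha1, hb1, h1, rfl⟩ := ha
  obtain ⟨a2, b2, ha2, hb2, h2, rfl⟩ := hb
  obtain ⟨x, y, hx, hy, hxy, rfl⟩ := hz
  have hn := extent_lt n
  rw [cornerPoint_childCorner_zero, cornerPoint_childCorner_one, orient_cornerPoint]
  refine mul_pos hα ?_
  set ax := a1 / 5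
  set ay := 1 / 5 + b1 / 5 - a1 / 5
  set bx := 1 / 5 + a2 / 5 - b2 / 5
  set b' := b2 / 5
  have e1 : 0 ≤ ax := by positivity
  have e2 : ax ≤ 1 / 20 := by simp only [ax]; linarith
  have e3 : 3 / 20 ≤ ay := by simp only [ay]; linarith
  have e4 : ay ≤ 1 / 4 := by simp only [ay]; linarith
  have e5 : 3 / 20 ≤ bx := by simp only [bx]; linarith
  have e6 : bx ≤ 1 / 4 := by simp only [bx]; linarith
  have e7 : 0 ≤ b' := by positivity
  have e8 : b' ≤ 1 / 20 := by simp only [b']; linarith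
  have key := lt_of_both_lt (d := bx - ax) (e := ay - b')
    (K := (bx - ax) * ay + (ay - b') * ax) (x := x) (y := y) (by linarith) (by linarith) hx hy hxy
    (by nlinarith [mul_nonneg e1 e7]) (by nlinarith [mul_nonneg e1 e7])
  linarith

/-- Both points have coordinate sum strictly below that of the midpoint, and their first coordinates
are on different sides of `c / 2`. Strictness comes from `a1 > 0` and `b2 > 0`, hence
`StrictlyBelow`. -/
theorem internal_orient_nodePoint_pos {α : Corner} {n : ℕ} {a b : Plane}
    (hα : 0 < orient α.o α.p α.q) (ha : StrictlyBelow (childCorner α 0) n a)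
    (hb : StrictlyBelow (childCorner α 1) n b) :
    0 < orient a b (cornerPoint α (extent (n + 1) / 2) (extent (n + 1) / 2)) := by
  obtain ⟨a1, b1, ha1, hb1, h1, rfl⟩ := ha
  obtain ⟨a2, b2, ha2, hb2, h2, rfl⟩ := hb
  have hn := extent_lt n
  have hn' := extent_lt (n + 1)
  have hn'' := extent_succ_ge n
  have he : extent (n + 1) = (1 + extent n) / 5 := rfl
  rw [cornerPoint_childCorner_zero, cornerPoint_childCorner_one, orient_cornerPoint]
  refine mul_pos hα ?_
  set c := extent (n + 1)
  have e1 : 0 < c - (1 / 5 + b1 / 5) := by linarith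
  have e2 : 0 < c - (1 / 5 + a2 / 5) := by linarith
  have e3 : 0 < (1 / 5 + a2 / 5 - b2 / 5) - c / 2 := by linarith
  have e4 : 0 < c / 2 - a1 / 5 := by linarith
  linarith [mul_pos e1 e3, mul_pos e2 e4]

/-- The coordinate form of external separation, stated once for the left child; the right child
follows by exchanging the two coordinates. -/
theorem external_inequality {a b c c' x y : ℝ} (ha : 0 ≤ a) (hb : 0 ≤ b) (hab : a + b ≤ c')
    (hc' : c' < 1 / 4) (hc : 1 / 5 ≤ c) (hc4 : c < 1 / 4) (hx : 0 ≤ x) (hy : 0 ≤ y)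
    (hxy : 3 / 4 ≤ x + y) :
    0 < (c / 2 - a / 5) * (y - (1 / 5 + b / 5 - a / 5))
      - (c / 2 - (1 / 5 + b / 5 - a / 5)) * (x - a / 5) := by
  set ax := a / 5
  set ay := 1 / 5 + b / 5 - a / 5
  have e1 : 0 ≤ ax := by positivity
  have e2 : ax ≤ 1 / 20 := by simp only [ax]; linarith
  have e3 : 1 / 5 ≤ ay + ax := by simp only [ax, ay]; linarith
  have e4 : ay ≤ 1 / 4 := by simp only [ay]; linarith
  have key := lt_of_both_lt (d := c / 2 - ax) (e := ay - c / 2)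
    (K := (c / 2 - ax) * ay + (ay - c / 2) * ax) (x := x) (y := y) (by linarith) (by linarith) hx
    hy hxy (by nlinarith) (by nlinarith)
  linarith

theorem external_left_pos {α : Corner} {n : ℕ} {a z : Plane} (hα : 0 < orient α.o α.p α.q)
    (ha : Below (childCorner α 0) n a) (hz : Outside α z) :
    0 < orient a (cornerPoint α (extent (n + 1) / 2) (extent (n + 1) / 2)) z := by
  obtain ⟨a1, b1, ha1, hb1, h1, rfl⟩ := ha
  obtain ⟨x, y, hx, hy, hxy, rfl⟩ := hz
  rw [cornerPoint_childCorner_zero, orient_cornerPoint]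
  exact mul_pos hα (external_inequality ha1 hb1 h1 (extent_lt n) (extent_succ_ge n)
    (extent_lt (n + 1)) hx hy hxy)

theorem external_right_pos {α : Corner} {n : ℕ} {b z : Plane} (hα : 0 < orient α.o α.p α.q)
    (hb : Below (childCorner α 1) n b) (hz : Outside α z) :
    0 < orient (cornerPoint α (extent (n + 1) / 2) (extent (n + 1) / 2)) b z := by
  obtain ⟨a1, b1, ha1, hb1, h1, rfl⟩ := hb
  obtain ⟨x, y, hx, hy, hxy, rfl⟩ := hz
  rw [cornerPoint_childCorner_one, orient_cornerPoint]
  refine mul_pos hα ?_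
  have := external_inequality hb1 ha1 (by linarith) (extent_lt n) (extent_succ_ge n)
    (extent_lt (n + 1)) hy hx (by linarith)
  linarith

theorem append_singleton_length_le {m u : List ℕ} {i k : ℕ} (h : m ++ [i] <+: u)
    (hu : u.length ≤ k) : m.length + 1 ≤ k := by
  have := h.length_le
  simp at this
  omega

theorem eq_of_prefix_of_not_children {m w : List ℕ} (hw : ∀ i ∈ w, i < 2) (h : m <+: w)
    (h0 : ¬ m ++ [0] <+: w) (h1 : ¬ m ++ [1] <+: w) : m = w := by
  by_contra hne
  obtain ⟨i, hi, hiw⟩ := exists_append_singleton_prefix h hne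
  have := hw i hiw
  interval_cases i <;> contradiction

theorem separated_nodePoint (k : ℕ) : Separated (truncation forest1 k) (nodePoint k) := by
  intro u hu v hv w hw h
  have height : ∀ {m : List ℕ}, m.length + 1 ≤ k →
      k + 1 - m.length = k + 1 - (m.length + 1) + 1 := fun h => by omega
  have below : ∀ {m u : List ℕ} {i : ℕ}, u ∈ truncation forest1 k → m ++ [i] <+: u →
      StrictlyBelow (childCorner (corner k m) i) (k + 1 - (m.length + 1)) (nodePoint k u) := by
    intro m u i hu h
    have := strictlyBelow_nodePoint h hu.1.2 hu.2
    rwa [corner_append_singleton, List.length_append, List.length_singleton] at this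
  induction h with
  | internal m u v w h0 h1 hw0 hw1 =>
    have hm := binary_of_prefix (prefix_of_append_singleton_prefix h0) hu.1.2
    have hα := orient_corner_pos k hm
    have hmk := append_singleton_length_le h0 hu.2
    by_cases hmw : m <+: w
    · obtain rfl := eq_of_prefix_of_not_children hw.1.2 hmw hw0 hw1
      rw [nodePoint_eq (u := m) (by omega), height hmk]
      exact internal_orient_nodePoint_pos hα (below hu h0) (below hv h1)
    · exact internal_orient_pos hα (below hu h0).below (below hv h1).below
        (outside_nodePoint hm hw.1.2 (by omega) hw.2 hmw)
  | left m a z ha hz =>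
    have hmk := append_singleton_length_le ha hu.2
    rw [nodePoint_eq (u := m) (by omega), height hmk]
    exact external_left_pos (orient_corner_pos k hv.1.2) (below hu ha).below
      (outside_nodePoint hv.1.2 hw.1.2 hv.2 hw.2 hz)
  | right m b z hb hz =>
    have hmk := append_singleton_length_le hb hv.2
    rw [nodePoint_eq (u := m) (by omega), height hmk]
    exact external_right_pos (orient_corner_pos k hu.1.2) (below hv hb).below
      (outside_nodePoint hu.1.2 hw.1.2 hu.2 hw.2 hz)
  | rotate u v w _ ih =>
    rw [← orient_rotate]
    exact ih hw hu hv

/-- In the coordinates of `u`, its own label has sum below `1/4`, and the label of a node not below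
`u` has sum at least `3/4`. -/
theorem injOn_nodePoint (k : ℕ) : Set.InjOn (nodePoint k) (truncation forest1 k) := by
  have key : ∀ u ∈ truncation forest1 k, ∀ w ∈ truncation forest1 k, ¬ u <+: w →
      nodePoint k u ≠ nodePoint k w := by
    intro u hu w hw h he
    obtain ⟨a, b, ha, hb, hab, h1⟩ := strictlyBelow_nodePoint List.prefix_rfl hu.1.2 hu.2
    obtain ⟨x, y, hx, hy, hxy, h2⟩ := outside_nodePoint hu.1.2 hw.1.2 hu.2 hw.2 h
    rw [h1, h2] at he
    obtain ⟨rfl, rfl⟩ := cornerPoint_injective (orient_corner_pos k hu.1.2) he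
    linarith [extent_lt (k + 1 - u.length)]
  intro u hu w hw he
  by_cases h : u <+: w
  · by_cases h' : w <+: u
    · exact h.eq_of_length (le_antisymm h.length_le h'.length_le)
    · exact absurd he.symm (key w hw u hu h')
  · exact absurd he (key u hu w hw h)

theorem abs_nodePoint_le {k : ℕ} {u : List ℕ} (hu : u ∈ truncation forest1 k) :
    |(nodePoint k u).1| ≤ 2 * 5 ^ (k + 1) ∧ |(nodePoint k u).2| ≤ 2 * 5 ^ (k + 1) := by
  obtain ⟨a, b, ha, hb, hab, h⟩ := strictlyBelow_nodePoint List.nil_prefix hu.1.2 hu.2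
  have hn := extent_lt (k + 1 - ([] : List ℕ).length)
  have hM : (0 : ℝ) < 2 * 5 ^ (k + 1) := by positivity
  rw [h]
  simp only [cornerPoint, corner, List.foldl_nil, rootCorner, Prod.fst_add, Prod.snd_add,
    Prod.smul_fst, Prod.smul_snd, Prod.fst_sub, Prod.snd_sub, smul_eq_mul, sub_zero, mul_zero,
    add_zero, zero_add]
  constructor
  · rw [abs_of_nonneg (by positivity)]
    nlinarith
  · rw [abs_of_nonneg (by positivity)]
    nlinarith

/-! ## The lexicographic order of the nodes of a level -/

theorem exists_meet_of_lt {u v : List ℕ} (hu : ∀ i ∈ u, i < 2) (hv : ∀ i ∈ v, i < 2)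
    (hlen : u.length = v.length) (h : u < v) : ∃ m, m ++ [0] <+: u ∧ m ++ [1] <+: v := by
  induction u generalizing v with
  | nil =>
    rw [List.length_nil] at hlen
    obtain rfl := List.length_eq_zero_iff.1 hlen.symm
    exact absurd h (lt_irrefl _)
  | cons a u ih =>
    rcases v with _ | ⟨b, v⟩
    · simp at hlen
    rcases List.cons_lt_cons_iff.1 h with hab | ⟨rfl, hlt⟩
    · have hb := hv b (by simp)
      obtain rfl : a = 0 := by omega
      obtain rfl : b = 1 := by omega
      exact ⟨[], by simp, by simp⟩
    · obtain ⟨m, h0, h1⟩ := ih (v := v) (fun i hi => hu i (by simp [hi]))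
        (fun i hi => hv i (by simp [hi])) (by simpa using hlen) hlt
      exact ⟨a :: m, by simpa using h0, by simpa using h1⟩

/-- Three nodes of the same level, from left to right. -/
theorem exists_meets_of_lt {u v w : List ℕ} (hu : ∀ i ∈ u, i < 2) (hv : ∀ i ∈ v, i < 2)
    (hw : ∀ i ∈ w, i < 2) (huv : u.length = v.length) (hvw : v.length = w.length)
    (h : u < v) (h' : v < w) :
    (∃ m, m ++ [0] <+: u ∧ m ++ [1] <+: v ∧ ¬ m <+: w) ∨
      (∃ m, m ++ [0] <+: v ∧ m ++ [1] <+: w ∧ ¬ m <+: u) := by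
  obtain ⟨m, hm0, hm1⟩ := exists_meet_of_lt hu hv huv h
  obtain ⟨n, hn0, hn1⟩ := exists_meet_of_lt hv hw hvw h'
  have hne : m ≠ n := by
    rintro rfl
    simpa using eq_of_append_singleton_prefix hm1 hn0
  by_cases hmw : m <+: w
  · refine Or.inr ⟨n, hn0, hn1, fun hnu => hne ?_⟩
    have h1 := prefix_meet (by norm_num) hm0 hm1 hnu (prefix_of_append_singleton_prefix hn0)
    have h2 := prefix_meet (by norm_num) hn0 hn1 (prefix_of_append_singleton_prefix hm1) hmw
    exact h2.eq_of_length (le_antisymm h2.length_le h1.length_le)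
  · exact Or.inl ⟨m, hm0, hm1, hmw⟩

theorem posTriple_of_lt {u v w : List ℕ} (hu : ∀ i ∈ u, i < 2) (hv : ∀ i ∈ v, i < 2)
    (hw : ∀ i ∈ w, i < 2) (huv : u.length = v.length) (hvw : v.length = w.length)
    (h : u < v) (h' : v < w) : PosTriple u v w := by
  rcases exists_meets_of_lt hu hv hw huv hvw h h' with ⟨m, h0, h1, hm⟩ | ⟨m, h0, h1, hm⟩
  · exact .internal m u v w h0 h1 (fun h => hm (prefix_of_append_singleton_prefix h))
      (fun h => hm (prefix_of_append_singleton_prefix h))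
  · exact (PosTriple.internal m v w u h0 h1 (fun h => hm (prefix_of_append_singleton_prefix h))
      (fun h => hm (prefix_of_append_singleton_prefix h))).rotate'

theorem leafPoint_orient_pos {k : ℕ} {u v w : List ℕ} (hu : u ∈ level1 (k + 1) (k + 1))
    (hv : v ∈ level1 (k + 1) (k + 1)) (hw : w ∈ level1 (k + 1) (k + 1)) (h : u < v) (h' : v < w) :
    0 < orient (leafPoint k u) (leafPoint k v) (leafPoint k w) := by
  have key : ∀ {m u v w : List ℕ}, u ∈ level1 (k + 1) (k + 1) → v ∈ level1 (k + 1) (k + 1) →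
      w ∈ level1 (k + 1) (k + 1) → m ++ [0] <+: u → m ++ [1] <+: v → ¬ m <+: w →
      0 < orient (leafPoint k u) (leafPoint k v) (leafPoint k w) := by
    intro m u v w hu hv hw h0 h1 hm
    have hmb := binary_of_prefix (prefix_of_append_singleton_prefix h0) hu.1.2
    have hmk := append_singleton_length_le h0 hu.2.le
    have b0 := below_leafPoint h0 hu.1.2 hu.2
    have b1 := below_leafPoint h1 hv.1.2 hv.2
    rw [corner_append_singleton, List.length_append, List.length_singleton] at b0 b1
    exact internal_orient_pos (orient_corner_pos k hmb) b0 b1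
      (outside_leafPoint hmb hw.1.2 (by omega) hw.2 hm)
  rcases exists_meets_of_lt hu.1.2 hv.1.2 hw.1.2 (hu.2.trans hv.2.symm) (hv.2.trans hw.2.symm) h h'
    with ⟨m, h0, h1, hm⟩ | ⟨m, h0, h1, hm⟩
  · exact key hu hv hw h0 h1 hm
  · rw [orient_rotate]
    exact key hv hw hu h0 h1 hm

/-! ## The labelings of the constructed sets -/

theorem truncation_forest1 (k : ℕ) : truncation forest1 k = tree1 k \ {[]} := by
  ext u
  simp only [truncation, forest1, tree1, Set.mem_sdiff, Set.mem_ofPred_eq, Set.mem_singleton_iff]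
  tauto

theorem levelSet_forest1 {k j : ℕ} (h1 : 1 ≤ j) (hj : j ≤ k) : levelSet forest1 j = level1 k j := by
  ext u
  simp only [levelSet, level1, forest1, tree1, Set.mem_ofPred_eq]
  constructor
  · rintro ⟨⟨-, h⟩, h'⟩
    exact ⟨⟨by omega, h⟩, h'⟩
  · rintro ⟨⟨-, h⟩, h'⟩
    exact ⟨⟨by rintro rfl; simp at h'; omega, h⟩, h'⟩

theorem forest2_subset_forest1 : forest2 ⊆ forest1 := fun u hu =>
  ⟨by rintro rfl; simpa using hu.2, hu.1⟩

theorem truncation_forest2_subset (k : ℕ) : truncation forest2 k ⊆ truncation forest1 k :=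
  fun _ hu => ⟨forest2_subset_forest1 hu.1, hu.2⟩

theorem drawing1_eq (k : ℕ) : drawing1 k = nodePoint k '' truncation forest1 k := by
  rw [truncation_forest1, drawing1]

theorem drawing2_eq (k : ℕ) : drawing2 k = nodePoint k '' truncation forest2 k := by
  rw [drawing2]
  congr 1
  ext u
  simp only [truncation, forest2, tree1, Set.mem_ofPred_eq]
  tauto

theorem separated_nodePoint_forest2 (k : ℕ) : Separated (truncation forest2 k) (nodePoint k) :=
  (separated_nodePoint k).mono (truncation_forest2_subset k)

theorem injOn_nodePoint_forest2 (k : ℕ) : Set.InjOn (nodePoint k) (truncation forest2 k) :=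
  (injOn_nodePoint k).mono (truncation_forest2_subset k)

theorem numLayers_drawing1 (k : ℕ) : numLayers (drawing1 k) = k := by
  rw [drawing1_eq]
  exact isForest_forest1.numLayers_image (separated_nodePoint k) (injOn_nodePoint k)

theorem numLayers_drawing2 (k : ℕ) : numLayers (drawing2 k) = k := by
  rw [drawing2_eq]
  exact isForest_forest2.numLayers_image (separated_nodePoint_forest2 k)
    (injOn_nodePoint_forest2 k)

theorem isNestedAlmostConvex_drawing1 (k : ℕ) : IsNestedAlmostConvex (drawing1 k) := by
  rw [drawing1_eq]
  exact isForest_forest1.isNestedAlmostConvex_image (separated_nodePoint k) (injOn_nodePoint k)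

theorem isNestedAlmostConvex_drawing2 (k : ℕ) : IsNestedAlmostConvex (drawing2 k) := by
  rw [drawing2_eq]
  exact isForest_forest2.isNestedAlmostConvex_image (separated_nodePoint_forest2 k)
    (injOn_nodePoint_forest2 k)

theorem layer_drawing1 {k j : ℕ} (hj : j ≤ k) :
    layer (drawing1 k) j = nodePoint k '' levelSet forest1 j := by
  rw [drawing1_eq]
  exact isForest_forest1.layer_image (separated_nodePoint k) (injOn_nodePoint k) hj

theorem layer_drawing2 {k j : ℕ} (hj : j ≤ k) :
    layer (drawing2 k) j = nodePoint k '' levelSet forest2 j := by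
  rw [drawing2_eq]
  exact isForest_forest2.layer_image (separated_nodePoint_forest2 k)
    (injOn_nodePoint_forest2 k) hj

theorem typeOne_drawing1 (k : ℕ) :
    IsTypeOne (drawing1 k) ∧ (drawing1 k).ncard = 2 ^ (k + 1) - 2 := by
  have h := (isNestedAlmostConvex_drawing1 k).typeOne fun hk => by
    rw [numLayers_drawing1] at hk
    have hl : levelSet forest1 1 = {[0], [1]} := by
      ext u
      constructor
      · intro hu; exact forest1_cases hu.1 hu.2.le
      · rintro (rfl | rfl) <;> exact ⟨⟨by simp, by simp⟩, by simp⟩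
    rw [layer_drawing1 hk, ((injOn_nodePoint k).mono
      (Forest.levelSet_subset_truncation 1 |>.trans (truncation_mono _ hk))).ncard_image, hl]
    exact Set.ncard_pair (by simp)
  rw [numLayers_drawing1] at h
  exact ⟨h.1, h.2.1⟩

theorem typeTwo_drawing2 {k : ℕ} (hk : 1 ≤ k) :
    IsTypeTwo (drawing2 k) ∧ (drawing2 k).ncard = 3 * 2 ^ (k - 1) - 2 := by
  have h := (isNestedAlmostConvex_drawing2 k).typeTwo (by rwa [numLayers_drawing2]) (by
    have hl : levelSet forest2 1 = {[0]} := by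
      ext u
      constructor
      · intro hu
        have hlen := hu.2
        rcases forest2_cases hu.1 (by omega) with rfl | rfl | rfl | rfl
        · rfl
        all_goals simp at hlen
      · rintro rfl
        exact ⟨⟨by simp, by simp⟩, by simp⟩
    rw [layer_drawing2 hk, hl, Set.image_singleton, Set.ncard_singleton])
  rw [numLayers_drawing2] at h
  exact ⟨h.1, h.2.1⟩

theorem Separated.internalSeparation {N : Set (List ℕ)} {x : List ℕ → Plane}
    (hx : Separated N x) (h2 : ∀ u, u ++ [2] ∉ N) :
    InternalSeparation N x (x '' N) := by
  rintro u c c' (⟨rfl, rfl⟩ | ⟨h, -⟩)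
  · rintro _ ⟨v, ⟨hv, hcv⟩, rfl⟩ _ ⟨w, ⟨hw, hcw⟩, rfl⟩ _ ⟨⟨z, hz, rfl⟩, hnot⟩
    refine hx v hv w hw z hz (.internal u v w z hcv hcw (fun h => hnot (Or.inl ?_))
      (fun h => hnot (Or.inr ?_)))
    · exact ⟨z, ⟨hz, h⟩, rfl⟩
    · exact ⟨z, ⟨hz, h⟩, rfl⟩
  · exact absurd h (h2 u)

theorem internalSeparation_drawing1 (k : ℕ) :
    InternalSeparation (tree1 k \ {[]}) (nodePoint k) (drawing1 k) := by
  rw [← truncation_forest1, drawing1_eq]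
  refine (separated_nodePoint k).internalSeparation fun u hu => ?_
  have := hu.1.2 2 (by simp)
  omega

theorem externalSeparation_drawing1 (k : ℕ) :
    ExternalSeparation (tree1 k \ {[]}) (nodePoint k) (drawing1 k) := by
  rw [← truncation_forest1, drawing1_eq]
  rintro u _ ⟨⟨z, hz, rfl⟩, hnot⟩
  have hzu : ¬ u <+: z := fun h => hnot ⟨z, ⟨hz, h⟩, rfl⟩
  have hu : ∀ {v : List ℕ} {i : ℕ}, v ∈ truncation forest1 k → u ++ [i] <+: v →
      u ∈ truncation forest1 k := by
    intro v i hv h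
    have h' := prefix_of_append_singleton_prefix h
    exact ⟨⟨by rintro rfl; simp at hzu, binary_of_prefix h' hv.1.2⟩, h'.length_le.trans hv.2⟩
  constructor
  · rintro _ ⟨v, ⟨hv, huv⟩, rfl⟩
    exact separated_nodePoint k v hv u (hu hv huv) z hz (.left u v z huv hzu)
  · rintro _ ⟨v, ⟨hv, huv⟩, rfl⟩
    exact separated_nodePoint k u (hu hv huv) v hv z hz (.right u v z huv hzu)

theorem isNestedLabeling_drawing1 (k : ℕ) :
    IsNestedLabeling (level1 k) (nodePoint k) (drawing1 k) := by
  intro j h1 hj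
  rw [numLayers_drawing1] at hj
  rw [← levelSet_forest1 h1 hj]
  refine ⟨(layer_drawing1 hj).symm, fun u hu v hv w hw huv hvw => ?_⟩
  have hsub : ∀ u ∈ levelSet forest1 j, u ∈ truncation forest1 k := fun u hu =>
    ⟨hu.1, hu.2.trans_le hj⟩
  exact separated_nodePoint k u (hsub u hu) v (hsub v hv) w (hsub w hw)
    (posTriple_of_lt hu.1.2 hv.1.2 hw.1.2 (hu.2.trans hv.2.symm) (hv.2.trans hw.2.symm) huv hvw)

/-! ## The tree with three branches at the root -/

theorem embed2_append (u : List ℕ) {i : ℕ} (hi : i < 2) : embed2 (u ++ [i]) = embed2 u ++ [i] := by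
  rcases u with _ | ⟨a, u⟩
  · simp [embed2, show i ≠ 2 by omega]
  · by_cases ha : a = 2 <;> simp [embed2, ha]

/-- Only the root has to be excluded: its image `[0]` is not a prefix of the images in the third
branch. -/
theorem embed2_prefix {c : List ℕ} (hc : c ≠ []) (w : List ℕ) :
    embed2 c <+: embed2 w ↔ c <+: w := by
  obtain ⟨a, c, rfl⟩ := List.exists_cons_of_ne_nil hc
  rcases w with _ | ⟨b, w⟩
  · by_cases ha : a = 2 <;> simp [embed2, ha]
  · by_cases ha : a = 2
    · by_cases hb : b = 2
      · simp [embed2, ha, hb]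
      · simp [embed2, ha, hb, Ne.symm hb]
    · by_cases hb : b = 2 <;> simp [embed2, ha, hb]

theorem length_embed2 (u : List ℕ) : (embed2 u).length = u.length + 1 := by
  rcases u with _ | ⟨a, u⟩
  · rfl
  · by_cases ha : a = 2 <;> simp [embed2, ha]

theorem embed2_injective : Function.Injective embed2 := by
  intro u v h
  rcases u with _ | ⟨a, u⟩
  · have := congrArg List.length h
    rw [length_embed2, length_embed2] at this
    exact (List.length_eq_zero_iff.1 (by simpa using this.symm)).symm
  · have h1 : (a :: u) <+: v := (embed2_prefix (by simp) v).1 (h ▸ List.prefix_rfl)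
    refine h1.eq_of_length ?_
    have := congrArg List.length h
    rwa [length_embed2, length_embed2, Nat.add_right_cancel_iff] at this

theorem embed2_lt {u v : List ℕ} (hlen : u.length = v.length)
    (hu : ∀ a t, u = a :: t → a < 3) (hv : ∀ a t, v = a :: t → a < 3) (h : u < v) :
    embed2 u < embed2 v := by
  rcases u with _ | ⟨a, u⟩
  · obtain rfl := List.length_eq_zero_iff.1 hlen.symm
    exact absurd h (lt_irrefl _)
  rcases v with _ | ⟨b, v⟩
  · simp at hlen
  have ha := hu a u rfl
  have hb := hv b v rfl
  rcases List.cons_lt_cons_iff.1 h with hab | ⟨rfl, hlt⟩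
  · have ha2 : a ≠ 2 := by omega
    by_cases hb2 : b = 2
    · simp [embed2, ha2, hb2, List.cons_lt_cons_iff]
    · simp [embed2, ha2, hb2, List.cons_lt_cons_iff, hab]
  · by_cases ha2 : a = 2
    · simp [embed2, ha2, hlt]
    · simp [embed2, ha2, hlt]

theorem bijOn_embed2 {k : ℕ} (hk : 1 ≤ k) : Set.BijOn embed2 (tree2 k) (truncation forest2 k) := by
  refine ⟨?_, embed2_injective.injOn, ?_⟩
  · rintro u ⟨hlen, h⟩
    refine ⟨?_, by rw [length_embed2]; omega⟩
    rcases h with rfl | ⟨a, v, rfl, ha, hv⟩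
    · exact isForest_forest2.zero_mem
    · by_cases ha2 : a = 2
      · simpa [embed2, ha2, forest2] using hv
      · simp only [embed2, ha2, if_false]
        refine ⟨?_, Or.inl (by simp)⟩
        intro i hi
        simp only [List.mem_cons] at hi
        rcases hi with rfl | rfl | hi
        · norm_num
        · omega
        · exact hv i hi
  · rintro u ⟨⟨h2, ⟨t, rfl⟩ | ⟨t, rfl⟩⟩, hlen⟩
    · rcases t with _ | ⟨a, t⟩
      · exact ⟨[], ⟨by simp; omega, Or.inl rfl⟩, rfl⟩
      · have ha := h2 a (by simp)
        refine ⟨a :: t, ⟨by simp at hlen ⊢; omega, Or.inr ⟨a, t, rfl, by omega, ?_⟩⟩, ?_⟩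
        · exact fun i hi => h2 i (by simp [hi])
        · simp [embed2, show a ≠ 2 by omega]
    · refine ⟨2 :: t, ⟨by simp at hlen ⊢; omega, Or.inr ⟨2, t, rfl, by norm_num, ?_⟩⟩, ?_⟩
      · exact fun i hi => h2 i (by simp [hi])
      · simp [embed2]

theorem image_embed2_level2 {k j : ℕ} (h1 : 1 ≤ j) (hj : j ≤ k) :
    embed2 '' level2 k j = levelSet forest2 j := by
  have hbij := bijOn_embed2 (h1.trans hj)
  ext u
  constructor
  · rintro ⟨v, ⟨hv, hlen⟩, rfl⟩
    exact ⟨(hbij.mapsTo hv).1, by rw [length_embed2, hlen]⟩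
  · rintro ⟨hu, hlen⟩
    obtain ⟨v, hv, rfl⟩ := hbij.surjOn ⟨hu, hlen.trans_le hj⟩
    exact ⟨v, ⟨hv, by rwa [length_embed2] at hlen⟩, rfl⟩

theorem isTypeTwoLabeling_drawing2 {k : ℕ} (hk : 1 ≤ k) :
    IsTypeTwoLabeling k (nodePoint k ∘ embed2) (drawing2 k) := by
  refine ⟨numLayers_drawing2 k, (typeTwo_drawing2 hk).1, ?_⟩
  rw [drawing2_eq]
  exact (injOn_nodePoint_forest2 k).bijOn_image.comp (bijOn_embed2 hk)

theorem isNestedLabeling_drawing2 (k : ℕ) :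
    IsNestedLabeling (level2 k) (nodePoint k ∘ embed2) (drawing2 k) := by
  intro j h1 hj
  rw [numLayers_drawing2] at hj
  have himg := image_embed2_level2 h1 hj
  refine ⟨by rw [Set.image_comp, himg, layer_drawing2 hj], fun u hu v hv w hw huv hvw => ?_⟩
  have hmem : ∀ u ∈ level2 k j, embed2 u ∈ levelSet forest2 j := fun u hu => himg ▸ ⟨u, hu, rfl⟩
  have hsub : ∀ u ∈ level2 k j, embed2 u ∈ truncation forest2 k := fun u hu =>
    ⟨(hmem u hu).1, (hmem u hu).2.trans_le hj⟩
  have hhead : ∀ u ∈ level2 k j, ∀ a t, u = a :: t → a < 3 := by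
    rintro u ⟨⟨-, h⟩, -⟩ a t rfl
    rcases h with h | ⟨b, s, h, hb, -⟩
    · simp at h
    · simp only [List.cons.injEq] at h
      omega
  have hlen : ∀ {u v}, u ∈ level2 k j → v ∈ level2 k j → u.length = v.length := by
    intro u v hu hv
    have h1 := hu.2
    have h2 := hv.2
    omega
  refine separated_nodePoint_forest2 k _ (hsub u hu) _ (hsub v hv) _ (hsub w hw)
    (posTriple_of_lt (hmem u hu).1.1 (hmem v hv).1.1 (hmem w hw).1.1 ?_ ?_ ?_ ?_)
  · rw [length_embed2, length_embed2, hlen hu hv]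
  · rw [length_embed2, length_embed2, hlen hv hw]
  · exact embed2_lt (hlen hu hv) (hhead u hu) (hhead v hv) huv
  · exact embed2_lt (hlen hv hw) (hhead v hv) (hhead w hw) hvw

/-- The branches at the root of the three-branched tree go to `[0, 0]`, `[0, 1]`, `[1, 0]`. The
cyclic conditions with the third branch are, up to rotation, external triples at `[0]` if `z` is the
root label and internal triples at `[0]` otherwise. -/
theorem posTriple_branches {k : ℕ} {u c c' v w z : List ℕ}
    (h : ConsecutiveChildren (tree2 k) u c c') (hcv : embed2 c <+: v) (hcw : embed2 c' <+: w)
    (hz : z ∈ forest2) (hcz : ¬ embed2 c <+: z) (hcz' : ¬ embed2 c' <+: z) : PosTriple v w z := by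
  rcases h with ⟨rfl, rfl⟩ | ⟨hmem, h⟩
  · rw [embed2_append u (by norm_num)] at hcv hcw hcz hcz'
    exact .internal (embed2 u) v w z hcv hcw hcz hcz'
  have hu : u = [] := by
    obtain ⟨-, h | ⟨a, t, h, -, ht⟩⟩ := hmem
    · simp at h
    · rcases u with _ | ⟨b, u⟩
      · rfl
      · simp only [List.cons_append, List.cons.injEq] at h
        have := ht 2 (by rw [← h.2]; simp)
        omega
  subst hu
  have key : ¬ [0, 1] <+: z ∧ ¬ [1, 0] <+: z ∨ ¬ [1, 0] <+: z ∧ ¬ [0, 0] <+: z →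
      z = [0] ∨ [0, 0] <+: z ∨ [0, 1] <+: z := by
    intro h
    have h0 : [0] <+: z := hz.2.resolve_right (by tauto)
    by_cases h1 : [0, 0] <+: z
    · exact Or.inr (Or.inl h1)
    by_cases h2 : [0, 1] <+: z
    · exact Or.inr (Or.inr h2)
    exact Or.inl (eq_of_prefix_of_not_children hz.1 h0 h1 h2).symm
  have disj : ∀ {c d z : List ℕ}, c.length ≤ d.length → ¬ c <+: d → d <+: z → ¬ c <+: z :=
    fun hl hcd hd hc => hcd (List.prefix_of_prefix_length_le hc hd hl)
  rcases h with ⟨rfl, rfl⟩ | ⟨rfl, rfl⟩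
  · have e1 : embed2 ([] ++ [1]) = [0, 1] := rfl
    have e2 : embed2 ([] ++ [2]) = [1, 0] := rfl
    rw [e1] at hcv hcz
    rw [e2] at hcw hcz'
    have hw0 : ∀ {c : List ℕ}, c.length ≤ 2 → ¬ c <+: [1, 0] → ¬ c <+: w :=
      fun hl h => disj (d := [1, 0]) (by simpa using hl) h hcw
    rcases key (Or.inl ⟨hcz, hcz'⟩) with rfl | h | h
    · exact (PosTriple.right [0] v w hcv (hw0 (by simp) (by simp))).rotate
    · exact (PosTriple.internal [0] z v w h hcv (hw0 (by simp) (by simp))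
        (hw0 (by simp) (by simp))).rotate
    · exact absurd h hcz
  · have e1 : embed2 ([] ++ [2]) = [1, 0] := rfl
    have e2 : embed2 ([] ++ [0]) = [0, 0] := rfl
    rw [e1] at hcv hcz
    rw [e2] at hcw hcz'
    have hv0 : ∀ {c : List ℕ}, c.length ≤ 2 → ¬ c <+: [1, 0] → ¬ c <+: v :=
      fun hl h => disj (d := [1, 0]) (by simpa using hl) h hcv
    rcases key (Or.inr ⟨hcz, hcz'⟩) with rfl | h | h
    · exact (PosTriple.left [0] w v hcw (hv0 (by simp) (by simp))).rotate'
    · exact absurd h hcz'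
    · exact (PosTriple.internal [0] w z v hcw h (hv0 (by simp) (by simp))
        (hv0 (by simp) (by simp))).rotate'

theorem consecutiveChildren_ne_nil {N : Set (List ℕ)} {u c c' : List ℕ}
    (h : ConsecutiveChildren N u c c') : c ≠ [] ∧ c' ≠ [] := by
  rcases h with ⟨rfl, rfl⟩ | ⟨-, ⟨rfl, rfl⟩ | ⟨rfl, rfl⟩⟩ <;> simp

theorem internalSeparation_drawing2 {k : ℕ} (hk : 1 ≤ k) :
    InternalSeparation (tree2 k) (nodePoint k ∘ embed2) (drawing2 k) := by
  have hbij := bijOn_embed2 hk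
  intro u c c' h
  obtain ⟨hc, hc'⟩ := consecutiveChildren_ne_nil h
  rintro _ ⟨v, ⟨hv, hcv⟩, rfl⟩ _ ⟨w, ⟨hw, hcw⟩, rfl⟩ z' ⟨hz', hnot⟩
  rw [drawing2_eq] at hz'
  obtain ⟨z, hz, rfl⟩ := hz'
  obtain ⟨s, hs, rfl⟩ := hbij.surjOn hz
  refine separated_nodePoint_forest2 k _ (hbij.mapsTo hv) _ (hbij.mapsTo hw) _ hz
    (posTriple_branches h ((embed2_prefix hc v).2 hcv) ((embed2_prefix hc' w).2 hcw) hz.1 ?_ ?_)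
  · exact fun h => hnot (Or.inl ⟨s, ⟨hs, (embed2_prefix hc s).1 h⟩, rfl⟩)
  · exact fun h => hnot (Or.inr ⟨s, ⟨hs, (embed2_prefix hc' s).1 h⟩, rfl⟩)

theorem externalSeparation_drawing2 {k : ℕ} (hk : 1 ≤ k) :
    ExternalSeparation (tree2 k) (nodePoint k ∘ embed2) (drawing2 k) := by
  have hbij := bijOn_embed2 hk
  rintro u z' ⟨hz', hnot⟩
  rw [drawing2_eq] at hz'
  obtain ⟨z, hz, rfl⟩ := hz'
  obtain ⟨s, hs, rfl⟩ := hbij.surjOn hz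
  have hus : ¬ u <+: s := fun h => hnot ⟨s, ⟨hs, h⟩, rfl⟩
  have hu : u ≠ [] := by rintro rfl; simp at hus
  have hus' : ¬ embed2 u <+: embed2 s := by rwa [embed2_prefix hu]
  have huN : ∀ {v : List ℕ} {i : ℕ}, v ∈ tree2 k → u ++ [i] <+: v →
      embed2 u ∈ truncation forest2 k := by
    rintro v i ⟨hlen, hv⟩ h
    have hle := h.length_le
    simp only [List.length_append, List.length_singleton] at hle
    refine hbij.mapsTo ⟨by omega, Or.inr ?_⟩
    obtain ⟨a, t, rfl⟩ := List.exists_cons_of_ne_nil hu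
    rcases hv with rfl | ⟨b, r, rfl, hb, hr⟩
    · simp at h
    · simp only [List.cons_append, List.cons_prefix_cons] at h
      obtain ⟨rfl, h⟩ := h
      exact ⟨a, t, rfl, hb, binary_of_prefix (prefix_of_append_singleton_prefix h) hr⟩
  have hchild : ∀ {v : List ℕ} {i : ℕ}, i < 2 → u ++ [i] <+: v → embed2 u ++ [i] <+: embed2 v := by
    intro v i hi h
    rw [← embed2_append u hi]
    exact (embed2_prefix (by simp) v).2 h
  constructor
  · rintro _ ⟨v, ⟨hv, huv⟩, rfl⟩
    exact separated_nodePoint_forest2 k _ (hbij.mapsTo hv) _ (huN hv huv) _ hz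
      (.left _ _ _ (hchild (by norm_num) huv) hus')
  · rintro _ ⟨v, ⟨hv, huv⟩, rfl⟩
    exact separated_nodePoint_forest2 k _ (huN hv huv) _ (hbij.mapsTo hv) _ hz
      (.right _ _ _ (hchild (by norm_num) huv) hus')

/-! ## Integer representation of the corners -/

/-- The corner `(o + 2we, o, o + 2wf)`, in integers. -/
structure Item where
  ox : ℤ
  oy : ℤ
  ex : ℤ
  ey : ℤ
  fx : ℤ
  fy : ℤ
  w : ℤ

namespace Item

def child (a : Item) (i : ℕ) : Item :=
  if i = 0 then
    ⟨a.ox + 2 * (a.w / 5) * a.ex, a.oy + 2 * (a.w / 5) * a.ey, a.ex, a.ey,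
      a.fx - a.ex, a.fy - a.ey, a.w / 5⟩
  else
    ⟨a.ox + 2 * (a.w / 5) * a.fx, a.oy + 2 * (a.w / 5) * a.fy, a.ex - a.fx, a.ey - a.fy,
      a.fx, a.fy, a.w / 5⟩

/-- The first coordinate of the point of the node. -/
def px (a : Item) : ℤ := a.ox + (a.ex + a.fx) * ((a.w - 1) / 4)

/-- The second coordinate of the point of the node. -/
def py (a : Item) : ℤ := a.oy + (a.ey + a.fy) * ((a.w - 1) / 4)

/-- The fields in the order in which they are kept in the memory. -/
def field (a : Item) : ℕ → ℤ
  | 0 => a.ox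
  | 1 => a.oy
  | 2 => a.ex
  | 3 => a.ey
  | 4 => a.fx
  | 5 => a.fy
  | _ => a.w

noncomputable def toCorner (a : Item) : Corner :=
  ⟨(a.ox + 2 * a.w * a.ex, a.oy + 2 * a.w * a.ey), (a.ox, a.oy),
    (a.ox + 2 * a.w * a.fx, a.oy + 2 * a.w * a.fy)⟩

/-- The integer division by `5` is exact because `w` is a positive power of `5`. -/
theorem toCorner_child {a : Item} {n : ℕ} (hw : a.w = 5 ^ (n + 1)) (i : ℕ) :
    (a.child i).toCorner = childCorner a.toCorner i := by
  have h : (a.w : ℝ) = 5 * ((a.w / 5 : ℤ) : ℝ) := by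
    have : a.w = 5 * (a.w / 5) := (Int.mul_ediv_cancel' ⟨5 ^ n, by rw [hw, pow_succ']⟩).symm
    exact_mod_cast this
  by_cases hi : i = 0
  · simp only [child, hi, if_true, toCorner, childCorner, leftPoint, rightPoint,
      AffineMap.lineMap_apply, vsub_eq_sub, vadd_eq_add, Prod.mk_sub_mk, Prod.smul_mk,
      Prod.mk_add_mk, smul_eq_mul, Corner.mk.injEq, Prod.mk.injEq]
    generalize a.w / 5 = m at h ⊢
    push_cast [h]
    refine ⟨⟨?_, ?_⟩, ⟨?_, ?_⟩, ?_, ?_⟩ <;> ring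
  · simp only [child, hi, if_false, toCorner, childCorner, leftPoint, rightPoint,
      AffineMap.lineMap_apply, vsub_eq_sub, vadd_eq_add, Prod.mk_sub_mk, Prod.smul_mk,
      Prod.mk_add_mk, smul_eq_mul, Corner.mk.injEq, Prod.mk.injEq]
    generalize a.w / 5 = m at h ⊢
    push_cast [h]
    refine ⟨⟨?_, ?_⟩, ⟨?_, ?_⟩, ?_, ?_⟩ <;> ring

end Item

/-- The item of the node `u` in the construction with `k` levels. -/
def item (k : ℕ) (u : List ℕ) : Item := u.foldl Item.child ⟨0, 0, 0, 1, 1, 0, 5 ^ (k + 1)⟩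

theorem item_append_singleton (k : ℕ) (u : List ℕ) (i : ℕ) :
    item k (u ++ [i]) = (item k u).child i := by simp [item, List.foldl_append]

theorem Item.child_w (a : Item) (i : ℕ) : (a.child i).w = a.w / 5 := by
  unfold Item.child; split_ifs <;> rfl

theorem item_w {k : ℕ} {u : List ℕ} (hu : u.length ≤ k + 1) :
    (item k u).w = 5 ^ (k + 1 - u.length) := by
  induction u using List.reverseRecOn with
  | nil => rfl
  | append_singleton u i ih =>
    simp only [List.length_append, List.length_singleton] at hu ⊢
    rw [item_append_singleton, Item.child_w, ih (by omega),
      show k + 1 - u.length = (k + 1 - (u.length + 1)) + 1 by omega, pow_succ]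
    exact Int.mul_ediv_cancel _ (by norm_num)

theorem toCorner_item {k : ℕ} {u : List ℕ} (hu : u.length ≤ k + 1) :
    (item k u).toCorner = corner k u := by
  induction u using List.reverseRecOn with
  | nil => simp [item, corner, Item.toCorner, rootCorner]
  | append_singleton u i ih =>
    simp only [List.length_append, List.length_singleton] at hu
    rw [item_append_singleton, corner_append_singleton, ← ih (by omega),
      Item.toCorner_child (n := k - u.length)]
    rw [item_w (by omega), show k + 1 - u.length = k - u.length + 1 by omega]

/-- The factor `2` in the sides of the corner cancels the half of the midpoint, which leaves the
integer `(5 ^ n - 1) / 4` as coefficient. -/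
theorem nodePoint_eq_item {k : ℕ} {u : List ℕ} (hu : u.length ≤ k) :
    nodePoint k u = (((item k u).px : ℝ), ((item k u).py : ℝ)) := by
  have hw := item_w (k := k) (u := u) (by omega)
  set n := k + 1 - u.length with hn
  have h4 : (((5 ^ n - 1) / 4 : ℤ) : ℝ) = extent n * 5 ^ n := by
    obtain ⟨c, hc⟩ : (4 : ℤ) ∣ 5 ^ n - 1 := by simpa using sub_one_dvd_pow_sub_one (5 : ℤ) n
    rw [hc, Int.mul_ediv_cancel_left _ (by norm_num), extent_eq]
    have : ((5 : ℝ) ^ n - 1) = 4 * c := by exact_mod_cast hc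
    rw [this]; ring
  rw [nodePoint_eq hu, ← toCorner_item (by omega), ← hn]
  simp only [cornerPoint, Item.toCorner, Item.px, Item.py, hw, Prod.mk_sub_mk, Prod.smul_mk,
    Prod.mk_add_mk, smul_eq_mul, Prod.mk.injEq]
  push_cast [h4]
  constructor <;> ring

theorem isIntegerPoint_nodePoint {k : ℕ} {u : List ℕ} (hu : u.length ≤ k) :
    IsIntegerPoint (nodePoint k u) := ⟨_, _, nodePoint_eq_item hu⟩

/-! ### Size of the integers in the representation. -/

theorem abs_add_le_of_le {a b A B C : ℤ} (ha : |a| ≤ A) (hb : |b| ≤ B) (h : A + B ≤ C) :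
    |a + b| ≤ C := (abs_add_le a b).trans ((add_le_add ha hb).trans h)

theorem abs_sub_le_of_le {a b A B C : ℤ} (ha : |a| ≤ A) (hb : |b| ≤ B) (h : A + B ≤ C) :
    |a - b| ≤ C := (abs_sub a b).trans ((add_le_add ha hb).trans h)

theorem abs_mul_le_of_le {a b A B C : ℤ} (ha : |a| ≤ A) (hb : |b| ≤ B) (h : A * B ≤ C) :
    |a * b| ≤ C := by
  rw [abs_mul]
  exact (mul_le_mul ha hb (abs_nonneg _) ((abs_nonneg _).trans ha)).trans h

/-- Taking differences at most doubles the direction vectors in one level. The apex moves by at most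
`2 * 5 ^ (k - m) * 2 ^ m ≤ 2 * 5 ^ k` in a step from level `m`. -/
theorem abs_item_le {k : ℕ} {u : List ℕ} (hu : u.length ≤ k + 1) :
    (|(item k u).ex| ≤ 2 ^ u.length ∧ |(item k u).ey| ≤ 2 ^ u.length) ∧
    (|(item k u).fx| ≤ 2 ^ u.length ∧ |(item k u).fy| ≤ 2 ^ u.length) ∧
    |(item k u).ox| ≤ 2 * 5 ^ k * u.length ∧ |(item k u).oy| ≤ 2 * 5 ^ k * u.length := by
  induction u using List.reverseRecOn with
  | nil => simp [item]
  | append_singleton u i ih =>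
    simp only [List.length_append, List.length_singleton] at hu ⊢
    obtain ⟨⟨h1, h2⟩, ⟨h3, h4⟩, h5, h6⟩ := ih (by omega)
    have hw : (item k u).w / 5 = 5 ^ (k - u.length) := by
      rw [← Item.child_w _ 0, ← item_append_singleton, item_w (by simpa using hu)]
      simp
    have e1 : (2 : ℤ) ^ u.length + 2 ^ u.length ≤ 2 ^ (u.length + 1) := by rw [pow_succ]; linarith
    have e2 : (2 : ℤ) ^ u.length ≤ 2 ^ (u.length + 1) := by
      have : (0 : ℤ) < 2 ^ u.length := by positivity
      linarith
    have e3 : ∀ o x : ℤ, |o| ≤ 2 * 5 ^ k * u.length → |x| ≤ 2 ^ u.length →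
        |o + 2 * 5 ^ (k - u.length) * x| ≤ 2 * 5 ^ k * ((u.length + 1 : ℕ) : ℤ) := by
      intro o x ho hx
      refine abs_add_le_of_le ho (abs_mul_le_of_le (abs_of_nonneg (by positivity)).le hx le_rfl) ?_
      have : (5 : ℤ) ^ (k - u.length) * 2 ^ u.length ≤ 5 ^ k := by
        calc (5 : ℤ) ^ (k - u.length) * 2 ^ u.length ≤ 5 ^ (k - u.length) * 5 ^ u.length := by
              gcongr; norm_num
          _ = 5 ^ k := by rw [← pow_add, Nat.sub_add_cancel (by omega)]
      push_cast
      nlinarith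
    rw [item_append_singleton]
    by_cases hi : i = 0
    · simp only [Item.child, hi, if_true, hw]
      exact ⟨⟨h1.trans e2, h2.trans e2⟩,
        ⟨abs_sub_le_of_le h3 h1 e1, abs_sub_le_of_le h4 h2 e1⟩, e3 _ _ h5 h1, e3 _ _ h6 h2⟩
    · simp only [Item.child, hi, if_false, hw]
      exact ⟨⟨abs_sub_le_of_le h1 h3 e1, abs_sub_le_of_le h2 h4 e1⟩,
        ⟨h3.trans e2, h4.trans e2⟩, e3 _ _ h5 h3, e3 _ _ h6 h4⟩

/-- Level `k + 1` is included because the program also computes the children of the last level,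
which it never outputs. -/
theorem abs_field_item_le {k : ℕ} {u : List ℕ} (hu : u.length ≤ k + 1) (c : ℕ) :
    |(item k u).field c| ≤ 10 ^ (k + 1) := by
  obtain ⟨⟨h1, h2⟩, ⟨h3, h4⟩, h5, h6⟩ := abs_item_le hu
  have hk : ((k + 1 : ℕ) : ℤ) ≤ 2 ^ k := by exact_mod_cast Nat.lt_two_pow_self (n := k)
  have e1 : (2 : ℤ) ^ u.length ≤ 10 ^ (k + 1) :=
    (pow_le_pow_right₀ (by norm_num) hu).trans (pow_le_pow_left₀ (by norm_num) (by norm_num) _)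
  have e2 : (2 * 5 ^ k * u.length : ℤ) ≤ 10 ^ (k + 1) := by
    have h : (u.length : ℤ) ≤ 2 ^ k := le_trans (by exact_mod_cast hu) hk
    calc (2 * 5 ^ k * u.length : ℤ) ≤ 2 * 5 ^ k * 2 ^ k := by gcongr
      _ = 2 * 10 ^ k := by rw [mul_assoc, ← mul_pow]; norm_num
      _ ≤ 10 ^ (k + 1) := by
        rw [pow_succ]
        have : (0 : ℤ) < 10 ^ k := by positivity
        linarith
  have e3 : |(item k u).w| ≤ 10 ^ (k + 1) := by
    rw [item_w hu, abs_of_nonneg (by positivity)]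
    exact (pow_le_pow_right₀ (by norm_num) (by omega)).trans
      (pow_le_pow_left₀ (by norm_num) (by norm_num) _)
  unfold Item.field
  split
  exacts [h5.trans e2, h6.trans e2, h1.trans e1, h2.trans e1, h3.trans e1, h4.trans e1, e3]

/-! ## Enumeration of the nodes -/

/-- The nodes in the order in which they are processed, where `[0]` and `r` come first and the
children of the `j`-th node are at the positions `2j + 2` and `2j + 3`. -/
def enumNode (r : List ℕ) : ℕ → List ℕ
  | 0 => [0]
  | 1 => r
  | j + 2 => enumNode r (j / 2) ++ [j % 2]

theorem enumNode_zero (r : List ℕ) : enumNode r 0 = [0] := by rw [enumNode]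

theorem enumNode_one (r : List ℕ) : enumNode r 1 = r := by rw [enumNode]

theorem enumNode_left (r : List ℕ) (j : ℕ) : enumNode r (2 * j + 2) = enumNode r j ++ [0] := by
  rw [enumNode]; congr 2 <;> omega

theorem enumNode_right (r : List ℕ) (j : ℕ) : enumNode r (2 * j + 3) = enumNode r j ++ [1] := by
  rw [enumNode]; congr 2 <;> omega

/-- The first `2m + 2` nodes are the two initial ones and the children of the first `m`. Both
cardinalities `2 ^ (k + 1) - 2` and `3 * 2 ^ (k - 1) - 2` satisfy this recursion. -/
theorem enumNode_image_succ {r : List ℕ} {m : ℕ} {T T' : Set (List ℕ)}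
    (hT : enumNode r '' Set.Iio m = T)
    (hT' : ∀ u, u ∈ T' ↔ u = [0] ∨ u = r ∨ ∃ v ∈ T, ∃ i < 2, u = v ++ [i]) :
    enumNode r '' Set.Iio (2 * m + 2) = T' := by
  ext u
  rw [hT', ← hT]
  constructor
  · rintro ⟨j, hj, rfl⟩
    rcases j with _ | _ | j
    · exact Or.inl (enumNode_zero r)
    · exact Or.inr (Or.inl (enumNode_one r))
    · simp only [Set.mem_Iio] at hj
      exact Or.inr (Or.inr ⟨_, ⟨j / 2, by simp only [Set.mem_Iio]; omega, rfl⟩, j % 2,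
        Nat.mod_lt _ (by norm_num), by rw [enumNode]⟩)
  · rintro (rfl | rfl | ⟨_, ⟨j, hj, rfl⟩, i, hi, rfl⟩)
    · exact ⟨0, by simp, enumNode_zero r⟩
    · exact ⟨1, by simp, enumNode_one _⟩
    · simp only [Set.mem_Iio] at hj
      refine ⟨2 * j + 2 + i, by simp only [Set.mem_Iio]; omega, ?_⟩
      interval_cases i
      · exact enumNode_left r j
      · exact enumNode_right r j

theorem enumNode_image_forest1 (k : ℕ) :
    enumNode [1] '' Set.Iio (2 ^ (k + 1) - 2) = truncation forest1 k := by
  induction k with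
  | zero =>
    have : truncation forest1 0 = ∅ := by
      ext u
      simp only [truncation, forest1, Set.mem_ofPred_eq, Set.mem_empty_iff_false, iff_false]
      rintro ⟨⟨h, -⟩, hl⟩
      exact h (List.length_eq_zero_iff.1 (by omega))
    rw [this]
    simp
  | succ k ih =>
    have h2 : 2 ≤ 2 ^ (k + 1) := by rw [pow_succ]; have := Nat.one_le_two_pow (n := k); omega
    rw [show 2 ^ (k + 1 + 1) - 2 = 2 * (2 ^ (k + 1) - 2) + 2 by rw [pow_succ 2 (k + 1)]; omega]
    refine enumNode_image_succ ih fun u => ?_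
    constructor
    · rintro ⟨⟨hne, hu⟩, hlen⟩
      rcases List.eq_nil_or_concat u with rfl | ⟨v, i, rfl⟩
      · exact absurd rfl hne
      rw [List.concat_eq_append] at *
      have hi := hu i (by simp)
      rcases eq_or_ne v [] with rfl | hv
      · interval_cases i <;> simp
      · exact Or.inr (Or.inr ⟨v, ⟨⟨hv, fun j hj => hu j (by simp [hj])⟩, by simpa using hlen⟩,
          i, hi, rfl⟩)
    · rintro (rfl | rfl | ⟨v, ⟨hv, hlen⟩, i, hi, rfl⟩)
      · exact ⟨by simp [forest1], by simp⟩
      · exact ⟨by simp [forest1], by simp⟩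
      · exact ⟨isForest_forest1.append v hv i hi, by simpa using hlen⟩

/-- The first level has the single node `[0]`, so `[1, 0]` at position `1` is the first node of
length two, and every truncation of height at least one is an initial segment. -/
theorem enumNode_image_forest2 {k : ℕ} (hk : 1 ≤ k) :
    enumNode [1, 0] '' Set.Iio (3 * 2 ^ (k - 1) - 2) = truncation forest2 k := by
  induction k, hk using Nat.le_induction with
  | base =>
    ext u
    constructor
    · rintro ⟨j, hj, rfl⟩
      have : j = 0 := by simpa using hj
      subst this
      rw [enumNode_zero]
      exact ⟨isForest_forest2.zero_mem, by simp⟩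
    · rintro ⟨⟨-, ⟨t, rfl⟩ | ⟨t, rfl⟩⟩, hlen⟩
      · have : t = [] := List.length_eq_zero_iff.1 (by simpa using hlen)
        exact ⟨0, by simp, by simp [this, enumNode]⟩
      · simp at hlen
  | succ k hk ih =>
    have h2 : 1 ≤ 2 ^ (k - 1) := Nat.one_le_two_pow
    rw [show 3 * 2 ^ (k + 1 - 1) - 2 = 2 * (3 * 2 ^ (k - 1) - 2) + 2 by
      rw [show k + 1 - 1 = k - 1 + 1 by omega, pow_succ]; omega]
    refine enumNode_image_succ ih fun u => ?_
    constructor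
    · rintro ⟨⟨hu, hp⟩, hlen⟩
      rcases List.eq_nil_or_concat u with rfl | ⟨v, i, rfl⟩
      · simp at hp
      rw [List.concat_eq_append] at *
      have hi := hu i (by simp)
      rw [List.prefix_concat_iff, List.prefix_concat_iff] at hp
      have hv : [0] <+: v ∨ [1, 0] <+: v → ∃ v' ∈ truncation forest2 k, ∃ j < 2,
          v ++ [i] = v' ++ [j] := fun h =>
        ⟨v, ⟨⟨fun j hj => hu j (by simp [hj]), h⟩, by simpa using hlen⟩, i, hi, rfl⟩
      tauto
    · rintro (rfl | rfl | ⟨v, ⟨hv, hlen⟩, i, hi, rfl⟩)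
      · exact ⟨isForest_forest2.zero_mem, by simp⟩
      · exact ⟨by simp [forest2], by simpa using hk⟩
      · exact ⟨isForest_forest2.append v hv i hi, by simpa using hlen⟩

/-! ## Reasoning about random access machine programs -/

/-- The program halts within `t` steps, on words bounded by `W`, in a state that satisfies `Q`. -/
def Reaches (W : ℕ) (P : Program) (s : MachineState) (t : ℕ) (Q : MachineState → Prop) : Prop :=
  ∃ s' t', Exec W P s s' t' ∧ t' ≤ t ∧ Q s'

namespace Reaches

variable {W : ℕ} {P P' : Program} {s : MachineState} {t t' : ℕ} {Q Q' : MachineState → Prop}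

theorem mono (h : Reaches W P s t Q) (ht : t ≤ t') (hQ : ∀ s', Q s' → Q' s') :
    Reaches W P s t' Q' :=
  let ⟨s', u, he, hu, hq⟩ := h
  ⟨s', u, he, hu.trans ht, hQ s' hq⟩

theorem seq (h : Reaches W P s t Q) (h' : ∀ s', Q s' → Reaches W P' s' t' Q') :
    Reaches W (.seq P P') s (t + t') Q' := by
  obtain ⟨s', u, he, hu, hq⟩ := h
  obtain ⟨s'', u', he', hu', hq'⟩ := h' s' hq
  exact ⟨s'', u + u', .seq _ _ _ _ _ _ _ he he', by omega, hq'⟩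

theorem assign {r : ℕ} {op : Arith} {a b : Operand}
    (h : |op.eval (a.val s) (b.val s)| ≤ (W : ℤ)) :
    Reaches W (.assign r op a b) s 1
      (· = { s with reg := Function.update s.reg r (op.eval (a.val s) (b.val s)) }) :=
  ⟨_, 1, .assign s r op a b h, le_rfl, rfl⟩

theorem load {r : ℕ} {a : Operand} {x : ℕ} (hx : a.val s = x) (hW : x ≤ W) :
    Reaches W (.load r a) s 1 (· = { s with reg := Function.update s.reg r (s.mem x) }) :=
  ⟨_, 1, .load s r a (by omega) (by omega), le_rfl, by simp [hx]⟩

theorem store {a b : Operand} {x : ℕ} (hx : a.val s = x) (hW : x ≤ W)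
    (h : |b.val s| ≤ (W : ℤ)) :
    Reaches W (.store a b) s 1 (· = { s with mem := Function.update s.mem x (b.val s) }) :=
  ⟨_, 1, .store s a b (by omega) (by omega) h, le_rfl, by simp [hx]⟩

theorem ite {a b : Operand} (ht : a.val s < b.val s → Reaches W P s t Q)
    (hf : ¬ a.val s < b.val s → Reaches W P' s t Q) : Reaches W (.ite a b P P') s (t + 1) Q := by
  by_cases h : a.val s < b.val s
  · obtain ⟨s', u, he, hu, hq⟩ := ht h
    exact ⟨s', u + 1, .ite_true _ _ _ _ _ _ _ h he, by omega, hq⟩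
  · obtain ⟨s', u, he, hu, hq⟩ := hf h
    exact ⟨s', u + 1, .ite_false _ _ _ _ _ _ _ h he, by omega, hq⟩

/-- The invariant is indexed by the number of completed iterations, and `N` is the exact number of
iterations, so termination and running time come out together. -/
theorem loop {a b : Operand} {I : ℕ → MachineState → Prop} {N : ℕ}
    (hbody : ∀ i < N, ∀ s, I i s → a.val s < b.val s ∧ Reaches W P s t (I (i + 1)))
    (hend : ∀ s, I N s → ¬ a.val s < b.val s) (h0 : I 0 s) :
    Reaches W (.loop a b P) s (N * (t + 1) + 1) (I N) := by
  have key : ∀ m i, i + m = N → ∀ s, I i s →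
      Reaches W (.loop a b P) s (m * (t + 1) + 1) (I N) := by
    intro m
    induction m with
    | zero =>
      rintro i rfl s hs
      exact ⟨s, 1, .loop_false _ _ _ _ (hend s hs), by omega, hs⟩
    | succ m ih =>
      intro i hi s hs
      obtain ⟨hlt, s', u, he, hu, hq⟩ := hbody i (by omega) s hs
      obtain ⟨s'', u', he', hu', hq'⟩ := ih (i + 1) (by omega) s' hq
      refine ⟨s'', u + u' + 1, .loop_true _ _ _ _ _ _ _ _ hlt he he', ?_, hq'⟩
      rw [Nat.succ_mul]
      omega
  exact key N 0 (by omega) s h0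

end Reaches

/-- The assignment of the result of an operation to a register. -/
structure Assignment where
  r : ℕ
  op : Arith
  a : Operand
  b : Operand

namespace Assignment

def value (i : Assignment) (s : MachineState) : ℤ := i.op.eval (i.a.val s) (i.b.val s)

def run (i : Assignment) (s : MachineState) : MachineState :=
  { s with reg := Function.update s.reg i.r (i.value s) }

/-- The program that performs the assignments of a list. -/
def program : List Assignment → Program
  | [] => .skip
  | i :: l => .seq (.assign i.r i.op i.a i.b) (program l)

def runAll : List Assignment → MachineState → MachineState
  | [], s => s
  | i :: l, s => runAll l (i.run s)

/-- All the values that are assigned are bounded by `W`. -/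
def Safe (W : ℕ) : List Assignment → MachineState → Prop
  | [], _ => True
  | i :: l, s => |i.value s| ≤ (W : ℤ) ∧ Safe W l (i.run s)

theorem reaches {W : ℕ} {l : List Assignment} {s : MachineState} (h : Safe W l s) :
    Reaches W (program l) s l.length (· = runAll l s) := by
  induction l generalizing s with
  | nil => exact ⟨s, 0, .skip s, le_rfl, rfl⟩
  | cons i l ih =>
    rw [List.length_cons, add_comm]
    refine (Reaches.assign h.1).seq ?_
    rintro s' rfl
    exact ih h.2

end Assignment

/-- Load `m` consecutive words, from the address in the register `A` on, into the registers from
`D` on. -/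
def loadBlock (A T D : ℕ) : ℕ → Program
  | 0 => .skip
  | m + 1 => .seq (loadBlock A T D m)
      (.seq (.assign T .add (.reg A) (.const m)) (.load (D + m) (.reg T)))

/-- Store `m` consecutive registers, from `S` on, in the memory from the address in the
register `A` on. -/
def storeBlock (A T S : ℕ) : ℕ → Program
  | 0 => .skip
  | m + 1 => .seq (storeBlock A T S m)
      (.seq (.assign T .add (.reg A) (.const m)) (.store (.reg T) (.reg (S + m))))

theorem reaches_loadBlock {W A T D m b : ℕ} {s : MachineState} (hA : s.reg A = b) (hAT : A < T)
    (hTD : T < D) (hW : b + m ≤ W) :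
    Reaches W (loadBlock A T D m) s (2 * m) fun s' => s'.mem = s.mem ∧
      (∀ c < m, s'.reg (D + c) = s.mem (b + c)) ∧ ∀ r < T, s'.reg r = s.reg r := by
  induction m with
  | zero => exact ⟨s, 0, .skip s, le_rfl, rfl, by simp, fun _ _ => rfl⟩
  | succ m ih =>
    refine ((ih (by omega)).seq (t' := 1 + 1) fun s' ⟨hm, hr, hp⟩ => ?_).mono (by omega)
      fun _ h => h
    have hA' : s'.reg A = b := by rw [hp A hAT, hA]
    refine (Reaches.assign ?_).seq ?_
    · simp only [Arith.eval, Operand.val, hA']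
      rw [abs_of_nonneg (by positivity)]
      omega
    rintro s'' rfl
    refine (Reaches.load (x := b + m) ?_ (by omega)).mono le_rfl ?_
    · simp [Operand.val, Arith.eval, hA']
    rintro s'' rfl
    refine ⟨hm, fun c hc => ?_, fun r hrT => ?_⟩
    · rcases Nat.lt_succ_iff_lt_or_eq.1 hc with h | rfl
      · simp only
        rw [Function.update_of_ne (by omega), Function.update_of_ne (by omega), hr c h]
      · simp [hm]
    · simp only
      rw [Function.update_of_ne (by omega), Function.update_of_ne (by omega), hp r hrT]

theorem reaches_storeBlock {W A T S m b : ℕ} {s : MachineState} (hA : s.reg A = b) (hAT : A ≠ T)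
    (hTS : T < S) (hW : b + m ≤ W) (hb : ∀ c < m, |s.reg (S + c)| ≤ (W : ℤ)) :
    Reaches W (storeBlock A T S m) s (2 * m) fun s' =>
      (∀ c < m, s'.mem (b + c) = s.reg (S + c)) ∧
      (∀ x, x < b ∨ b + m ≤ x → s'.mem x = s.mem x) ∧ ∀ r ≠ T, s'.reg r = s.reg r := by
  induction m with
  | zero => exact ⟨s, 0, .skip s, le_rfl, by simp, fun _ _ => rfl, fun _ _ => rfl⟩
  | succ m ih =>
    refine ((ih (by omega) fun c hc => hb c (by omega)).seq (t' := 1 + 1)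
      fun s' ⟨hm, hx, hp⟩ => ?_).mono (by omega) fun _ h => h
    have hA' : s'.reg A = b := by rw [hp A hAT, hA]
    have hS : s'.reg (S + m) = s.reg (S + m) := hp _ (by omega)
    refine (Reaches.assign ?_).seq ?_
    · simp only [Arith.eval, Operand.val, hA']
      rw [abs_of_nonneg (by positivity)]
      omega
    rintro s'' rfl
    have hS' : Function.update s'.reg T (Arith.add.eval (Operand.val s' (.reg A))
        (Operand.val s' (.const m))) (S + m) = s.reg (S + m) := by
      rw [Function.update_of_ne (by omega), hS]
    refine (Reaches.store (x := b + m) ?_ (by omega) ?_).mono le_rfl ?_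
    · simp [Operand.val, Arith.eval, hA']
    · simp only [Operand.val] at hS' ⊢
      rw [hS']
      exact hb m (by omega)
    rintro s'' rfl
    simp only [Operand.val] at hS' ⊢
    refine ⟨fun c hc => ?_, fun x hx' => ?_, fun r hr => ?_⟩
    · rcases Nat.lt_succ_iff_lt_or_eq.1 hc with h | rfl
      · rw [Function.update_of_ne (by omega), hm c h]
      · rw [Function.update_self, hS']
    · rw [Function.update_of_ne (by omega), hx x (by omega)]
    · rw [Function.update_of_ne hr, hp r hr]

/-! ## The program -/

namespace Assignment

theorem runAll_mem (l : List Assignment) (s : MachineState) : (runAll l s).mem = s.mem := by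
  induction l generalizing s with
  | nil => rfl
  | cons i l ih => exact ih _

theorem runAll_reg_of_lt {l : List Assignment} {m r : ℕ} (h : ∀ i ∈ l, m ≤ i.r) (hr : r < m)
    (s : MachineState) : (runAll l s).reg r = s.reg r := by
  induction l generalizing s with
  | nil => rfl
  | cons i l ih =>
    rw [runAll, ih fun j hj => h j (by simp [hj])]
    have := h i (by simp)
    exact Function.update_of_ne (by omega) _ _

end Assignment

/-- The registers from `D` on hold the fields of an item. -/
def RegHolds (s : MachineState) (D : ℕ) (a : Item) : Prop := ∀ c < 7, s.reg (D + c) = a.field c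

/-- The memory cells from `b` on hold the fields of an item. -/
def MemHolds (s : MachineState) (b : ℕ) (a : Item) : Prop := ∀ c < 7, s.mem (b + c) = a.field c

theorem regHolds_iff {s : MachineState} {D : ℕ} {a : Item} :
    RegHolds s D a ↔ s.reg D = a.ox ∧ s.reg (D + 1) = a.oy ∧ s.reg (D + 2) = a.ex ∧
      s.reg (D + 3) = a.ey ∧ s.reg (D + 4) = a.fx ∧ s.reg (D + 5) = a.fy ∧
      s.reg (D + 6) = a.w := by
  constructor
  · intro h
    exact ⟨h 0 (by norm_num), h 1 (by norm_num), h 2 (by norm_num), h 3 (by norm_num),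
      h 4 (by norm_num), h 5 (by norm_num), h 6 (by norm_num)⟩
  · rintro ⟨h0, h1, h2, h3, h4, h5, h6⟩ c hc
    interval_cases c
    exacts [h0, h1, h2, h3, h4, h5, h6]

theorem RegHolds.of_eq {s s' : MachineState} {D m : ℕ} {a : Item} (h : RegHolds s D a)
    (hs : ∀ r < m, s'.reg r = s.reg r) (hm : D + 7 ≤ m) : RegHolds s' D a :=
  fun c hc => (hs _ (by omega)).trans (h c hc)

/-! ### Straight-line blocks and the loop body. -/

def pointAssignments : List Assignment :=
  [⟨20, .div, .reg 16, .const 5⟩, ⟨21, .mul, .const 2, .reg 20⟩, ⟨22, .sub, .reg 16, .const 1⟩,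
    ⟨23, .div, .reg 22, .const 4⟩, ⟨24, .add, .reg 12, .reg 14⟩, ⟨25, .mul, .reg 24, .reg 23⟩,
    ⟨26, .add, .reg 10, .reg 25⟩, ⟨27, .add, .reg 13, .reg 15⟩, ⟨28, .mul, .reg 27, .reg 23⟩,
    ⟨29, .add, .reg 11, .reg 28⟩]

/-- The current item is in registers `10` to `16`, and `w / 5` and its double are in `20` and `21`.
The left child goes to registers `30` to `36`; adding `0` is a copy, and `37` and `38` are scratch.
-/
def leftAssignments : List Assignment :=
  [⟨37, .mul, .reg 21, .reg 12⟩, ⟨30, .add, .reg 10, .reg 37⟩, ⟨38, .mul, .reg 21, .reg 13⟩,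
    ⟨31, .add, .reg 11, .reg 38⟩, ⟨32, .add, .reg 12, .const 0⟩, ⟨33, .add, .reg 13, .const 0⟩,
    ⟨34, .sub, .reg 14, .reg 12⟩, ⟨35, .sub, .reg 15, .reg 13⟩, ⟨36, .add, .reg 20, .const 0⟩]

def rightAssignments : List Assignment :=
  [⟨47, .mul, .reg 21, .reg 14⟩, ⟨40, .add, .reg 10, .reg 47⟩, ⟨48, .mul, .reg 21, .reg 15⟩,
    ⟨41, .add, .reg 11, .reg 48⟩, ⟨42, .sub, .reg 12, .reg 14⟩, ⟨43, .sub, .reg 13, .reg 15⟩,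
    ⟨44, .add, .reg 14, .const 0⟩, ⟨45, .add, .reg 15, .const 0⟩, ⟨46, .add, .reg 20, .const 0⟩]

/-- Memory begins with `2n` output cells, followed by items of seven cells each. Registers `50` and
`51` address the output of item `i`, and `54` and `55` the items `2i + 2` and `2i + 3`. -/
def addressAssignments : List Assignment :=
  [⟨50, .mul, .const 2, .reg 3⟩, ⟨51, .add, .reg 50, .const 1⟩, ⟨52, .mul, .const 2, .reg 6⟩,
    ⟨53, .add, .reg 52, .const 14⟩, ⟨54, .add, .reg 53, .reg 5⟩, ⟨55, .add, .reg 54, .const 7⟩]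

theorem abs_ediv_le {a b M : ℤ} (ha : |a| ≤ M) : |a / b| ≤ M :=
  (Int.abs_ediv_le_abs a b).trans ha

theorem Item.abs_px_le {a : Item} {M : ℤ} (hM : 1 ≤ M) (ha : ∀ c, |a.field c| ≤ M) :
    |a.px| ≤ 5 * M ^ 2 := by
  have c1 : |a.w - 1| ≤ 2 * M := abs_sub_le_of_le (ha 6) (by simpa using hM) (by linarith)
  have c2 : |a.ex + a.fx| ≤ 2 * M := abs_add_le_of_le (ha 2) (ha 4) (by linarith)
  exact abs_add_le_of_le (ha 0) (abs_mul_le_of_le c2 (abs_ediv_le c1) le_rfl) (by nlinarith)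

theorem Item.abs_py_le {a : Item} {M : ℤ} (hM : 1 ≤ M) (ha : ∀ c, |a.field c| ≤ M) :
    |a.py| ≤ 5 * M ^ 2 := by
  have c1 : |a.w - 1| ≤ 2 * M := abs_sub_le_of_le (ha 6) (by simpa using hM) (by linarith)
  have c2 : |a.ey + a.fy| ≤ 2 * M := abs_add_le_of_le (ha 3) (ha 5) (by linarith)
  exact abs_add_le_of_le (ha 1) (abs_mul_le_of_le c2 (abs_ediv_le c1) le_rfl) (by nlinarith)

theorem reaches_pointAssignments {W : ℕ} {s : MachineState} {a : Item} {M : ℤ} (hM : 1 ≤ M)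
    (hW : 10 * M ^ 2 ≤ W) (ha : ∀ c, |a.field c| ≤ M) (hs : RegHolds s 10 a) :
    Reaches W (Assignment.program pointAssignments) s 10 fun s' => s'.mem = s.mem ∧
      s'.reg 26 = a.px ∧ s'.reg 29 = a.py ∧ s'.reg 20 = a.w / 5 ∧ s'.reg 21 = 2 * (a.w / 5) ∧
      ∀ r < 20, s'.reg r = s.reg r := by
  obtain ⟨h0, h1, h2, h3, h4, h5, h6⟩ := regHolds_iff.1 hs
  simp only [Nat.reduceAdd] at h0 h1 h2 h3 h4 h5 h6
  have b2 : |a.ex| ≤ M := ha 2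
  have b3 : |a.ey| ≤ M := ha 3
  have b4 : |a.fx| ≤ M := ha 4
  have b5 : |a.fy| ≤ M := ha 5
  have b6 : |a.w| ≤ M := ha 6
  have hMM : M ≤ M ^ 2 := by nlinarith
  have c1 : |a.w / 5| ≤ M := abs_ediv_le b6
  have c2 : |2 * (a.w / 5)| ≤ 2 * M := abs_mul_le_of_le (by norm_num) c1 le_rfl
  have c3 : |a.w - 1| ≤ 2 * M := abs_sub_le_of_le b6 (by simpa using hM) (by linarith)
  have c4 : |(a.w - 1) / 4| ≤ 2 * M := abs_ediv_le c3
  have c5 : |a.ex + a.fx| ≤ 2 * M := abs_add_le_of_le b2 b4 (by linarith)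
  have c6 : |(a.ex + a.fx) * ((a.w - 1) / 4)| ≤ 4 * M ^ 2 := abs_mul_le_of_le c5 c4 (by nlinarith)
  have c8 : |a.ey + a.fy| ≤ 2 * M := abs_add_le_of_le b3 b5 (by linarith)
  have c9 : |(a.ey + a.fy) * ((a.w - 1) / 4)| ≤ 4 * M ^ 2 := abs_mul_le_of_le c8 c4 (by nlinarith)
  have hsafe : Assignment.Safe W pointAssignments s := by
    simp only [Assignment.Safe, pointAssignments, Assignment.run, Assignment.value, Arith.eval,
      Operand.val, Function.update_apply, h0, h1, h2, h3, h4, h5, h6, and_true,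
      Nat.reduceEqDiff, if_false, if_true]
    refine ⟨?_, ?_, ?_, ?_, ?_, ?_, ?_, ?_, ?_, ?_⟩
    exacts [c1.trans (by linarith), c2.trans (by linarith), c3.trans (by linarith),
      c4.trans (by linarith), c5.trans (by linarith), c6.trans (by linarith),
      (Item.abs_px_le hM ha).trans (by linarith), c8.trans (by linarith), c9.trans (by linarith),
      (Item.abs_py_le hM ha).trans (by linarith)]
  refine (Assignment.reaches hsafe).mono le_rfl ?_
  rintro s' rfl
  refine ⟨Assignment.runAll_mem _ _, ?_, ?_, ?_, ?_, fun r hr => Assignment.runAll_reg_of_lt (m := 20)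
    (by simp [pointAssignments]) hr s⟩
  all_goals
    simp only [Assignment.runAll, pointAssignments, Assignment.run, Assignment.value, Arith.eval,
      Operand.val, Function.update_apply, h0, h1, h2, h3, h4, h5, h6,
      Nat.reduceEqDiff, if_false, if_true, Item.px, Item.py]

theorem reaches_leftAssignments {W : ℕ} {s : MachineState} {a : Item} {M : ℤ} (hM : 1 ≤ M)
    (hW : 10 * M ^ 2 ≤ W) (ha : ∀ c, |a.field c| ≤ M) (hs : RegHolds s 10 a)
    (h20 : s.reg 20 = a.w / 5) (h21 : s.reg 21 = 2 * (a.w / 5)) :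
    Reaches W (Assignment.program leftAssignments) s 9 fun s' => s'.mem = s.mem ∧
      RegHolds s' 30 (a.child 0) ∧ ∀ r < 30, s'.reg r = s.reg r := by
  obtain ⟨h0, h1, h2, h3, h4, h5, -⟩ := regHolds_iff.1 hs
  simp only [Nat.reduceAdd] at h0 h1 h2 h3 h4 h5
  have b0 : |a.ox| ≤ M := ha 0
  have b1 : |a.oy| ≤ M := ha 1
  have b2 : |a.ex| ≤ M := ha 2
  have b3 : |a.ey| ≤ M := ha 3
  have b4 : |a.fx| ≤ M := ha 4
  have b5 : |a.fy| ≤ M := ha 5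
  have hMM : M ≤ M ^ 2 := by nlinarith
  have c1 : |a.w / 5| ≤ M := abs_ediv_le (ha 6)
  have c2 : |2 * (a.w / 5)| ≤ 2 * M := abs_mul_le_of_le (by norm_num) c1 le_rfl
  have c3 : |2 * (a.w / 5) * a.ex| ≤ 2 * M ^ 2 := abs_mul_le_of_le c2 b2 (by nlinarith)
  have c4 : |2 * (a.w / 5) * a.ey| ≤ 2 * M ^ 2 := abs_mul_le_of_le c2 b3 (by nlinarith)
  have hsafe : Assignment.Safe W leftAssignments s := by
    simp only [Assignment.Safe, leftAssignments, Assignment.run, Assignment.value, Arith.eval,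
      Operand.val, Function.update_apply, h0, h1, h2, h3, h4, h5, h20, h21, and_true,
      Nat.reduceEqDiff, if_false, if_true, add_zero]
    refine ⟨?_, ?_, ?_, ?_, ?_, ?_, ?_, ?_, ?_⟩
    exacts [c3.trans (by linarith), abs_add_le_of_le b0 c3 (by linarith), c4.trans (by linarith),
      abs_add_le_of_le b1 c4 (by linarith), b2.trans (by linarith), b3.trans (by linarith),
      abs_sub_le_of_le b4 b2 (by linarith), abs_sub_le_of_le b5 b3 (by linarith),
      c1.trans (by linarith)]
  refine (Assignment.reaches hsafe).mono le_rfl ?_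
  rintro s' rfl
  refine ⟨Assignment.runAll_mem _ _, ?_, fun r hr => Assignment.runAll_reg_of_lt (m := 30)
    (by simp [leftAssignments]) hr s⟩
  rw [regHolds_iff]
  simp only [Assignment.runAll, leftAssignments, Assignment.run, Assignment.value, Arith.eval,
    Operand.val, Function.update_apply, h0, h1, h2, h3, h4, h5, h20, h21, and_true, Nat.reduceAdd,
    Nat.reduceEqDiff, if_false, if_true, add_zero, Item.child]

theorem reaches_rightAssignments {W : ℕ} {s : MachineState} {a : Item} {M : ℤ} (hM : 1 ≤ M)
    (hW : 10 * M ^ 2 ≤ W) (ha : ∀ c, |a.field c| ≤ M) (hs : RegHolds s 10 a)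
    (h20 : s.reg 20 = a.w / 5) (h21 : s.reg 21 = 2 * (a.w / 5)) :
    Reaches W (Assignment.program rightAssignments) s 9 fun s' => s'.mem = s.mem ∧
      RegHolds s' 40 (a.child 1) ∧ ∀ r < 40, s'.reg r = s.reg r := by
  obtain ⟨h0, h1, h2, h3, h4, h5, -⟩ := regHolds_iff.1 hs
  simp only [Nat.reduceAdd] at h0 h1 h2 h3 h4 h5
  have b0 : |a.ox| ≤ M := ha 0
  have b1 : |a.oy| ≤ M := ha 1
  have b2 : |a.ex| ≤ M := ha 2
  have b3 : |a.ey| ≤ M := ha 3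
  have b4 : |a.fx| ≤ M := ha 4
  have b5 : |a.fy| ≤ M := ha 5
  have hMM : M ≤ M ^ 2 := by nlinarith
  have c1 : |a.w / 5| ≤ M := abs_ediv_le (ha 6)
  have c2 : |2 * (a.w / 5)| ≤ 2 * M := abs_mul_le_of_le (by norm_num) c1 le_rfl
  have c3 : |2 * (a.w / 5) * a.fx| ≤ 2 * M ^ 2 := abs_mul_le_of_le c2 b4 (by nlinarith)
  have c4 : |2 * (a.w / 5) * a.fy| ≤ 2 * M ^ 2 := abs_mul_le_of_le c2 b5 (by nlinarith)
  have hsafe : Assignment.Safe W rightAssignments s := by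
    simp only [Assignment.Safe, rightAssignments, Assignment.run, Assignment.value, Arith.eval,
      Operand.val, Function.update_apply, h0, h1, h2, h3, h4, h5, h20, h21, and_true,
      Nat.reduceEqDiff, if_false, if_true, add_zero]
    refine ⟨?_, ?_, ?_, ?_, ?_, ?_, ?_, ?_, ?_⟩
    exacts [c3.trans (by linarith), abs_add_le_of_le b0 c3 (by linarith), c4.trans (by linarith),
      abs_add_le_of_le b1 c4 (by linarith), abs_sub_le_of_le b2 b4 (by linarith),
      abs_sub_le_of_le b3 b5 (by linarith), b4.trans (by linarith), b5.trans (by linarith),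
      c1.trans (by linarith)]
  refine (Assignment.reaches hsafe).mono le_rfl ?_
  rintro s' rfl
  refine ⟨Assignment.runAll_mem _ _, ?_, fun r hr => Assignment.runAll_reg_of_lt (m := 40)
    (by simp [rightAssignments]) hr s⟩
  rw [regHolds_iff]
  simp only [Assignment.runAll, rightAssignments, Assignment.run, Assignment.value, Arith.eval,
    Operand.val, Function.update_apply, h0, h1, h2, h3, h4, h5, h20, h21, and_true, Nat.reduceAdd,
    Nat.reduceEqDiff, if_false, if_true, add_zero, Item.child, one_ne_zero]

theorem reaches_addressAssignments {W n i : ℕ} {s : MachineState} (hW : 21 * n + 30 ≤ W)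
    (hi : i < n) (h3 : s.reg 3 = i) (h5 : s.reg 5 = 2 * n) (h6 : s.reg 6 = 7 * i) :
    Reaches W (Assignment.program addressAssignments) s 6 fun s' => s'.mem = s.mem ∧
      s'.reg 50 = ((2 * i : ℕ) : ℤ) ∧ s'.reg 51 = ((2 * i + 1 : ℕ) : ℤ) ∧
      s'.reg 54 = ((2 * n + 7 * (2 * i + 2) : ℕ) : ℤ) ∧
      s'.reg 55 = ((2 * n + 7 * (2 * i + 3) : ℕ) : ℤ) ∧ ∀ r < 50, s'.reg r = s.reg r := by
  have hsafe : Assignment.Safe W addressAssignments s := by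
    simp only [Assignment.Safe, addressAssignments, Assignment.run, Assignment.value, Arith.eval,
      Operand.val, Function.update_apply, h3, h5, h6, and_true,
      Nat.reduceEqDiff, if_false, if_true]
    refine ⟨?_, ?_, ?_, ?_, ?_, ?_⟩ <;> rw [abs_of_nonneg (by positivity)] <;> omega
  refine (Assignment.reaches hsafe).mono le_rfl ?_
  rintro s' rfl
  refine ⟨Assignment.runAll_mem _ _, ?_, ?_, ?_, ?_, fun r hr => Assignment.runAll_reg_of_lt (m := 50)
    (by simp [addressAssignments]) hr s⟩
  all_goals
    simp only [Assignment.runAll, addressAssignments, Assignment.run, Assignment.value, Arith.eval,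
      Operand.val, Function.update_apply, h3, h5, h6,
      Nat.reduceEqDiff, if_false, if_true]
    push_cast
    ring

/-- Output the point of the item whose number is in register `3`, and append the two children of
the item to the list of items. -/
def bodyProgram : Program :=
  .seq (Assignment.program [⟨6, .mul, .const 7, .reg 3⟩, ⟨7, .add, .reg 6, .reg 5⟩]) <|
  .seq (loadBlock 7 8 10 7) <|
  .seq (Assignment.program pointAssignments) <|
  .seq (Assignment.program leftAssignments) <|
  .seq (Assignment.program rightAssignments) <|
  .seq (Assignment.program addressAssignments) <|
  .seq (.store (.reg 50) (.reg 26)) <|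
  .seq (.store (.reg 51) (.reg 29)) <|
  .seq (storeBlock 54 8 30 7) <|
  .seq (storeBlock 55 8 40 7) <|
  .assign 3 .add (.reg 3) (.const 1)

/-- Since `i < n`, the output stays below cell `2n`. The children are written from item `2i + 2` on,
so the pending items `i + 1` to `2i + 1` are unaffected. -/
theorem reaches_bodyProgram {W n i : ℕ} {s : MachineState} {a : Item} {M : ℤ} (hM : 1 ≤ M)
    (hW : 10 * M ^ 2 ≤ W) (hW' : 21 * n + 30 ≤ W) (ha : ∀ c, |a.field c| ≤ M)
    (ha0 : ∀ c, |(a.child 0).field c| ≤ M) (ha1 : ∀ c, |(a.child 1).field c| ≤ M)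
    (hi : i < n) (h3 : s.reg 3 = i) (h5 : s.reg 5 = 2 * n) (hmem : MemHolds s (2 * n + 7 * i) a) :
    Reaches W bodyProgram s 81 fun s' =>
      s'.reg 0 = s.reg 0 ∧ s'.reg 3 = ((i + 1 : ℕ) : ℤ) ∧ s'.reg 5 = 2 * n ∧
      s'.mem (2 * i) = a.px ∧ s'.mem (2 * i + 1) = a.py ∧
      MemHolds s' (2 * n + 7 * (2 * i + 2)) (a.child 0) ∧
      MemHolds s' (2 * n + 7 * (2 * i + 3)) (a.child 1) ∧
      ∀ x, x ≠ 2 * i → x ≠ 2 * i + 1 → x < 2 * n + 7 * (2 * i + 2) → s'.mem x = s.mem x := by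
  have hMM : M ≤ M ^ 2 := by nlinarith
  unfold bodyProgram
  -- One summand for each block of `bodyProgram`; their sum is `81`.
  refine Reaches.mono (t := 2 + (2 * 7 + (10 + (9 + (9 + (6 + (1 + (1 + (2 * 7 + (2 * 7 + 1))))))))))
    ?_ (by norm_num) (fun _ h => h)
  refine (Assignment.reaches ?_).seq ?_
  · simp only [Assignment.Safe, Assignment.run, Assignment.value, Arith.eval,
      Operand.val, Function.update_apply, h3, h5, and_true,
      Nat.reduceEqDiff, if_false, if_true]
    refine ⟨?_, ?_⟩ <;> rw [abs_of_nonneg (by positivity)] <;> omega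
  intro s1 e1
  have m1 : s1.mem = s.mem := by rw [e1]; exact Assignment.runAll_mem _ _
  have r1 : ∀ r < 6, s1.reg r = s.reg r := fun r hr => by
    rw [e1]; exact Assignment.runAll_reg_of_lt (m := 6) (by simp) hr s
  have r16 : s1.reg 6 = 7 * i := by
    simp [e1, Assignment.runAll, Assignment.run, Assignment.value, Arith.eval, Operand.val, h3]
  have r17 : s1.reg 7 = ((2 * n + 7 * i : ℕ) : ℤ) := by
    simp [e1, Assignment.runAll, Assignment.run, Assignment.value, Arith.eval, Operand.val, h3, h5]
    ring
  clear e1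
  refine (reaches_loadBlock r17 (by norm_num) (by norm_num) (by omega)).seq ?_
  rintro s2 ⟨m2, l2, r2⟩
  rw [m1] at m2 l2
  have q2 : RegHolds s2 10 a := fun c hc => (l2 c hc).trans (hmem c hc)
  refine (reaches_pointAssignments hM hW ha q2).seq ?_
  rintro s3 ⟨m3, x3, y3, w3, d3, r3⟩
  rw [m2] at m3
  have q3 := q2.of_eq r3 (by norm_num)
  refine (reaches_leftAssignments hM hW ha q3 w3 d3).seq ?_
  rintro s4 ⟨m4, c4, r4⟩
  rw [m3] at m4
  refine (reaches_rightAssignments hM hW ha (q3.of_eq r4 (by norm_num))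
    ((r4 _ (by norm_num)).trans w3) ((r4 _ (by norm_num)).trans d3)).seq ?_
  rintro s5 ⟨m5, c5, r5⟩
  rw [m4] at m5
  have p5 : ∀ r < 8, s5.reg r = s1.reg r := fun r hr => by
    rw [r5 r (by omega), r4 r (by omega), r3 r (by omega), r2 r (by omega)]
  refine (reaches_addressAssignments hW' hi ((p5 3 (by norm_num)).trans ((r1 3 (by norm_num)).trans h3))
    ((p5 5 (by norm_num)).trans ((r1 5 (by norm_num)).trans h5))
    ((p5 6 (by norm_num)).trans r16)).seq ?_
  rintro s6 ⟨m6, x6, y6, a6, b6, r6⟩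
  rw [m5] at m6
  have p6 : ∀ r < 6, s6.reg r = s.reg r := fun r hr => by
    rw [r6 r (by omega), p5 r (by omega), r1 r hr]
  have x6' : s6.reg 26 = a.px := by
    rw [r6 _ (by norm_num), r5 _ (by norm_num), r4 _ (by norm_num), x3]
  have y6' : s6.reg 29 = a.py := by
    rw [r6 _ (by norm_num), r5 _ (by norm_num), r4 _ (by norm_num), y3]
  have c6 : RegHolds s6 30 (a.child 0) := (c4.of_eq r5 (by norm_num)).of_eq r6 (by norm_num)
  have d6 : RegHolds s6 40 (a.child 1) := c5.of_eq r6 (by norm_num)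
  refine (Reaches.store (x := 2 * i) ?_ (by omega) ?_).seq ?_
  · simp only [Operand.val, x6]
  · simp only [Operand.val, x6']
    exact (Item.abs_px_le hM ha).trans (by linarith)
  intro s7 e7
  have m7 : s7.mem = Function.update s.mem (2 * i) a.px := by
    rw [e7]; simp only [Operand.val, x6', m6]
  have r7 : s7.reg = s6.reg := by rw [e7]
  clear e7
  refine (Reaches.store (x := 2 * i + 1) ?_ (by omega) ?_).seq ?_
  · simp only [Operand.val, r7, y6]
  · simp only [Operand.val, r7, y6']
    exact (Item.abs_py_le hM ha).trans (by linarith)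
  intro s8 e8
  have m8 : s8.mem = Function.update (Function.update s.mem (2 * i) a.px) (2 * i + 1) a.py := by
    rw [e8]; simp only [Operand.val, r7, y6', m7]
  have r8 : s8.reg = s6.reg := by rw [e8, r7]
  clear e8
  refine (reaches_storeBlock (b := 2 * n + 7 * (2 * i + 2)) (by rw [r8, a6]) (by norm_num)
    (by norm_num) (by omega) ?_).seq ?_
  · intro c hc
    rw [r8, c6 c hc]
    exact (ha0 c).trans (by linarith)
  rintro s9 ⟨l9, m9, r9⟩
  rw [r8] at l9 r9
  refine (reaches_storeBlock (b := 2 * n + 7 * (2 * i + 3)) (by rw [r9 _ (by norm_num), b6])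
    (by norm_num) (by norm_num) (by omega) ?_).seq ?_
  · intro c hc
    rw [r9 _ (by omega), d6 c hc]
    exact (ha1 c).trans (by linarith)
  rintro s10 ⟨l10, m10, r10⟩
  have p10 : ∀ r < 6, s10.reg r = s.reg r := fun r hr => by
    rw [r10 r (by omega), r9 r (by omega), p6 r hr]
  refine (Reaches.assign ?_).mono le_rfl ?_
  · simp only [Operand.val, Arith.eval, p10 3 (by norm_num), h3]
    rw [abs_of_nonneg (by positivity)]
    omega
  rintro s' rfl
  simp only [Operand.val, Arith.eval, p10 3 (by norm_num), h3]
  have hlow : ∀ x < 2 * n + 7 * (2 * i + 2), s10.mem x = s8.mem x := fun x hx => by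
    rw [m10 x (by omega), m9 x (by omega)]
  refine ⟨?_, by simp, ?_, ?_, ?_, fun c hc => ?_, fun c hc => ?_, fun x h1 h2 hx => ?_⟩
  · rw [Function.update_of_ne (by norm_num), p10 0 (by norm_num)]
  · rw [Function.update_of_ne (by norm_num), p10 5 (by norm_num), h5]
  · rw [hlow _ (by omega), m8, Function.update_of_ne (by omega), Function.update_self]
  · rw [hlow _ (by omega), m8, Function.update_self]
  · simp only
    rw [m10 _ (by omega), l9 c hc, c6 c hc]
  · simp only
    rw [l10 c hc, r9 _ (by omega), d6 c hc]
  · rw [hlow x hx, m8, Function.update_of_ne h2, Function.update_of_ne h1]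

/-! ### Initialization, main loop and running time. -/

def startAssignments : List Assignment :=
  [⟨1, .add, .const 2, .const 0⟩, ⟨2, .add, .const 1, .const 0⟩, ⟨4, .add, .reg 0, .const 2⟩,
    ⟨5, .mul, .const 2, .reg 0⟩, ⟨6, .add, .reg 5, .const 7⟩]

def doublingAssignments : List Assignment :=
  [⟨1, .mul, .const 2, .reg 1⟩, ⟨2, .mul, .const 5, .reg 2⟩]

/-- The items of the two children of the root. -/
def rootAssignments : List Assignment :=
  [⟨30, .add, .const 0, .const 0⟩, ⟨31, .mul, .const 2, .reg 2⟩, ⟨32, .add, .const 0, .const 0⟩,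
    ⟨33, .add, .const 1, .const 0⟩, ⟨34, .add, .const 1, .const 0⟩,
    ⟨35, .add, .const (-1), .const 0⟩, ⟨36, .add, .reg 2, .const 0⟩,
    ⟨40, .mul, .const 2, .reg 2⟩, ⟨41, .add, .const 0, .const 0⟩,
    ⟨42, .add, .const (-1), .const 0⟩, ⟨43, .add, .const 1, .const 0⟩,
    ⟨44, .add, .const 1, .const 0⟩, ⟨45, .add, .const 0, .const 0⟩, ⟨46, .add, .reg 2, .const 0⟩]

/-- Replace the item of `[1]` by the item of `[1, 0]`. -/
def grandchildAssignments : List Assignment :=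
  [⟨47, .div, .reg 2, .const 5⟩, ⟨48, .mul, .const 2, .reg 47⟩, ⟨40, .sub, .reg 31, .reg 48⟩,
    ⟨41, .add, .reg 48, .const 0⟩, ⟨44, .add, .const 2, .const 0⟩,
    ⟨45, .add, .const (-1), .const 0⟩, ⟨46, .add, .reg 47, .const 0⟩]

/-- The program that computes the drawing with `n` points. -/
def drawingProgram : Program :=
  .seq (Assignment.program startAssignments) <|
  .seq (.loop (.reg 1) (.reg 4) (Assignment.program doublingAssignments)) <|
  .seq (Assignment.program rootAssignments) <|
  .seq (.ite (.reg 4) (.reg 1) (Assignment.program grandchildAssignments) .skip) <|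
  .seq (storeBlock 5 8 30 7) <|
  .seq (storeBlock 6 8 40 7) <|
  .loop (.reg 3) (.reg 0) bodyProgram

theorem item_zero (k : ℕ) : item k [0] = ⟨0, 2 * 5 ^ k, 0, 1, 1, -1, 5 ^ k⟩ := by
  have : (5 : ℤ) ^ (k + 1) / 5 = 5 ^ k := by
    rw [pow_succ]; exact Int.mul_ediv_cancel _ (by norm_num)
  simp [item, Item.child, this]

theorem item_one (k : ℕ) : item k [1] = ⟨2 * 5 ^ k, 0, -1, 1, 1, 0, 5 ^ k⟩ := by
  have : (5 : ℤ) ^ (k + 1) / 5 = 5 ^ k := by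
    rw [pow_succ]; exact Int.mul_ediv_cancel _ (by norm_num)
  simp [item, Item.child, this]

theorem item_one_zero (k : ℕ) : item k [1, 0] =
    ⟨2 * 5 ^ k - 2 * (5 ^ k / 5), 2 * (5 ^ k / 5), -1, 1, 2, -1, 5 ^ k / 5⟩ := by
  have : item k [1, 0] = (item k [1]).child 0 := item_append_singleton k [1] 0
  rw [this, item_one]
  simp [Item.child]
  ring

/-- For both types `2 ^ k < n + 2 ≤ 2 ^ (k + 1)`, so the loop recovers the number of layers
implicitly: it stops after `k` rounds with `5 ^ k` in register `2`. -/
theorem reaches_doubling {W n k : ℕ} {s : MachineState} (hlow : ∀ i < k, 2 ^ (i + 1) < n + 2)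
    (hup : n + 2 ≤ 2 ^ (k + 1)) (hW : 2 * (n + 2) ≤ W) (hW' : 5 ^ k ≤ W) (h1 : s.reg 1 = 2)
    (h2 : s.reg 2 = 1) (h4 : s.reg 4 = n + 2) :
    Reaches W (.loop (.reg 1) (.reg 4) (Assignment.program doublingAssignments)) s
      (k * (2 + 1) + 1) fun s' => s'.reg 1 = 2 ^ (k + 1) ∧ s'.reg 2 = 5 ^ k ∧ s'.mem = s.mem ∧
        ∀ r, r ≠ 1 → r ≠ 2 → s'.reg r = s.reg r := by
  refine Reaches.loop (I := fun i s' => s'.reg 1 = 2 ^ (i + 1) ∧ s'.reg 2 = 5 ^ i ∧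
    s'.mem = s.mem ∧ ∀ r, r ≠ 1 → r ≠ 2 → s'.reg r = s.reg r) ?_ ?_ ?_
  · rintro i hi s' ⟨g1, g2, gm, gr⟩
    have g4 : s'.reg 4 = n + 2 := by rw [gr 4 (by norm_num) (by norm_num), h4]
    have hlt : (2 : ℤ) ^ (i + 1) < n + 2 := by exact_mod_cast hlow i hi
    have hpow : (5 : ℤ) * 5 ^ i ≤ W := by
      have : 5 * 5 ^ i ≤ W := by
        rw [← pow_succ']
        exact (Nat.pow_le_pow_right (by norm_num) hi).trans hW'
      exact_mod_cast this
    refine ⟨by simpa only [Operand.val, g1, g4], (Assignment.reaches ?_).mono le_rfl ?_⟩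
    · simp only [Assignment.Safe, doublingAssignments, Assignment.run, Assignment.value, Arith.eval,
        Operand.val, Function.update_apply, g1, g2, and_true, Nat.reduceEqDiff, if_false]
      refine ⟨?_, ?_⟩ <;> rw [abs_of_nonneg (by positivity)]
      · have : (2 : ℤ) * (n + 2) ≤ W := by exact_mod_cast hW
        linarith
      · exact hpow
    · rintro s'' rfl
      refine ⟨?_, ?_, (Assignment.runAll_mem _ _).trans gm, fun r hr1 hr2 => ?_⟩
      · simp [Assignment.runAll, doublingAssignments, Assignment.run, Assignment.value, Arith.eval,
          Operand.val, g1]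
        ring
      · simp [Assignment.runAll, doublingAssignments, Assignment.run, Assignment.value, Arith.eval,
          Operand.val, g2]
        ring
      · rw [← gr r hr1 hr2]
        simp [Assignment.runAll, doublingAssignments, Assignment.run, hr1, hr2]
  · rintro s' ⟨g1, -, -, gr⟩
    have g4 : s'.reg 4 = n + 2 := by rw [gr 4 (by norm_num) (by norm_num), h4]
    simp only [Operand.val, g1, g4, not_lt]
    exact_mod_cast hup
  · exact ⟨by simpa using h1, by simpa using h2, rfl, fun _ _ _ => rfl⟩

theorem reaches_rootAssignments {W k : ℕ} {s : MachineState} (hW : 2 * 5 ^ k ≤ W)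
    (h2 : s.reg 2 = 5 ^ k) :
    Reaches W (Assignment.program rootAssignments) s 14 fun s' => s'.mem = s.mem ∧
      RegHolds s' 30 (item k [0]) ∧ RegHolds s' 40 (item k [1]) ∧
      ∀ r < 30, s'.reg r = s.reg r := by
  have hW' : (2 : ℤ) * 5 ^ k ≤ W := by exact_mod_cast hW
  have h5 : (1 : ℤ) ≤ 5 ^ k := one_le_pow₀ (by norm_num)
  have hsafe : Assignment.Safe W rootAssignments s := by
    simp only [Assignment.Safe, rootAssignments, Assignment.run, Assignment.value, Arith.eval,
      Operand.val, Function.update_apply, h2, and_true, Nat.reduceEqDiff, if_false, add_zero]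
    refine ⟨?_, ?_, ?_, ?_, ?_, ?_, ?_, ?_, ?_, ?_, ?_, ?_, ?_, ?_⟩ <;> rw [abs_le] <;>
      constructor <;> linarith
  refine (Assignment.reaches hsafe).mono le_rfl ?_
  rintro s' rfl
  refine ⟨Assignment.runAll_mem _ _, ?_, ?_, fun r hr => Assignment.runAll_reg_of_lt (m := 30)
    (by simp [rootAssignments]) hr s⟩
  all_goals
    rw [regHolds_iff]
    simp only [Assignment.runAll, rootAssignments, Assignment.run, Assignment.value, Arith.eval,
      Operand.val, Function.update_apply, h2, and_true, Nat.reduceEqDiff, if_false, if_true,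
      Nat.reduceAdd, add_zero, item_zero, item_one]

theorem reaches_grandchildAssignments {W k : ℕ} {s : MachineState} (hW : 2 * 5 ^ k ≤ W)
    (h2 : s.reg 2 = 5 ^ k) (h0 : RegHolds s 30 (item k [0])) (h1 : RegHolds s 40 (item k [1])) :
    Reaches W (Assignment.program grandchildAssignments) s 7 fun s' => s'.mem = s.mem ∧
      RegHolds s' 40 (item k [1, 0]) ∧ ∀ r < 40, s'.reg r = s.reg r := by
  have hW' : (2 : ℤ) * 5 ^ k ≤ W := by exact_mod_cast hW
  have h5 : (1 : ℤ) ≤ 5 ^ k := one_le_pow₀ (by norm_num)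
  have h6 : (0 : ℤ) ≤ 5 ^ k / 5 := by positivity
  have h7 : (5 : ℤ) ^ k / 5 ≤ 5 ^ k := Int.ediv_le_self _ (by positivity)
  have h31 : s.reg 31 = 2 * 5 ^ k := by rw [h0 1 (by norm_num), item_zero]; rfl
  have h42 : s.reg 42 = -1 := by rw [h1 2 (by norm_num), item_one]; rfl
  have h43 : s.reg 43 = 1 := by rw [h1 3 (by norm_num), item_one]; rfl
  have hsafe : Assignment.Safe W grandchildAssignments s := by
    simp only [Assignment.Safe, grandchildAssignments, Assignment.run, Assignment.value, Arith.eval,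
      Operand.val, Function.update_apply, h2, h31, and_true, Nat.reduceEqDiff, if_false, if_true,
      add_zero]
    refine ⟨?_, ?_, ?_, ?_, ?_, ?_, ?_⟩ <;> rw [abs_le] <;> constructor <;> linarith
  refine (Assignment.reaches hsafe).mono le_rfl ?_
  rintro s' rfl
  refine ⟨Assignment.runAll_mem _ _, ?_, fun r hr => Assignment.runAll_reg_of_lt (m := 40)
    (by simp [grandchildAssignments]) hr s⟩
  rw [regHolds_iff]
  simp only [Assignment.runAll, grandchildAssignments, Assignment.run, Assignment.value, Arith.eval,
    Operand.val, Function.update_apply, h2, h31, h42, h43, and_true, Nat.reduceEqDiff, if_false,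
    if_true, Nat.reduceAdd, add_zero, item_one_zero]

/-- The items form a queue. After `i` rounds the points before position `i` are written and the
items `i` to `2i + 1` are present; one round consumes item `i` and appends two. -/
theorem reaches_mainLoop {W n k : ℕ} {r : List ℕ} {s : MachineState}
    (hlen : ∀ j < n, (enumNode r j).length ≤ k) (hW : 10 * (10 ^ (k + 1)) ^ 2 ≤ W)
    (hW' : 21 * n + 30 ≤ W) (h0 : s.reg 0 = n) (h3 : s.reg 3 = 0) (h5 : s.reg 5 = 2 * n)
    (hm0 : MemHolds s (2 * n) (item k [0])) (hm1 : MemHolds s (2 * n + 7) (item k r)) :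
    Reaches W (.loop (.reg 3) (.reg 0) bodyProgram) s (n * (81 + 1) + 1) fun s' =>
      ∀ j < n, s'.mem (2 * j) = (item k (enumNode r j)).px ∧
        s'.mem (2 * j + 1) = (item k (enumNode r j)).py := by
  refine (Reaches.loop (N := n) (I := fun i s' => s'.reg 0 = n ∧ s'.reg 3 = i ∧ s'.reg 5 = 2 * n ∧
    (∀ j < i, s'.mem (2 * j) = (item k (enumNode r j)).px ∧
      s'.mem (2 * j + 1) = (item k (enumNode r j)).py) ∧
    ∀ j, i ≤ j → j < 2 * i + 2 → MemHolds s' (2 * n + 7 * j) (item k (enumNode r j)))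
    ?_ ?_ ?_).mono le_rfl fun s' hs' => hs'.2.2.2.1
  · rintro i hi s' ⟨g0, g3, g5, gout, gmem⟩
    refine ⟨by simpa only [Operand.val, g0, g3, Nat.cast_lt], ?_⟩
    have hl := hlen i hi
    refine (reaches_bodyProgram (M := 10 ^ (k + 1)) (one_le_pow₀ (by norm_num))
      (by exact_mod_cast hW) hW' (abs_field_item_le (by omega)) ?_ ?_ hi g3 g5
      (gmem i le_rfl (by omega))).mono le_rfl ?_
    · rw [← item_append_singleton]
      exact abs_field_item_le (by simpa using hl)
    · rw [← item_append_singleton]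
      exact abs_field_item_le (by simpa using hl)
    rintro s'' ⟨e0, e3, e5, ex, ey, el, er, eo⟩
    rw [← item_append_singleton, ← enumNode_left] at el
    rw [← item_append_singleton, ← enumNode_right] at er
    refine ⟨e0.trans g0, e3, e5, fun j hj => ?_, fun j hj1 hj2 => ?_⟩
    · rcases Nat.lt_succ_iff_lt_or_eq.1 hj with h | rfl
      · rw [eo _ (by omega) (by omega) (by omega), eo _ (by omega) (by omega) (by omega)]
        exact gout j h
      · exact ⟨ex, ey⟩
    · rcases lt_trichotomy j (2 * i + 2) with h | rfl | h
      · intro c hc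
        rw [eo _ (by omega) (by omega) (by omega)]
        exact gmem j (by omega) h c hc
      · exact el
      · obtain rfl : j = 2 * i + 3 := by omega
        exact er
  · rintro s' ⟨g0, g3, -⟩
    simp only [Operand.val, g0, g3, lt_self_iff_false, not_false_eq_true]
  · refine ⟨h0, by simpa using h3, h5, by simp, fun j _ hj => ?_⟩
    interval_cases j
    · rw [enumNode_zero]; exact hm0
    · rw [enumNode_one]; exact hm1

theorem reaches_drawingProgram {W n k : ℕ} {r : List ℕ}
    (hr : r = [1] ∧ n + 2 = 2 ^ (k + 1) ∨ r = [1, 0] ∧ 1 ≤ k ∧ n + 2 = 3 * 2 ^ (k - 1))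
    (hlen : ∀ j < n, (enumNode r j).length ≤ k) (hW : 10 * (10 ^ (k + 1)) ^ 2 ≤ W)
    (hW' : 21 * n + 30 ≤ W) :
    Reaches W drawingProgram (inputState n) (3 * k + 82 * n + 58) fun s' =>
      ∀ j < n, s'.mem (2 * j) = (item k (enumNode r j)).px ∧
        s'.mem (2 * j + 1) = (item k (enumNode r j)).py := by
  have hpow : ∀ i < k, 2 ^ (i + 1) ≤ 2 ^ k := fun i hi => Nat.pow_le_pow_right (by norm_num) hi
  have hk0 : 0 < 2 ^ k := by positivity
  have hlow : ∀ i < k, 2 ^ (i + 1) < n + 2 := by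
    intro i hi
    refine (hpow i hi).trans_lt ?_
    rcases hr with ⟨-, h⟩ | ⟨-, h1, h⟩
    · rw [h, pow_succ]; omega
    · rw [h, show k = k - 1 + 1 by omega, pow_succ, Nat.add_sub_cancel]
      have : 0 < 2 ^ (k - 1) := by positivity
      omega
  have hup : n + 2 ≤ 2 ^ (k + 1) := by
    rcases hr with ⟨-, h⟩ | ⟨-, h1, h⟩
    · exact h.le
    · rw [h, show k + 1 = k - 1 + 2 by omega, pow_add]
      omega
  -- For `k = 1` the item of `[1, 0]` is stored although its point is not output, so length `k + 1`
  -- has to be allowed.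
  have hrlen : r.length ≤ k + 1 := by
    rcases hr with ⟨rfl, -⟩ | ⟨rfl, h, -⟩ <;> simp
    exact h
  have hM : 10 ^ (k + 1) ≤ 10 * (10 ^ (k + 1)) ^ 2 := by
    have : 1 ≤ 10 ^ (k + 1) := Nat.one_le_pow _ _ (by norm_num)
    nlinarith
  have h5W : 2 * 5 ^ k ≤ W := by
    have : 5 ^ k ≤ 10 ^ k := Nat.pow_le_pow_left (by norm_num) k
    have : 10 ^ (k + 1) = 10 * 10 ^ k := pow_succ' _ _
    omega
  have hitem : ∀ u : List ℕ, u.length ≤ k + 1 → ∀ c, |(item k u).field c| ≤ (W : ℤ) :=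
    fun u hu c => (abs_field_item_le hu c).trans (by exact_mod_cast hM.trans hW)
  unfold drawingProgram
  refine Reaches.mono (t := 5 + ((k * (2 + 1) + 1) + (14 + ((7 + 1) + (2 * 7 + (2 * 7 +
    (n * (81 + 1) + 1))))))) ?_ (by omega) (fun _ h => h)
  refine (Assignment.reaches ?_).seq ?_
  · simp only [Assignment.Safe, startAssignments, Assignment.run, Assignment.value, Arith.eval,
      Operand.val, Function.update_apply, inputState, and_true, Nat.reduceEqDiff, if_false, if_true,
      OfNat.zero_ne_ofNat, zero_ne_one]
    refine ⟨?_, ?_, ?_, ?_, ?_⟩ <;> rw [abs_of_nonneg (by positivity)] <;> omega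
  intro s1 e1
  have f0 : s1.reg 0 = n := by rw [e1]; rfl
  have f1 : s1.reg 1 = 2 := by rw [e1]; rfl
  have f2 : s1.reg 2 = 1 := by rw [e1]; rfl
  have f3 : s1.reg 3 = 0 := by rw [e1]; rfl
  have f4 : s1.reg 4 = n + 2 := by rw [e1]; rfl
  have f5 : s1.reg 5 = 2 * n := by rw [e1]; rfl
  have f6 : s1.reg 6 = 2 * n + 7 := by rw [e1]; rfl
  clear e1
  refine (reaches_doubling hlow hup (by omega) (by omega) f1 f2 f4).seq ?_
  rintro s2 ⟨g1, g2, -, gr⟩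
  have p2 : ∀ r, 2 < r → s2.reg r = s1.reg r := fun r h => gr r (by omega) (by omega)
  refine (reaches_rootAssignments h5W g2).seq ?_
  rintro s3 ⟨-, i0, i1, p3⟩
  -- After the doubling loop, `n + 2 < 2 ^ (k + 1)` holds for type 2 and equality for type 1, so
  -- this test selects the second initial node.
  have hite : Reaches W (.ite (.reg 4) (.reg 1) (Assignment.program grandchildAssignments) .skip) s3
      (7 + 1) fun s' => RegHolds s' 40 (item k r) ∧ ∀ r < 40, s'.reg r = s3.reg r := by
    have e4 : Operand.val s3 (.reg 4) = n + 2 := by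
      simp only [Operand.val]; rw [p3 4 (by norm_num), p2 4 (by norm_num), f4]
    have e1 : Operand.val s3 (.reg 1) = 2 ^ (k + 1) := by
      simp only [Operand.val]; rw [p3 1 (by norm_num), g1]
    refine Reaches.ite (fun h => ?_) (fun h => ?_)
    · rw [e4, e1] at h
      have h' : n + 2 < 2 ^ (k + 1) := by exact_mod_cast h
      obtain rfl : r = [1, 0] := by
        rcases hr with ⟨-, h⟩ | ⟨h, -⟩
        · omega
        · exact h
      exact (reaches_grandchildAssignments h5W ((p3 2 (by norm_num)).trans g2) i0 i1).mono le_rfl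
        fun _ h => h.2
    · rw [e4, e1] at h
      have h' : ¬ n + 2 < 2 ^ (k + 1) := by exact_mod_cast h
      obtain rfl : r = [1] := by
        rcases hr with ⟨h, -⟩ | ⟨-, h1, h⟩
        · exact h
        · have e : 2 ^ (k + 1) = 2 ^ (k - 1) * 2 ^ 2 := by rw [← pow_add]; congr 1; omega
          have : 0 < 2 ^ (k - 1) := by positivity
          omega
      exact ⟨s3, 0, .skip _, by norm_num, i1, fun _ _ => rfl⟩
  refine hite.seq ?_
  rintro s4 ⟨j1, p4⟩
  have p4' : ∀ r, 2 < r → r < 30 → s4.reg r = s1.reg r := fun r h h' => by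
    rw [p4 r (by omega), p3 r h', p2 r h]
  have q0 : s4.reg 0 = n := by
    rw [p4 0 (by norm_num), p3 0 (by norm_num), gr 0 (by norm_num) (by norm_num), f0]
  have q3 := (p4' 3 (by norm_num) (by norm_num)).trans f3
  have q5 := (p4' 5 (by norm_num) (by norm_num)).trans f5
  have q6 := (p4' 6 (by norm_num) (by norm_num)).trans f6
  have j0 : RegHolds s4 30 (item k [0]) := i0.of_eq p4 (by norm_num)
  refine (reaches_storeBlock (b := 2 * n) (by rw [q5]; push_cast; ring) (by norm_num) (by norm_num)
    (by omega) fun c hc => ?_).seq ?_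
  · rw [j0 c hc]
    exact hitem _ (by simp) c
  rintro s5 ⟨l5, m5, r5⟩
  refine (reaches_storeBlock (b := 2 * n + 7) (by rw [r5 _ (by norm_num), q6]; push_cast; ring)
    (by norm_num) (by norm_num) (by omega) fun c hc => ?_).seq ?_
  · rw [r5 _ (by omega), j1 c hc]
    exact hitem _ hrlen c
  rintro s6 ⟨l6, m6, r6⟩
  have r6' : ∀ r < 8, s6.reg r = s4.reg r := fun r h => by rw [r6 r (by omega), r5 r (by omega)]
  refine reaches_mainLoop hlen hW hW' ?_ ?_ ?_ ?_ ?_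
  · rw [r6' 0 (by norm_num), q0]
  · rw [r6' 3 (by norm_num), q3]
  · rw [r6' 5 (by norm_num), q5]
  · intro c hc
    rw [m6 _ (by omega), l5 c hc, j0 c hc]
  · intro c hc
    rw [l6 c hc, r5 _ (by omega), j1 c hc]

/-- The program computes the drawing in linear time, on words of logarithmic length. -/
theorem exec_drawingProgram {n k : ℕ} {r : List ℕ} {T : Set (List ℕ)}
    (hr : r = [1] ∧ n + 2 = 2 ^ (k + 1) ∨ r = [1, 0] ∧ 1 ≤ k ∧ n + 2 = 3 * 2 ^ (k - 1))
    (hT : enumNode r '' Set.Iio n = truncation T k) :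
    ∃ s t, Exec (256000 * (n + 1) ^ 8) drawingProgram (inputState n) s t ∧
      t ≤ 256000 * (n + 1) ∧ outputPoints n s = nodePoint k '' truncation T k := by
  have hlen : ∀ j < n, (enumNode r j).length ≤ k := fun j hj =>
    (hT.subset ⟨j, hj, rfl⟩ : enumNode r j ∈ truncation T k).2
  have h2k : 2 ^ k ≤ n + 2 := by
    rcases hr with ⟨-, h⟩ | ⟨-, h1, h⟩
    · rw [h, pow_succ]; omega
    · rw [h, show k = k - 1 + 1 by omega, pow_succ, Nat.add_sub_cancel]; omega
  have hk : k < 2 ^ k := Nat.lt_two_pow_self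
  -- The bound `10 ≤ 2 ^ 4` turns the exponential into a fourth power of `2 ^ k ≤ n + 2 ≤ 2 (n +
  -- 1)`. Squaring and the factor `10` then give `10 * 160 ^ 2 = 256000` and the exponent `8`.
  have h10 : 10 ^ (k + 1) ≤ 160 * (n + 1) ^ 4 := by
    calc 10 ^ (k + 1) = 10 * 10 ^ k := pow_succ' _ _
      _ ≤ 10 * 16 ^ k := by gcongr; norm_num
      _ = 10 * (2 ^ k) ^ 4 := by rw [← pow_mul, mul_comm k, pow_mul]; norm_num
      _ ≤ 10 * (2 * (n + 1)) ^ 4 := by gcongr; omega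
      _ = 160 * (n + 1) ^ 4 := by ring
  have hW : 10 * (10 ^ (k + 1)) ^ 2 ≤ 256000 * (n + 1) ^ 8 := by
    calc 10 * (10 ^ (k + 1)) ^ 2 ≤ 10 * (160 * (n + 1) ^ 4) ^ 2 := by gcongr
      _ = 256000 * (n + 1) ^ 8 := by ring
  have hW' : 21 * n + 30 ≤ 256000 * (n + 1) ^ 8 := by
    have : n + 1 ≤ (n + 1) ^ 8 := Nat.le_self_pow (by norm_num) _
    omega
  obtain ⟨s, t, he, ht, hs⟩ := reaches_drawingProgram hr hlen hW hW'
  refine ⟨s, t, he, by omega, ?_⟩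
  rw [← hT, Set.image_image]
  ext p
  constructor
  · rintro ⟨j, hj, rfl⟩
    refine ⟨j, hj, ?_⟩
    dsimp only
    rw [nodePoint_eq_item (hlen j hj), (hs j hj).1, (hs j hj).2]
  · rintro ⟨j, hj, rfl⟩
    refine ⟨j, hj, ?_⟩
    dsimp only
    rw [nodePoint_eq_item (hlen j hj), (hs j hj).1, (hs j hj).2]

/-! ### The grid bound and the conclusion. -/

theorem five_pow_le_rpow {j n : ℕ} (h : 2 ^ j ≤ n) : (5 : ℝ) ^ j ≤ (n : ℝ) ^ Real.logb 2 5 := by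
  calc (5 : ℝ) ^ j = ((2 : ℝ) ^ Real.logb 2 5) ^ j := by
        rw [Real.rpow_logb (by norm_num) (by norm_num) (by norm_num)]
    _ = ((2 : ℝ) ^ j) ^ Real.logb 2 5 := by
        rw [← Real.rpow_natCast, ← Real.rpow_natCast, ← Real.rpow_mul (by norm_num),
          ← Real.rpow_mul (by norm_num), mul_comm]
    _ ≤ (n : ℝ) ^ Real.logb 2 5 := Real.rpow_le_rpow (by positivity) (by exact_mod_cast h)
        (Real.logb_nonneg (by norm_num) (by norm_num))

/-- A set with a separated labeling has the order type of the construction, whose points lie on a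
small grid and are computed in linear time. -/
theorem isDrawing_and_computable {X : Set Plane} {x : List ℕ → Plane} {r : List ℕ} {k : ℕ}
    (T : Set (List ℕ)) (hT : T ⊆ forest1) (hx : Set.BijOn x (truncation T k) X)
    (hs : Separated (truncation T k) x)
    (hr : r = [1] ∧ X.ncard + 2 = 2 ^ (k + 1) ∨
      r = [1, 0] ∧ 1 ≤ k ∧ X.ncard + 2 = 3 * 2 ^ (k - 1))
    (hn : enumNode r '' Set.Iio X.ncard = truncation T k) :
    IsDrawing (nodePoint k '' truncation T k) X ∧
    (∀ p ∈ nodePoint k '' truncation T k, |p.1| ≤ 50 * (X.ncard : ℝ) ^ Real.logb 2 5 ∧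
      |p.2| ≤ 50 * (X.ncard : ℝ) ^ Real.logb 2 5) ∧
    ∃ s t, Exec (256000 * (X.ncard + 1) ^ 8) drawingProgram (inputState X.ncard) s t ∧
      t ≤ 256000 * (X.ncard + 1) ∧ outputPoints X.ncard s = nodePoint k '' truncation T k := by
  have hsub : truncation T k ⊆ truncation forest1 k := fun u hu => ⟨hT hu.1, hu.2⟩
  refine ⟨⟨?_, ?_⟩, ?_, exec_drawingProgram hr hn⟩
  · rintro _ ⟨u, hu, rfl⟩
    exact isIntegerPoint_nodePoint hu.2
  · exact hs.sameOrderType ((separated_nodePoint k).mono hsub) (fun u hu => (hsub hu).1.2) hx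
      ((injOn_nodePoint k).mono hsub).bijOn_image
  · rintro _ ⟨u, hu, rfl⟩
    obtain ⟨j, rfl⟩ : ∃ j, k = j + 1 := by
      have : u.length ≠ 0 := fun h => (hsub hu).1.1 (List.length_eq_zero_iff.1 h)
      have := hu.2
      exact ⟨k - 1, by omega⟩
    -- With `k = j + 1`, the coordinate bound is `2 * 5 ^ (k + 1) = 50 * 5 ^ j`, which is where the
    -- constant `50` comes from.
    have hj : 2 ^ j ≤ X.ncard := by
      have : 1 ≤ 2 ^ j := Nat.one_le_two_pow
      rcases hr with ⟨-, h⟩ | ⟨-, -, h⟩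
      · rw [pow_succ, pow_succ] at h; omega
      · rw [Nat.add_sub_cancel] at h; omega
    have hle : (2 : ℝ) * 5 ^ (j + 1 + 1) ≤ 50 * (X.ncard : ℝ) ^ Real.logb 2 5 := by
      have := five_pow_le_rpow hj
      rw [pow_succ, pow_succ]
      linarith
    have := abs_nodePoint_le (hsub hu)
    exact ⟨this.1.trans hle, this.2.trans hle⟩

end NestedDrawing

theorem mainTheorem3 :
    -- the construction, for every number `k` of layers
    (∀ k : ℕ,
      -- the auxiliary points are in convex position, counterclockwise from left to right
      (∀ u ∈ level1 (k + 1) (k + 1), ∀ v ∈ level1 (k + 1) (k + 1), ∀ w ∈ level1 (k + 1) (k + 1),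
        u < v → v < w → 0 < orient (leafPoint k u) (leafPoint k v) (leafPoint k w)) ∧
      (drawing1 k).ncard = 2 ^ (k + 1) - 2 ∧
      (∀ p ∈ drawing1 k, IsIntegerPoint p ∧
        |p.1| ≤ 2 * 5 ^ (k + 1) ∧ |p.2| ≤ 2 * 5 ^ (k + 1)) ∧
      IsTypeOneLabeling k (nodePoint k) (drawing1 k) ∧
      IsNestedLabeling (level1 k) (nodePoint k) (drawing1 k) ∧
      InternalSeparation (tree1 k \ {[]}) (nodePoint k) (drawing1 k) ∧
      ExternalSeparation (tree1 k \ {[]}) (nodePoint k) (drawing1 k) ∧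
      IsNestedAlmostConvex (drawing1 k)) ∧
    -- the subset used for type 2
    (∀ k : ℕ, 1 ≤ k →
      drawing2 k ⊆ drawing1 k ∧
      (drawing2 k).ncard = 3 * 2 ^ (k - 1) - 2 ∧
      IsTypeTwoLabeling k (nodePoint k ∘ embed2) (drawing2 k) ∧
      IsNestedLabeling (level2 k) (nodePoint k ∘ embed2) (drawing2 k) ∧
      InternalSeparation (tree2 k) (nodePoint k ∘ embed2) (drawing2 k) ∧
      ExternalSeparation (tree2 k) (nodePoint k ∘ embed2) (drawing2 k) ∧
      IsNestedAlmostConvex (drawing2 k)) ∧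
    -- every nested almost convex set has such a drawing, on a small grid, found in linear time
    (∃ (C : ℝ) (P : Program) (K d : ℕ), ∀ X : Set Plane, IsNestedAlmostConvex X →
      ∃ D : Set Plane,
        IsDrawing D X ∧
        (∀ p ∈ D, |p.1| ≤ C * (X.ncard : ℝ) ^ Real.logb 2 5 ∧
          |p.2| ≤ C * (X.ncard : ℝ) ^ Real.logb 2 5) ∧
        ((IsTypeOne X ∧ X.ncard = 2 ^ (numLayers X + 1) - 2 ∧ D = drawing1 (numLayers X)) ∨
          (IsTypeTwo X ∧ X.ncard = 3 * 2 ^ (numLayers X - 1) - 2 ∧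
            D = drawing2 (numLayers X))) ∧
        ∃ (s : MachineState) (t : ℕ),
          Exec (K * (X.ncard + 1) ^ d) P (inputState X.ncard) s t ∧
          t ≤ K * (X.ncard + 1) ∧
          outputPoints X.ncard s = D) := by
  refine ⟨fun k => ?_, fun k hk => ?_, 50, drawingProgram, 256000, 8, fun X hX => ?_⟩
  · refine ⟨fun u hu v hv w hw => leafPoint_orient_pos hu hv hw, (typeOne_drawing1 k).2,
      fun p hp => ?_, ⟨numLayers_drawing1 k, (typeOne_drawing1 k).1, ?_⟩,
      isNestedLabeling_drawing1 k, internalSeparation_drawing1 k, externalSeparation_drawing1 k,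
      isNestedAlmostConvex_drawing1 k⟩
    · rw [drawing1_eq] at hp
      obtain ⟨u, hu, rfl⟩ := hp
      exact ⟨isIntegerPoint_nodePoint hu.2, abs_nodePoint_le hu⟩
    · rw [drawing1_eq, ← truncation_forest1]
      exact (injOn_nodePoint k).bijOn_image
  · refine ⟨?_, (typeTwo_drawing2 hk).2, isTypeTwoLabeling_drawing2 hk,
      isNestedLabeling_drawing2 k, internalSeparation_drawing2 hk, externalSeparation_drawing2 hk,
      isNestedAlmostConvex_drawing2 k⟩
    rw [drawing1_eq, drawing2_eq]
    exact Set.image_mono (truncation_forest2_subset k)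
  · rcases hX.classification with ⟨h1, hn, x, hx, hs⟩ | ⟨h2, hn, x, hx, hs⟩
    · have hpow : 1 ≤ 2 ^ numLayers X := Nat.one_le_two_pow
      have hn2 : X.ncard + 2 = 2 ^ (numLayers X + 1) := by rw [hn, pow_succ]; omega
      obtain ⟨hd, hb, he⟩ := isDrawing_and_computable forest1 subset_rfl hx hs (Or.inl ⟨rfl, hn2⟩)
        (by rw [hn]; exact enumNode_image_forest1 _)
      rw [← drawing1_eq] at hd hb he
      exact ⟨_, hd, hb, Or.inl ⟨h1, hn, rfl⟩, he⟩
    · have hpow : 1 ≤ 2 ^ (numLayers X - 1) := Nat.one_le_two_pow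
      have hn2 : X.ncard + 2 = 3 * 2 ^ (numLayers X - 1) := by rw [hn]; omega
      obtain ⟨hd, hb, he⟩ := isDrawing_and_computable forest2 forest2_subset_forest1 hx hs
        (Or.inr ⟨rfl, h2.1, hn2⟩) (by rw [hn]; exact enumNode_image_forest2 h2.1)
      rw [← drawing2_eq] at hd hb he
      exact ⟨_, hd, hb, Or.inr ⟨h2, hn, rfl⟩, he⟩
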